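/- Let $k$ be an algebraically closed field of characteristic $p>0$, and let $R$ be a commutative $k$-algebra essentially of finite type. Choose a presentation $R=T/I$ with $T$ a localization of a polynomial algebra $k[X_1,\dots,X_n]$, and let $$T^1_{R/k}=\operatorname{coker}\bigl(\operatorname{Hom}_R(\Omega_{T/k}\otimes_T R,R)\to \operatorname{Hom}_R(I/I^2,R)\bigr)$$ be the first cotangent module. For a local artinian $k$-algebra $A$ with residue field $k$, let $\operatorname{HS}^A(R)$ be the group of $A$-algebra automorphisms of $A\otimes_k R$ inducing the identity on $A/\mathfrak m_A\otimes_k R$. Let $$\Phi:\ 0\to k\cdot t\to A'\to A\to 0$$ be a small extension, i.e. $A'\to A$ is a surjective homomorphism of local artinian $k$-algebras with residue field $k$ whose kernel is $k\cdot t$, where $t\neq 0$ and $\mathfrak m_{A'}t=0$. For $D\in\operatorname{HS}^A(R)$ choose a lift $E\in \operatorname{HS}^{A'}(T)$ of $D$; the composite $\varphi_E: T\to A'\otimes_k T\to A'\otimes_k R$ of $x\mapsto E(1\otimes x)$ with the projection satisfies $\varphi_E(x)=t\otimes f_E(x)$ for $x\in I$ with an $R$-linear map $f_E:I/I^2\to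 R$, and $\operatorname{ob}_\Phi(D)\in T^1_{R/k}$ is the class of $f_E$. Let $\operatorname{Ob}^\Phi_R\subset T^1_{R/k}$ be the image of $\operatorname{ob}_\Phi$. For $m\ge 1$, let $\operatorname{HS}^m(R)$ be the set of Hasse-Schmidt derivations $(D_0=\operatorname{id},D_1,\dots,D_m)$ of $R$ over $k$ of length $m$. For $D\in \operatorname{HS}^{m-1}(R)$ (where $\operatorname{HS}^0(R)=\{\operatorname{id}\}$) choose $E\in\operatorname{HS}^m(T)$ with $E_i$ lifting $D_i$ for $i<m$; then $\operatorname{ob}_m(D)\in T^1_{R/k}$ is the class of $I/I^2\to R$, $x\mapsto E_m(x) \bmod I$. Let $\operatorname{Ob}^m_R\subset T^1_{R/k}$ be the image of $\operatorname{ob}_m$ (so $\operatorname{Ob}^1_R=0$). Let $i(\Phi)$ be the largest integer $i$ such that $p^i$ divides some positive integer $n$ for which there is $x\in\mathfrak m_{A'}$ with $0\ne x^n\in k\cdot t$, and put $q=p^{i(\Phi)}$. Then $$\operatorname{Ob}^\Phi_R=\operatorname{Ob}^q_R .$$ In particular, $\operatorname{Ob}^\Phi_R$ is a finitely generated module over the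 subring $R^q=\{r^q : r\in R\}$ of $R$ (a finitely generated $R^q$-submodule of $T^1_{R/k}$), and for every multiplicatively closed subset $S\subset R$, with $S^q=\{s^q : s\in S\}$, the canonical map $T^1_{R/k}\to T^1_{S^{-1}R/k}$ induces $$(S^q)^{-1}\operatorname{Ob}^\Phi_R=\operatorname{Ob}^\Phi_{S^{-1}R}.$$ -/

import Mathlib

open scoped TensorProduct

universe v w

noncomputable section

namespace SmallExtOb

/-! ### The first cotangent module, computed from a presentation `R = T / I` -/

section Cotangent

variable (k : Type*) (T : Type*) (R : Type*) [Field k] [CommRing T] [CommRing R]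
  [Algebra k T] [Algebra T R]

/-- `T` is a localization of a polynomial algebra `k[X₁, …, Xₙ]`. -/
def IsLocalizationOfPolynomial : Prop :=
  ∃ (n : ℕ) (f : MvPolynomial (Fin n) k →ₐ[k] T) (M : Submonoid (MvPolynomial (Fin n) k)),
    @IsLocalization _ _ M T _ f.toRingHom.toAlgebra

/-- The ideal `I = ker (T → R)` of the presentation. -/
abbrev relIdeal : Ideal T := RingHom.ker (algebraMap T R)

/-- `Hom_R(I / I², R)`. As `T → R` is going to be surjective and `I` kills `I / I²`, the `T`-linear
maps `I / I² → R` are the `R`-linear ones. -/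
abbrev ConormalDual : Type _ := (relIdeal T R).Cotangent →ₗ[T] R

variable [Algebra k R] [IsScalarTower k T R]

/-- The map `Hom_R(R ⊗_T Ω_{T/k}, R) → Hom_R(I / I², R)` dual to the conormal map
`I / I² → R ⊗_T Ω_{T/k}`, `x ↦ 1 ⊗ dx`. -/
def conormalDualMap : ((R ⊗[T] Ω[T⁄k]) →ₗ[R] R) →ₗ[R] ConormalDual T R where
  toFun g := g.restrictScalars T ∘ₗ KaehlerDifferential.kerCotangentToTensor k T R
  map_add' _ _ := rfl
  map_smul' _ _ := rfl

/-- The first cotangent module `T¹_{R/k}`, as the cokernel of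
`Hom_R(R ⊗_T Ω_{T/k}, R) → Hom_R(I / I², R)`. -/
def T1 : Type _ := ConormalDual T R ⧸ LinearMap.range (conormalDualMap k T R)

instance : AddCommGroup (T1 k T R) :=
  inferInstanceAs (AddCommGroup (ConormalDual T R ⧸ LinearMap.range (conormalDualMap k T R)))

/-- The `R`-module structure of the cokernel, and its restriction of scalars along any
`R₀ → R`. -/
instance {R₀ : Type*} [CommRing R₀] [Algebra R₀ R] : Module R₀ (T1 k T R) :=
  letI : Module R (T1 k T R) :=
    inferInstanceAs (Module R (ConormalDual T R ⧸ LinearMap.range (conormalDualMap k T R)))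
  Module.compHom _ (algebraMap R₀ R)

/-- The projection `Hom_R(I / I², R) → T¹_{R/k}`. -/
def T1.mk : ConormalDual T R →ₗ[R] T1 k T R where
  toFun := (LinearMap.range (conormalDualMap k T R)).mkQ
  map_add' := map_add _
  map_smul' r f := ((LinearMap.range (conormalDualMap k T R)).mkQ).map_smul r f

end Cotangent

/-! ### Hasse-Schmidt derivations of finite length and the modules `Ob^m` -/

/-- A Hasse-Schmidt derivation `(D₀, …, Dₘ)` of length `m`; the sequence is continued by zero. -/
structure HasseSchmidt (k : Type*) (R : Type*) [Field k] [CommRing R] [Algebra k R] (m : ℕ) where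
  /-- The components. -/
  comp : ℕ → R →ₗ[k] R
  comp_zero : comp 0 = LinearMap.id
  leibniz : ∀ i ≤ m, ∀ x y : R,
    comp i (x * y) = ∑ jl ∈ Finset.HasAntidiagonal.antidiagonal i, comp jl.1 x * comp jl.2 y
  comp_of_lt : ∀ i, m < i → comp i = 0

section Ob

variable (k : Type*) (T : Type*) (R : Type*) [Field k] [CommRing T] [CommRing R]
  [Algebra k T] [Algebra T R] [Algebra k R] [IsScalarTower k T R]

/-- `τ` is the obstruction `ob_m(D)` of `D ∈ HS^{m-1}(R)`, `m ≥ 1`: for a lift `E ∈ HS^m(T)` of `D`,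
the map `φ_E : T → R[ε]/ε^{m+1}`, `x ↦ ∑ᵢ (Eᵢ x mod I) εⁱ`, sends `x ∈ I` to `f(x) ε^m`,
that is, `f(x) = E_m x mod I`, and `τ` is the class of `f : I / I² → R`. -/
def IsHSObstruction (m : ℕ) (D : HasseSchmidt k R (m - 1)) (τ : T1 k T R) : Prop :=
  ∃ E : HasseSchmidt k T m,
    (∀ i < m, ∀ x : T, algebraMap T R (E.comp i x) = D.comp i (algebraMap T R x)) ∧
    ∃ f : ConormalDual T R,
      (∀ x : relIdeal T R, algebraMap T R (E.comp m x) = f ((relIdeal T R).toCotangent x)) ∧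
      T1.mk k T R f = τ

/-- `Ob^m_R ⊆ T¹_{R/k}`, the image of `ob_m`, for `m ≥ 1`. -/
def obHS (m : ℕ) : Set (T1 k T R) := {τ | ∃ D, IsHSObstruction k T R m D τ}

end Ob

/-! ### Small extensions, the groups `HS^A(R)` and the modules `Ob^Φ` -/

/-- The group `HS^A(R)` of `A`-algebra automorphisms of `A ⊗ R` that induce the identity of
`A/𝔪_A ⊗ R`. -/
def HS (k : Type*) (A : Type*) (R : Type*) [Field k] [CommRing A] [Algebra k A] [IsLocalRing A]
    [CommRing R] [Algebra k R] : Subgroup ((A ⊗[k] R) ≃ₐ[A] (A ⊗[k] R)) where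
  carrier := {D | ∀ x,
    Algebra.TensorProduct.map (IsScalarTower.toAlgHom k A (IsLocalRing.ResidueField A))
      (AlgHom.id k R) (D x) =
    Algebra.TensorProduct.map (IsScalarTower.toAlgHom k A (IsLocalRing.ResidueField A))
      (AlgHom.id k R) x}
  one_mem' _ := rfl
  mul_mem' {D E} hD hE x := (hD (E x)).trans (hE x)
  inv_mem' {D} hD x := by
    have h := hD (D⁻¹ x)
    rw [← AlgEquiv.mul_apply, mul_inv_cancel, AlgEquiv.one_apply] at h
    exact h.symm

/-- A small extension `0 → k·t → A' → A → 0`. -/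
structure SmallExtension (k : Type*) (A' : Type*) (A : Type*) [Field k] [CommRing A'] [Algebra k A']
    [IsLocalRing A'] [CommRing A] [Algebra k A] where
  /-- The surjection `A' → A`. -/
  hom : A' →ₐ[k] A
  /-- The generator of the kernel. -/
  t : A'
  surjective : Function.Surjective hom
  t_ne_zero : t ≠ 0
  maximalIdeal_mul_t : ∀ x ∈ IsLocalRing.maximalIdeal A', x * t = 0
  hom_eq_zero_iff : ∀ x, hom x = 0 ↔ ∃ c : k, x = c • t

namespace SmallExtension

variable {k : Type*} {A' : Type*} {A : Type*} [Field k] [CommRing A'] [Algebra k A']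
  [IsLocalRing A'] [CommRing A] [Algebra k A] (Φ : SmallExtension k A' A)

/-- The positive integers `n` such that `0 ≠ xⁿ ∈ k·t` for some `x ∈ 𝔪_{A'}`. -/
def exponents : Set ℕ :=
  {n | 0 < n ∧ ∃ x ∈ IsLocalRing.maximalIdeal A', (∃ c : k, x ^ n = c • Φ.t) ∧ x ^ n ≠ 0}

/-- `i(Φ)`: the largest `i` such that `p ^ i` divides some element of `Φ.exponents`. -/
def index (p : ℕ) : ℕ := sSup {i | ∃ n ∈ Φ.exponents, p ^ i ∣ n}

/-- The supremum in the definition of `i(Φ)` is a maximum. -/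
theorem isGreatest_index [Nontrivial A] [IsArtinianRing A'] (p : ℕ) (hp : 1 < p) :
    IsGreatest {i | ∃ n ∈ Φ.exponents, p ^ i ∣ n} (Φ.index p) := by
  have hne : {i | ∃ n ∈ Φ.exponents, p ^ i ∣ n}.Nonempty := by
    refine ⟨0, 1, ⟨one_pos, Φ.t, ?_, ⟨1, by simp⟩, by simpa using Φ.t_ne_zero⟩, by simp⟩
    rw [IsLocalRing.mem_maximalIdeal, mem_nonunits_iff]
    intro ht
    have h0 : Φ.hom Φ.t = 0 := (Φ.hom_eq_zero_iff _).2 ⟨1, by simp⟩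
    exact not_isUnit_zero (h0 ▸ ht.map Φ.hom)
  have hbdd : BddAbove {i | ∃ n ∈ Φ.exponents, p ^ i ∣ n} := by
    obtain ⟨N, hN⟩ := IsArtinianRing.isNilpotent_jacobson_bot (R := A')
    rw [IsLocalRing.jacobson_eq_maximalIdeal ⊥ bot_ne_top] at hN
    refine ⟨N, ?_⟩
    rintro i ⟨n, ⟨hn, x, hx, -, hx0⟩, hd⟩
    by_contra! hlt
    have h1 : N ≤ n := (hlt.trans (Nat.lt_pow_self hp)).le.trans (Nat.le_of_dvd hn hd)
    apply hx0
    have h2 : x ^ N ∈ IsLocalRing.maximalIdeal A' ^ N := Ideal.pow_mem_pow hx N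
    rw [hN] at h2
    exact pow_eq_zero_of_le h1 (by simpa using h2)
  exact ⟨Nat.sSup_mem hne hbdd, fun i hi ↦ le_csSup hbdd hi⟩

variable (T : Type*) (R : Type*) [CommRing T] [CommRing R]
  [Algebra k T] [Algebra T R] [Algebra k R] [IsScalarTower k T R] [IsLocalRing A]

/-- `τ` is the obstruction `ob_Φ(D)` of `D ∈ HS^A(R)`: for a lift `E ∈ HS^{A'}(T)` of `D`,
the map `φ_E : T → A' ⊗ T → A' ⊗ R` sends `x ∈ I` to `t ⊗ f(x)`, and `τ` is the class of
`f : I / I² → R`. -/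
def IsObstruction (D : HS k A R) (τ : T1 k T R) : Prop :=
  ∃ E : HS k A' T,
    (∀ x : A' ⊗[k] T,
      Algebra.TensorProduct.map Φ.hom (IsScalarTower.toAlgHom k T R) (E.1 x) =
        D.1 (Algebra.TensorProduct.map Φ.hom (IsScalarTower.toAlgHom k T R) x)) ∧
    ∃ f : ConormalDual T R,
      (∀ x : relIdeal T R,
        Algebra.TensorProduct.map (AlgHom.id k A') (IsScalarTower.toAlgHom k T R)
          (E.1 ((1 : A') ⊗ₜ[k] (x : T))) = Φ.t ⊗ₜ[k] f ((relIdeal T R).toCotangent x)) ∧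
      T1.mk k T R f = τ

/-- `Ob^Φ_R ⊆ T¹_{R/k}`, the image of `ob_Φ`. -/
def ob : Set (T1 k T R) := {τ | ∃ D, Φ.IsObstruction T R D τ}

end SmallExtension

/-! ### Powers and localization -/

/-- The subring `R^q` of `q`-th powers, `q = p ^ i`, where `p` is the characteristic of `k`. -/
def powSubring (k : Type*) [Field k] (p : ℕ) [Fact p.Prime] [CharP k p]
    (R : Type*) [CommRing R] [Algebra k R] (i : ℕ) : Subring R where
  carrier := {x | ∃ y : R, y ^ p ^ i = x}
  one_mem' := ⟨1, one_pow _⟩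
  zero_mem' := ⟨0, zero_pow (pow_ne_zero _ (Fact.out : p.Prime).ne_zero)⟩
  mul_mem' := by
    rintro _ _ ⟨a, rfl⟩ ⟨b, rfl⟩
    exact ⟨a * b, mul_pow _ _ _⟩
  add_mem' := by
    rintro _ _ ⟨a, rfl⟩ ⟨b, rfl⟩
    refine ⟨a + b, ?_⟩
    cases subsingleton_or_nontrivial R
    · exact Subsingleton.elim _ _
    · have : CharP R p := charP_of_injective_algebraMap (algebraMap k R).injective p
      exact add_pow_char_pow a b p i
  neg_mem' := by
    rintro _ ⟨a, rfl⟩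
    refine ⟨-a, ?_⟩
    cases subsingleton_or_nontrivial R
    · exact Subsingleton.elim _ _
    · have : CharP R p := charP_of_injective_algebraMap (algebraMap k R).injective p
      have h := add_pow_char_pow (-a) a p i
      rw [neg_add_cancel, zero_pow (pow_ne_zero _ (Fact.out : p.Prime).ne_zero)] at h
      exact eq_neg_of_add_eq_zero_left h.symm

/-- The multiplicative subset `S^q = {s^q | s ∈ S}` of `R^q`, `q = p ^ i`. -/
def powSubmonoid (k : Type*) [Field k] (p : ℕ) [Fact p.Prime] [CharP k p]
    {R : Type*} [CommRing R] [Algebra k R] (i : ℕ) (S : Submonoid R) :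
    Submonoid (powSubring k p R i) :=
  (S.map (powMonoidHom (p ^ i))).comap (powSubring k p R i).subtype

section Localization

variable (k : Type*) {T : Type*} {R : Type*} [Field k] [CommRing T] [CommRing R]
  [Algebra k T] [Algebra T R] [Algebra k R] [IsScalarTower k T R]
  {T' : Type*} {R' : Type*} [CommRing T'] [CommRing R']
  [Algebra k T'] [Algebra T' R'] [Algebra k R'] [IsScalarTower k T' R']
  [Algebra T T'] [Algebra R R']

/-- `u : T¹_{R/k} → T¹_{R'/k}` is the canonical map to a localization `R' = S⁻¹R`, where
`T' → R'` is the localization of the presentation `T → R`: it sends the class of `f : I / I² → R` to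
the class of the localization `f' : I' / I'² → R'` of `f`. (As `I` generates `I'`, at most one `f'`
extends a given `f`.) -/
def IsLocalizationMap (u : T1 k T R →ₗ[R] T1 k T' R') : Prop :=
  ∀ f : ConormalDual T R, ∃ f' : ConormalDual T' R',
    (∀ (x : relIdeal T R) (x' : relIdeal T' R'), (x' : T') = algebraMap T T' x →
      f' ((relIdeal T' R').toCotangent x') = algebraMap R R' (f ((relIdeal T R).toCotangent x))) ∧
    u (T1.mk k T R f) = T1.mk k T' R' f'

end Localization

end SmallExtOb

end

set_option linter.unusedSectionVars false

noncomputable section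

namespace SmallExtOb

/-! ### Base change of endomorphisms and automorphisms of `A ⊗ R` -/

section BaseChange

variable {k A B C R S : Type*} [Field k] [CommRing A] [Algebra k A] [CommRing B] [Algebra k B]
  [CommRing C] [Algebra k C] [CommRing R] [Algebra k R] [CommRing S] [Algebra k S]

/-! Obstructions turn products into sums. If `E` and `E'` lift `D` and `D'`, then `E * E'` lifts `D
* D'`, and the terms they produce at `t` add up, because `t` kills the maximal ideal. So `ob_Φ` is a
homomorphism from `HS^A(R)` to `T¹`. It vanishes exactly on the automorphisms that lift to
`HS^{A'}(R)`, and it is compatible with morphisms of small extensions. Hence `Ob^Φ` is known once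
generators of `HS^A(R)` are.

The generators are values of curves. A curve `G` is an element of `HS` over `k[ε]/εⁿ`, that is, a
Hasse-Schmidt derivation of length `n - 1`. Its value at `y` with `yⁿ = 0` is the base change along
`ε ↦ y`. If `y'` lifts `y` to `A'` and `y'ⁿ = c t`, then `ob_Φ(G(y)) = c ob(G)`
(`SmallExtension.isObstruction_subst`). Curves with `n = p ^ (j + 1)` suffice
(`approximableByCurves`). A value with `c ≠ 0` makes `p ^ (j + 1)` an exponent of `Φ`, so `j + 1 ≤
i(Φ)`, and its obstruction lies in `Ob^q` because `Ob^(p^i)` increases with `i`. Conversely, if `0 ≠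
xⁿ ∈ k t` with `q ∣ n`, some scalar multiple `y` of `x^(n/q)` satisfies `y^q = t`, and substituting
it in curves realizes all of `Ob^q`.

Generation rests on two facts. First, only powers of `p` obstruct. For other `n` the map `c ↦ cⁿ` is
not additive, and rescalings of a curve combine to one with the same first order part and no
obstruction (`HS.exists_extension_of_ne_pow`). Second, there is an induction on `A` through `A/(t)`,
with `t` in the socle. Modulo `t` an automorphism is approximated by some `G(y)`. If `y^(p^(j+1)) =
c t ≠ 0` in `A` and `y` cannot be corrected, comparing obstructions puts `ob(G)` in `Ob^(p^j)`. Then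
the first order part of `G` extends far enough to be evaluated at `y` (`approximableByCurves_step`).

For the module statements, multiplying the `i`-th component of a Hasse-Schmidt derivation by `aⁱ`
makes `Ob^q` stable under `R^q`, over which `R` and hence `T¹` is finite. The same scaling clears
the denominators of a derivation of a localization, at the cost of a factor `s^q`. -/

/-- The `A`-algebra endomorphism of `A ⊗ R` that extends `φ : R → A ⊗ R`. -/
def extend (φ : R →ₐ[k] A ⊗[k] R) : A ⊗[k] R →ₐ[A] A ⊗[k] R :=
  Algebra.TensorProduct.lift (Algebra.ofId A _) φ fun _ _ ↦ Commute.all _ _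

@[simp]
theorem extend_tmul (φ : R →ₐ[k] A ⊗[k] R) (a : A) (r : R) :
    extend φ (a ⊗ₜ r) = a • φ r := by
  simp [extend, Algebra.ofId_apply, Algebra.smul_def]

theorem extend_one_tmul (φ : R →ₐ[k] A ⊗[k] R) (r : R) : extend φ (1 ⊗ₜ r) = φ r := by simp

theorem map_tmul_eq_smul {F : Type*} [FunLike F (A ⊗[k] R) (A ⊗[k] R)]
    [LinearMapClass F A (A ⊗[k] R) (A ⊗[k] R)] (D : F) (a : A) (r : R) :
    D (a ⊗ₜ r) = a • D (1 ⊗ₜ r) := by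
  rw [← map_smul, TensorProduct.smul_tmul', smul_eq_mul, mul_one]

/-- `h ⊗ u : A ⊗ R → B ⊗ S`. -/
abbrev tmap (h : A →ₐ[k] B) (u : R →ₐ[k] S) : A ⊗[k] R →ₐ[k] B ⊗[k] S :=
  Algebra.TensorProduct.map h u

theorem tmap_smul (h : A →ₐ[k] B) (u : R →ₐ[k] S) (a : A) (x : A ⊗[k] R) :
    tmap h u (a • x) = h a • tmap h u x := by
  rw [Algebra.smul_def, map_mul, Algebra.smul_def]
  simp

theorem tmap_tmap {Q : Type*} [CommRing Q] [Algebra k Q] (h : A →ₐ[k] B) (u : R →ₐ[k] S)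
    (h' : B →ₐ[k] C) (u' : S →ₐ[k] Q) (x : A ⊗[k] R) :
    tmap h' u' (tmap h u x) = tmap (h'.comp h) (u'.comp u) x := by
  induction x with
  | zero => simp
  | add x y hx hy => simp only [map_add, hx, hy]
  | tmul a r => simp

theorem tmap_id (x : A ⊗[k] R) : tmap (AlgHom.id k A) (AlgHom.id k R) x = x := by
  simp [tmap]

/-- The base change of an endomorphism. -/
def endBaseChange (h : A →ₐ[k] B) (φ : A ⊗[k] R →ₐ[A] A ⊗[k] R) : B ⊗[k] R →ₐ[B] B ⊗[k] R :=
  extend ((tmap h (AlgHom.id k R)).comp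
    ((φ.restrictScalars k).comp Algebra.TensorProduct.includeRight))

theorem endBaseChange_one_tmul (h : A →ₐ[k] B) (φ : A ⊗[k] R →ₐ[A] A ⊗[k] R) (r : R) :
    endBaseChange h φ (1 ⊗ₜ r) = tmap h (AlgHom.id k R) (φ (1 ⊗ₜ r)) := by
  simp [endBaseChange]

theorem end_ext {φ ψ : A ⊗[k] R →ₐ[A] A ⊗[k] R} (H : ∀ r : R, φ (1 ⊗ₜ r) = ψ (1 ⊗ₜ r)) :
    φ = ψ :=
  Algebra.TensorProduct.ext' fun a r ↦ by rw [map_tmul_eq_smul, map_tmul_eq_smul ψ, H]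

theorem aut_ext {D E : (A ⊗[k] R) ≃ₐ[A] (A ⊗[k] R)} (H : ∀ r : R, D (1 ⊗ₜ r) = E (1 ⊗ₜ r)) :
    D = E :=
  AlgEquiv.ext fun x ↦ DFunLike.congr_fun (end_ext (φ := (D : A ⊗[k] R →ₐ[A] A ⊗[k] R))
    (ψ := (E : A ⊗[k] R →ₐ[A] A ⊗[k] R)) H) x

theorem endBaseChange_tmap (h : A →ₐ[k] B) (φ : A ⊗[k] R →ₐ[A] A ⊗[k] R) (x : A ⊗[k] R) :
    endBaseChange h φ (tmap h (AlgHom.id k R) x) = tmap h (AlgHom.id k R) (φ x) := by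
  induction x with
  | zero => simp
  | add x y hx hy => simp only [map_add, hx, hy]
  | tmul a r =>
    rw [map_tmul_eq_smul φ, tmap_smul, ← endBaseChange_one_tmul, ← map_tmul_eq_smul]
    simp

theorem endBaseChange_comp (h : A →ₐ[k] B) (φ ψ : A ⊗[k] R →ₐ[A] A ⊗[k] R) :
    endBaseChange h (φ.comp ψ) = (endBaseChange h φ).comp (endBaseChange h ψ) :=
  end_ext fun r ↦ by
    rw [AlgHom.comp_apply, endBaseChange_one_tmul, endBaseChange_one_tmul, endBaseChange_tmap,
      AlgHom.comp_apply]

theorem endBaseChange_id (h : A →ₐ[k] B) :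
    endBaseChange h (AlgHom.id A (A ⊗[k] R)) = AlgHom.id B (B ⊗[k] R) :=
  end_ext fun r ↦ by simp [endBaseChange_one_tmul]

/-- The base change of automorphisms. -/
def baseChange (h : A →ₐ[k] B) :
    ((A ⊗[k] R) ≃ₐ[A] (A ⊗[k] R)) →* ((B ⊗[k] R) ≃ₐ[B] (B ⊗[k] R)) where
  toFun D := AlgEquiv.ofAlgHom (endBaseChange h D) (endBaseChange h D.symm)
    (by rw [← endBaseChange_comp, AlgEquiv.comp_symm, endBaseChange_id])
    (by rw [← endBaseChange_comp, AlgEquiv.symm_comp, endBaseChange_id])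
  map_one' := aut_ext fun r ↦ by
    change endBaseChange h (AlgHom.id A (A ⊗[k] R)) (1 ⊗ₜ r) = _
    rw [endBaseChange_id]
    rfl
  map_mul' D E := aut_ext fun r ↦ by
    change endBaseChange h ((D * E : _ ≃ₐ[A] _) : A ⊗[k] R →ₐ[A] A ⊗[k] R) (1 ⊗ₜ r) =
      endBaseChange h (D : A ⊗[k] R →ₐ[A] A ⊗[k] R)
        (endBaseChange h (E : A ⊗[k] R →ₐ[A] A ⊗[k] R) (1 ⊗ₜ r))
    simp only [endBaseChange_one_tmul, endBaseChange_tmap]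
    rfl

theorem baseChange_one_tmul (h : A →ₐ[k] B) (D : (A ⊗[k] R) ≃ₐ[A] (A ⊗[k] R)) (r : R) :
    baseChange h D (1 ⊗ₜ r) = tmap h (AlgHom.id k R) (D (1 ⊗ₜ r)) :=
  endBaseChange_one_tmul h _ r

theorem baseChange_tmap (h : A →ₐ[k] B) (D : (A ⊗[k] R) ≃ₐ[A] (A ⊗[k] R)) (x : A ⊗[k] R) :
    baseChange h D (tmap h (AlgHom.id k R) x) = tmap h (AlgHom.id k R) (D x) :=
  endBaseChange_tmap h _ x

theorem baseChange_baseChange (h : A →ₐ[k] B) (h' : B →ₐ[k] C)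
    (D : (A ⊗[k] R) ≃ₐ[A] (A ⊗[k] R)) :
    baseChange h' (baseChange h D) = baseChange (h'.comp h) D :=
  aut_ext fun r ↦ by simp only [baseChange_one_tmul, tmap_tmap, AlgHom.id_comp]

theorem baseChange_id (D : (A ⊗[k] R) ≃ₐ[A] (A ⊗[k] R)) : baseChange (AlgHom.id k A) D = D :=
  aut_ext fun r ↦ by rw [baseChange_one_tmul, tmap_id]

theorem baseChange_eq_one_iff (h : A →ₐ[k] B) (D : (A ⊗[k] R) ≃ₐ[A] (A ⊗[k] R)) :
    baseChange h D = 1 ↔ ∀ r : R, tmap h (AlgHom.id k R) (D (1 ⊗ₜ r)) = 1 ⊗ₜ r := by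
  simp only [← baseChange_one_tmul]
  exact ⟨fun H r ↦ by rw [H]; rfl, fun H ↦ aut_ext H⟩

end BaseChange

/-! ### The groups `HS^A(R)` -/

section HSGroup

variable {k A B R : Type*} [Field k] [CommRing A] [Algebra k A] [IsLocalRing A]
  [CommRing B] [Algebra k B] [IsLocalRing B] [CommRing R] [Algebra k R]

variable (k A) in
/-- The map from `A` to its residue field. -/
abbrev toResidue : A →ₐ[k] IsLocalRing.ResidueField A :=
  IsScalarTower.toAlgHom k A (IsLocalRing.ResidueField A)

theorem mem_HS_iff_baseChange {D : (A ⊗[k] R) ≃ₐ[A] (A ⊗[k] R)} :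
    D ∈ HS k A R ↔ baseChange (toResidue k A) D = 1 := by
  constructor
  · intro H
    rw [baseChange_eq_one_iff]
    intro r
    rw [H]
    simp
  · intro H x
    rw [← baseChange_tmap, H]
    rfl

theorem mem_HS_iff {D : (A ⊗[k] R) ≃ₐ[A] (A ⊗[k] R)} :
    D ∈ HS k A R ↔ ∀ r : R, tmap (toResidue k A) (AlgHom.id k R) (D (1 ⊗ₜ r)) = 1 ⊗ₜ r := by
  rw [mem_HS_iff_baseChange, baseChange_eq_one_iff]

theorem baseChange_mem_HS (h : A →ₐ[k] B) [IsLocalHom h] {D : (A ⊗[k] R) ≃ₐ[A] (A ⊗[k] R)}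
    (hD : D ∈ HS k A R) : baseChange h D ∈ HS k B R := by
  rw [mem_HS_iff_baseChange] at hD ⊢
  have : IsLocalHom (h : A →+* B) := ⟨fun a ha ↦ IsLocalHom.map_nonunit (f := h) a ha⟩
  let h' : IsLocalRing.ResidueField A →ₐ[k] IsLocalRing.ResidueField B :=
    { IsLocalRing.ResidueField.map (h : A →+* B) with
      commutes' := fun c ↦ by
        change IsLocalRing.ResidueField.map (h : A →+* B)
          (IsLocalRing.residue A (algebraMap k A c)) = IsLocalRing.residue B (algebraMap k B c)
        rw [IsLocalRing.ResidueField.map_residue]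
        simp }
  have : (toResidue k B).comp h = h'.comp (toResidue k A) := by
    ext a
    exact (IsLocalRing.ResidueField.map_residue (h : A →+* B) a).symm
  rw [baseChange_baseChange, this, ← baseChange_baseChange, hD, map_one]

/-- Base change along a local homomorphism `A → B`, as a homomorphism `HS^A(R) → HS^B(R)`. -/
def HS.map (h : A →ₐ[k] B) [IsLocalHom h] : HS k A R →* HS k B R :=
  ((baseChange h).comp (HS k A R).subtype).codRestrict _ fun D ↦ baseChange_mem_HS h D.2

@[simp]
theorem HS.coe_map (h : A →ₐ[k] B) [IsLocalHom h] (D : HS k A R) :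
    (HS.map h D : (B ⊗[k] R) ≃ₐ[B] (B ⊗[k] R)) = baseChange h D.1 := rfl

/-- Right exactness of the tensor product, phrased with `A`-submodules so that induction on `a • y`
with `a ∈ ker h` becomes available. -/
theorem mem_of_tmap_eq_zero {A B R : Type*} [CommRing A] [Algebra k A] [CommRing B] [Algebra k B]
    [CommRing R] [Algebra k R] {h : A →ₐ[k] B} (hh : Function.Surjective h) {x : A ⊗[k] R}
    (hx : tmap h (AlgHom.id k R) x = 0) : x ∈ RingHom.ker h • (⊤ : Submodule A (A ⊗[k] R)) := by
  have hx' : x ∈ RingHom.ker (tmap h (AlgHom.id k R)) := hx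
  rw [Algebra.TensorProduct.rTensor_ker h hh, Ideal.map] at hx'
  clear hx
  induction hx' using Submodule.span_induction with
  | mem x hx =>
    obtain ⟨a, ha, rfl⟩ := hx
    have : (Algebra.TensorProduct.includeLeft : A →ₐ[k] A ⊗[k] R) a = a • 1 := by
      simp [Algebra.TensorProduct.one_def, TensorProduct.smul_tmul']
    rw [this]
    exact Submodule.smul_mem_smul ha trivial
  | zero => exact zero_mem _
  | add x y _ _ hx hy => exact add_mem hx hy
  | smul a x hx' hx =>
    clear hx'
    rw [smul_eq_mul]
    induction hx using Submodule.smul_induction_on' with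
    | smul j hj y _ =>
      rw [mul_smul_comm]
      exact Submodule.smul_mem_smul hj trivial
    | add x _ y _ hx hy => rw [mul_add]; exact add_mem hx hy

theorem toResidue_surjective : Function.Surjective (toResidue k A) :=
  IsLocalRing.residue_surjective

theorem ker_toResidue : RingHom.ker (toResidue k A) = IsLocalRing.maximalIdeal A :=
  IsLocalRing.ker_residue

theorem mem_maximalIdeal_smul_top {x : A ⊗[k] R}
    (hx : tmap (toResidue k A) (AlgHom.id k R) x = 0) :
    x ∈ IsLocalRing.maximalIdeal A • (⊤ : Submodule A (A ⊗[k] R)) := by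
  rw [← ker_toResidue (k := k)]
  exact mem_of_tmap_eq_zero toResidue_surjective hx

theorem tmap_toResidue_smul {a : A} (ha : a ∈ IsLocalRing.maximalIdeal A) (x : A ⊗[k] R) :
    tmap (toResidue k A) (AlgHom.id k R) (a • x) = 0 := by
  rw [← ker_toResidue (k := k)] at ha
  rw [tmap_smul, show toResidue k A a = 0 from ha, zero_smul]

theorem isNilpotent_maximalIdeal [IsArtinianRing A] :
    IsNilpotent (IsLocalRing.maximalIdeal A) := by
  have h := IsArtinianRing.isNilpotent_jacobson_bot (R := A)
  rwa [IsLocalRing.jacobson_eq_maximalIdeal ⊥ bot_ne_top] at h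

theorem isNilpotent_of_mem_maximalIdeal [IsArtinianRing A] {a : A}
    (ha : a ∈ IsLocalRing.maximalIdeal A) : IsNilpotent a := by
  obtain ⟨n, hn⟩ := isNilpotent_maximalIdeal (A := A)
  exact ⟨n, by simpa [hn] using Ideal.pow_mem_pow ha n⟩

theorem isNilpotent_of_tmap_toResidue_eq_zero [IsArtinianRing A] {x : A ⊗[k] R}
    (hx : tmap (toResidue k A) (AlgHom.id k R) x = 0) : IsNilpotent x := by
  have h := mem_maximalIdeal_smul_top hx
  clear hx
  induction h using Submodule.smul_induction_on' with
  | smul a ha y _ =>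
    rw [← one_mul y, ← smul_mul_assoc, ← Algebra.algebraMap_eq_smul_one]
    exact (Commute.all _ _).isNilpotent_mul_right
      ((isNilpotent_of_mem_maximalIdeal ha).map (algebraMap A (A ⊗[k] R)))
  | add x _ y _ hx hy => exact (Commute.all x y).isNilpotent_add hx hy

/-- An endomorphism of `A ⊗ R` that is the identity modulo `𝔪_A` is bijective. -/
theorem bijective_of_residue [IsArtinianRing A] (φ : A ⊗[k] R →ₐ[A] A ⊗[k] R)
    (hφ : ∀ r : R, tmap (toResidue k A) (AlgHom.id k R) (φ (1 ⊗ₜ r)) = 1 ⊗ₜ r) :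
    Function.Bijective φ := by
  -- `φ = 1 + N`, and `N` raises the `𝔪_A`-adic filtration, so it is nilpotent.
  let N : Module.End A (A ⊗[k] R) := φ.toLinearMap - 1
  have hN : ∀ x, N x ∈ IsLocalRing.maximalIdeal A • (⊤ : Submodule A (A ⊗[k] R)) := by
    intro x
    induction x with
    | zero => simp
    | add x y hx hy => rw [map_add]; exact add_mem hx hy
    | tmul a r =>
      have : a ⊗ₜ[k] r = a • ((1 : A) ⊗ₜ[k] r) := by
        rw [TensorProduct.smul_tmul', smul_eq_mul, mul_one]
      rw [this, map_smul]
      refine Submodule.smul_mem _ _ (mem_maximalIdeal_smul_top ?_)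
      simp [N, hφ]
  have hpow : ∀ (n : ℕ) (x), (N ^ n) x ∈
      IsLocalRing.maximalIdeal A ^ n • (⊤ : Submodule A (A ⊗[k] R)) := by
    intro n
    induction n with
    | zero => intro x; rw [pow_zero, Ideal.one_eq_top, Submodule.top_smul]; trivial
    | succ n ih =>
      intro x
      rw [pow_succ' N n, Module.End.mul_apply]
      have := ih x
      generalize (N ^ n) x = z at this ⊢
      induction this using Submodule.smul_induction_on' with
      | smul a ha y _ =>
        rw [map_smul, pow_succ, Submodule.mul_smul]
        exact Submodule.smul_mem_smul ha (hN y)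
      | add x _ y _ hx hy => rw [map_add]; exact add_mem hx hy
  obtain ⟨n, hn⟩ := isNilpotent_maximalIdeal (A := A)
  have hnil : IsNilpotent N := ⟨n, LinearMap.ext fun x ↦ by simpa [hn] using hpow n x⟩
  have hu : IsUnit (1 + N) := hnil.isUnit_one_add
  rw [Module.End.isUnit_iff] at hu
  simpa [N] using hu

/-- The element of `HS^A(R)` given by `φ : R → A ⊗ R` that is the identity modulo `𝔪_A`. -/
def HS.mk [IsArtinianRing A] (φ : R →ₐ[k] A ⊗[k] R)
    (hφ : ∀ r : R, tmap (toResidue k A) (AlgHom.id k R) (φ r) = 1 ⊗ₜ r) : HS k A R :=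
  ⟨AlgEquiv.ofBijective (extend φ) (bijective_of_residue _ fun r ↦ by
    rw [extend_one_tmul, hφ]), mem_HS_iff.2 fun r ↦ by
      rw [AlgEquiv.coe_ofBijective, extend_one_tmul, hφ]⟩

theorem HS.mk_one_tmul [IsArtinianRing A] (φ : R →ₐ[k] A ⊗[k] R)
    (hφ : ∀ r : R, tmap (toResidue k A) (AlgHom.id k R) (φ r) = 1 ⊗ₜ r) (r : R) :
    (HS.mk φ hφ).1 (1 ⊗ₜ r) = φ r :=
  extend_one_tmul φ r

/-- The restriction to `R` of an element of `HS^A(R)`. -/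
def HS.toAlgHom (D : HS k A R) : R →ₐ[k] A ⊗[k] R :=
  ((D.1 : A ⊗[k] R →ₐ[A] A ⊗[k] R).restrictScalars k).comp Algebra.TensorProduct.includeRight

@[simp]
theorem HS.toAlgHom_apply (D : HS k A R) (r : R) : HS.toAlgHom D r = D.1 (1 ⊗ₜ r) := rfl

theorem HS.ext' {D E : HS k A R} (H : ∀ r : R, D.1 (1 ⊗ₜ r) = E.1 (1 ⊗ₜ r)) : D = E :=
  Subtype.ext (aut_ext H)

end HSGroup

/-! ### Automorphisms `1 + t ∂` -/

section OneAdd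

variable {k A B R : Type*} [Field k] [CommRing A] [Algebra k A]
  [CommRing B] [Algebra k B] [CommRing R] [Algebra k R]

/-- The homomorphism `r ↦ 1 ⊗ r + t ⊗ ∂ r`, where `t² = 0`. -/
def oneAddHom (t : A) (ht : t * t = 0) (d : Derivation k R R) : R →ₐ[k] A ⊗[k] R where
  toFun r := 1 ⊗ₜ r + t ⊗ₜ d r
  map_one' := by simp [Algebra.TensorProduct.one_def]
  map_mul' x y := by
    simp only [Derivation.leibniz, smul_eq_mul, mul_add, add_mul, TensorProduct.tmul_add,
      Algebra.TensorProduct.tmul_mul_tmul, one_mul, mul_one, ht, TensorProduct.zero_tmul, add_zero]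
    rw [mul_comm (d x) y]
    abel
  map_zero' := by simp
  map_add' x y := by simp only [map_add, TensorProduct.tmul_add]; abel
  commutes' c := by
    rw [Derivation.map_algebraMap, TensorProduct.tmul_zero, add_zero,
      Algebra.TensorProduct.algebraMap_apply, Algebra.TensorProduct.tmul_one_eq_one_tmul]

/-- The automorphism `1 + t ∂` of `A ⊗ R`, where `t² = 0`. -/
def oneAdd (t : A) (ht : t * t = 0) (d : Derivation k R R) : (A ⊗[k] R) ≃ₐ[A] (A ⊗[k] R) :=
  AlgEquiv.ofAlgHom (extend (oneAddHom t ht d)) (extend (oneAddHom t ht (-d)))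
    (end_ext fun r ↦ by
      simp [oneAddHom, TensorProduct.smul_tmul', TensorProduct.tmul_neg, ht])
    (end_ext fun r ↦ by
      simp [oneAddHom, TensorProduct.smul_tmul', TensorProduct.tmul_neg, ht])

theorem oneAdd_one_tmul (t : A) (ht : t * t = 0) (d : Derivation k R R) (r : R) :
    oneAdd t ht d (1 ⊗ₜ r) = 1 ⊗ₜ r + t ⊗ₜ d r := by
  change extend (oneAddHom t ht d) (1 ⊗ₜ r) = _
  rw [extend_one_tmul]
  rfl

theorem baseChange_oneAdd (h : A →ₐ[k] B) (t : A) (ht : t * t = 0) (d : Derivation k R R) :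
    baseChange h (oneAdd t ht d) = oneAdd (h t) (by rw [← map_mul, ht, map_zero]) d :=
  aut_ext fun r ↦ by simp [baseChange_one_tmul, oneAdd_one_tmul]

theorem oneAdd_zero (d : Derivation k R R) : oneAdd (0 : A) (mul_zero 0) d = 1 :=
  aut_ext fun r ↦ by simp [oneAdd_one_tmul]

/-- The cross term is `s t ∂²`, which is zero. -/
theorem oneAdd_mul (s t : A) (hs : s * s = 0) (ht : t * t = 0) (hst : s * t = 0)
    (d : Derivation k R R) :
    oneAdd s hs d * oneAdd t ht d = oneAdd (s + t) (by linear_combination hs + ht + 2 * hst) d :=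
  aut_ext fun r ↦ by
    rw [AlgEquiv.mul_apply, oneAdd_one_tmul, oneAdd_one_tmul, map_add, map_tmul_eq_smul _ t,
      oneAdd_one_tmul, oneAdd_one_tmul, smul_add, TensorProduct.smul_tmul',
      TensorProduct.smul_tmul', smul_eq_mul, smul_eq_mul, mul_comm t s, hst,
      TensorProduct.zero_tmul, mul_one, TensorProduct.add_tmul]
    abel

theorem oneAdd_congr {s t : A} (h : s = t) (hs : s * s = 0) (d : Derivation k R R)
    (ht : t * t = 0) : oneAdd s hs d = oneAdd t ht d := by
  subst h
  rfl

theorem oneAdd_inv (t : A) (ht : t * t = 0) (d : Derivation k R R) :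
    (oneAdd t ht d)⁻¹ = oneAdd (-t) (by rw [neg_mul_neg, ht]) d := by
  refine inv_eq_of_mul_eq_one_right ?_
  rw [oneAdd_mul t (-t) ht _ (by rw [mul_neg, ht, neg_zero]),
    oneAdd_congr (add_neg_cancel t) _ d (mul_zero 0), oneAdd_zero]

theorem oneAdd_mem_HS [IsLocalRing A] {t : A} (ht : t * t = 0) (d : Derivation k R R) :
    oneAdd t ht d ∈ HS k A R := by
  have htm : t ∈ IsLocalRing.maximalIdeal A := by
    rw [IsLocalRing.mem_maximalIdeal, mem_nonunits_iff]
    intro hu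
    have := (hu.mul hu)
    rw [ht] at this
    exact not_isUnit_zero this
  rw [mem_HS_iff_baseChange, baseChange_oneAdd]
  have h0 : toResidue k A t = 0 := by
    rw [← ker_toResidue (k := k)] at htm
    exact htm
  simp only [h0, oneAdd_zero]

end OneAdd

end SmallExtOb

namespace SmallExtOb

/-! ### Homomorphisms from a localization of a polynomial algebra -/

section Presentation

variable {k T C C₀ : Type*} [Field k] [CommRing T] [Algebra k T] [CommRing C] [Algebra k C]
  [CommRing C₀] [Algebra k C₀] {n : ℕ} (f : MvPolynomial (Fin n) k →ₐ[k] T)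
  {M : Submonoid (MvPolynomial (Fin n) k)}

theorem algHom_ext_of_isLocalization
    (hf : @IsLocalization _ _ M T _ f.toRingHom.toAlgebra) {φ ψ : T →ₐ[k] C}
    (h : ∀ i, φ (f (MvPolynomial.X i)) = ψ (f (MvPolynomial.X i))) : φ = ψ := by
  have h1 : φ.comp f = ψ.comp f := MvPolynomial.algHom_ext h
  let _ := f.toRingHom.toAlgebra
  have h2 : (φ : T →+* C) = ψ := IsLocalization.ringHom_ext M
    (RingHom.ext fun x ↦ DFunLike.congr_fun h1 x)
  exact AlgHom.ext fun x ↦ DFunLike.congr_fun h2 x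

/-- Images of the coordinates may be chosen freely. Elements of `M` go to units because they do so
after the local map `ρ`. This gives all the smoothness of `T` that is needed. -/
theorem exists_algHom_of_isLocalization
    (hf : @IsLocalization _ _ M T _ f.toRingHom.toAlgebra) (ρ : C →ₐ[k] C₀) [IsLocalHom ρ]
    (ψ : T →ₐ[k] C₀) (c : Fin n → C) (hc : ∀ i, ρ (c i) = ψ (f (MvPolynomial.X i))) :
    ∃ φ : T →ₐ[k] C, (∀ i, φ (f (MvPolynomial.X i)) = c i) ∧ ρ.comp φ = ψ := by
  have h1 : ρ.comp (MvPolynomial.aeval c) = ψ.comp f :=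
    MvPolynomial.algHom_ext fun i ↦ by simp [hc]
  let _ := f.toRingHom.toAlgebra
  have hM : ∀ y : M, IsUnit ((MvPolynomial.aeval c : _ →ₐ[k] C).toRingHom (y : _)) := by
    intro y
    refine isUnit_of_map_unit ρ _ ?_
    have h2 : IsUnit (ψ (f (y : MvPolynomial (Fin n) k))) :=
      (IsLocalization.map_units T y).map ψ
    have h3 := DFunLike.congr_fun h1 (y : MvPolynomial (Fin n) k)
    simp only [AlgHom.comp_apply] at h3
    rw [← h3] at h2
    exact h2
  have key : ∀ x, (IsLocalization.lift hM : T →+* C) (f x) = MvPolynomial.aeval c x :=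
    fun x ↦ IsLocalization.lift_eq hM x
  let φ : T →ₐ[k] C :=
    { (IsLocalization.lift hM : T →+* C) with
      commutes' := fun r ↦ by
        have := key (MvPolynomial.C r)
        rw [← MvPolynomial.algebraMap_eq, AlgHom.commutes, AlgHom.commutes] at this
        exact this }
  have hφ : ∀ i, φ (f (MvPolynomial.X i)) = c i := fun i ↦ by
    rw [← MvPolynomial.aeval_X (R := k) c i]
    exact key _
  refine ⟨φ, hφ, algHom_ext_of_isLocalization f hf fun i ↦ ?_⟩
  rw [AlgHom.comp_apply, hφ, hc]

end Presentation

/-- A homomorphism out of an artinian local ring is local. -/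
instance isLocalHom_of_isArtinianRing {k A B : Type*} [Field k] [CommRing A] [Algebra k A]
    [IsLocalRing A] [IsArtinianRing A] [CommRing B] [Algebra k B] [Nontrivial B] (h : A →ₐ[k] B) :
    IsLocalHom h where
  map_nonunit a ha := by
    by_contra hu
    obtain ⟨n, hn⟩ := (isNilpotent_of_mem_maximalIdeal (A := A) (a := a) hu).map h
    have := ha.pow n
    rw [hn] at this
    exact not_isUnit_zero this

/-- The kernel is nil: if `b` lifts the inverse of the image of `a`, then `a * b` is `1` plus a
nilpotent. -/
instance isLocalHom_tmap_toResidue {k A R : Type*} [Field k] [CommRing A] [Algebra k A]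
    [IsLocalRing A] [IsArtinianRing A] [CommRing R] [Algebra k R] :
    IsLocalHom (tmap (toResidue k A) (AlgHom.id k R)) where
  map_nonunit a ha := by
    obtain ⟨u, hu⟩ := ha
    obtain ⟨b, hb⟩ : ∃ b, tmap (toResidue k A) (AlgHom.id k R) b = ↑u⁻¹ :=
      TensorProduct.map_surjective (g := (toResidue k A).toLinearMap)
      (toResidue_surjective (k := k) (A := A)) (g' := (AlgHom.id k R).toLinearMap) Function.surjective_id
      (↑u⁻¹ : IsLocalRing.ResidueField A ⊗[k] R)
    have h1 : tmap (toResidue k A) (AlgHom.id k R) (a * b - 1) = 0 := by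
      rw [map_sub, map_mul, map_one, ← hu, hb, Units.mul_inv, sub_self]
    have h2 : IsUnit (a * b) := by
      have := (isNilpotent_of_tmap_toResidue_eq_zero h1).isUnit_add_one
      rwa [sub_add_cancel] at this
    exact isUnit_of_mul_isUnit_left h2

section Lift

variable {k T R : Type*} [Field k] [CommRing T] [CommRing R]
  [Algebra k T] [Algebra T R] [Algebra k R] [IsScalarTower k T R]

variable (k T R) in
/-- The projection `T → R`. -/
abbrev pr : T →ₐ[k] R := IsScalarTower.toAlgHom k T R

variable {A B : Type*} [CommRing A] [Algebra k A] [CommRing B] [Algebra k B]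

/-- An automorphism of `A ⊗ T` lifts one of `B ⊗ R`. -/
def Lifts (h : A →ₐ[k] B) (E : (A ⊗[k] T) ≃ₐ[A] (A ⊗[k] T)) (D : (B ⊗[k] R) ≃ₐ[B] (B ⊗[k] R)) :
    Prop :=
  ∀ x : A ⊗[k] T, tmap h (pr k T R) (E x) = D (tmap h (pr k T R) x)

theorem lifts_iff {h : A →ₐ[k] B} {E : (A ⊗[k] T) ≃ₐ[A] (A ⊗[k] T)}
    {D : (B ⊗[k] R) ≃ₐ[B] (B ⊗[k] R)} :
    Lifts h E D ↔ ∀ y : T, tmap h (pr k T R) (E (1 ⊗ₜ y)) = D (1 ⊗ₜ algebraMap T R y) := by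
  constructor
  · intro H y
    rw [H]
    simp
  · intro H x
    induction x with
    | zero => simp
    | add x y hx hy => simp only [map_add, hx, hy]
    | tmul a r =>
      rw [map_tmul_eq_smul E, tmap_smul, H, ← map_tmul_eq_smul]
      simp

theorem Lifts.mul {h : A →ₐ[k] B} {E E' : (A ⊗[k] T) ≃ₐ[A] (A ⊗[k] T)}
    {D D' : (B ⊗[k] R) ≃ₐ[B] (B ⊗[k] R)} (H : Lifts h E D) (H' : Lifts h E' D') :
    Lifts h (E * E') (D * D') := fun x ↦ by
  rw [AlgEquiv.mul_apply, H, H', AlgEquiv.mul_apply]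

theorem Lifts.baseChange {A' B' : Type*} [CommRing A'] [Algebra k A'] [CommRing B'] [Algebra k B']
    {h : A →ₐ[k] B} {E : (A ⊗[k] T) ≃ₐ[A] (A ⊗[k] T)}
    {D : (B ⊗[k] R) ≃ₐ[B] (B ⊗[k] R)} (H : Lifts h E D) {h' : A' →ₐ[k] B'} (a : A →ₐ[k] A')
    (b : B →ₐ[k] B') (hab : h'.comp a = b.comp h) :
    Lifts h' (SmallExtOb.baseChange a E) (SmallExtOb.baseChange b D) := by
  rw [lifts_iff] at H ⊢
  intro y
  rw [baseChange_one_tmul, baseChange_one_tmul, ← H, tmap_tmap, tmap_tmap, hab, AlgHom.comp_id,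
    AlgHom.id_comp]

/-- Elements of `HS^B(R)` lift to `HS^A(T)`. -/
theorem exists_lifts (hT : IsLocalizationOfPolynomial k T)
    (hTR : Function.Surjective (algebraMap T R)) [IsLocalRing A] [IsArtinianRing A]
    [IsLocalRing B] {h : A →ₐ[k] B} (hh : Function.Surjective h) (D : HS k B R) :
    ∃ E : HS k A T, Lifts h E.1 D.1 := by
  obtain ⟨n, f, M, hf⟩ := hT
  have hsurj : Function.Surjective (tmap h (pr k T R)) :=
    TensorProduct.map_surjective (g := h.toLinearMap) hh (g' := (pr k T R).toLinearMap) hTR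
  -- The correction terms must be lifted inside `𝔪_A ⊗ T`, so that the resulting endomorphism is the
  -- identity modulo `𝔪_A`.
  have hlift : ∀ z : B ⊗[k] R, tmap (toResidue k B) (AlgHom.id k R) z = 0 →
      ∃ e : A ⊗[k] T, tmap (toResidue k A) (AlgHom.id k T) e = 0 ∧ tmap h (pr k T R) e = z := by
    intro z hz
    have hz' := mem_maximalIdeal_smul_top hz
    clear hz
    induction hz' using Submodule.smul_induction_on' with
    | smul b hb y _ =>
      obtain ⟨a, rfl⟩ := hh b
      obtain ⟨e, rfl⟩ := hsurj y
      have ha : a ∈ IsLocalRing.maximalIdeal A := fun hu ↦ hb (hu.map h)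
      exact ⟨a • e, tmap_toResidue_smul ha e, tmap_smul _ _ _ _⟩
    | add x _ y _ hx hy =>
      obtain ⟨e, he, rfl⟩ := hx
      obtain ⟨e', he', rfl⟩ := hy
      exact ⟨e + e', by rw [map_add, he, he', add_zero], map_add _ _ _⟩
  have hD : ∀ i, ∃ e : A ⊗[k] T, tmap (toResidue k A) (AlgHom.id k T) e = 0 ∧
      tmap h (pr k T R) e = D.1 (1 ⊗ₜ algebraMap T R (f (MvPolynomial.X i))) -
        1 ⊗ₜ algebraMap T R (f (MvPolynomial.X i)) := fun i ↦ by
    apply hlift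
    rw [map_sub, mem_HS_iff.1 D.2]
    simp
  choose e he he' using hD
  obtain ⟨φ, hφ, hφ'⟩ := exists_algHom_of_isLocalization f hf
    (tmap (toResidue k A) (AlgHom.id k T)) Algebra.TensorProduct.includeRight
    (fun i ↦ 1 ⊗ₜ f (MvPolynomial.X i) + e i) (fun i ↦ by rw [map_add, he]; simp)
  have hres : ∀ r : T, tmap (toResidue k A) (AlgHom.id k T) (φ r) = 1 ⊗ₜ r :=
    fun r ↦ DFunLike.congr_fun hφ' r
  refine ⟨HS.mk φ hres, lifts_iff.2 fun y ↦ ?_⟩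
  rw [HS.mk_one_tmul]
  have : (tmap h (pr k T R)).comp φ = (HS.toAlgHom D).comp (pr k T R) :=
    algHom_ext_of_isLocalization f hf fun i ↦ by
      rw [AlgHom.comp_apply, hφ, map_add, he']
      simp
  exact DFunLike.congr_fun this y

end Lift

/-! ### Coefficients at `t` -/

namespace SmallExtension

variable {k A' A : Type*} [Field k] [CommRing A'] [Algebra k A'] [IsLocalRing A'] [CommRing A]
  [Algebra k A] (Φ : SmallExtension k A' A)

theorem exists_dual : ∃ l : A' →ₗ[k] k, l Φ.t = 1 := by
  obtain ⟨l, hl⟩ := Module.Projective.exists_dual_ne_zero k Φ.t_ne_zero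
  exact ⟨(l Φ.t)⁻¹ • l, by simp [hl]⟩

/-- A `k`-linear map `A' ⊗ R → R` that sends `t ⊗ r` to `r`. -/
def coeff (R : Type*) [CommRing R] [Algebra k R] : A' ⊗[k] R →ₗ[k] R :=
  (TensorProduct.lid k R).toLinearMap ∘ₗ LinearMap.rTensor R Φ.exists_dual.choose

@[simp]
theorem coeff_t_tmul {R : Type*} [CommRing R] [Algebra k R] (r : R) :
    Φ.coeff R (Φ.t ⊗ₜ r) = r := by
  simp [coeff, Φ.exists_dual.choose_spec]

theorem t_tmul_injective {R : Type*} [CommRing R] [Algebra k R] {r s : R}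
    (h : Φ.t ⊗ₜ[k] r = Φ.t ⊗ₜ[k] s) : r = s := by
  simpa using congrArg (Φ.coeff R) h

theorem t_mem_maximalIdeal [Nontrivial A] : Φ.t ∈ IsLocalRing.maximalIdeal A' := by
  intro hu
  have h := hu.map Φ.hom
  rw [(Φ.hom_eq_zero_iff _).2 ⟨1, (one_smul _ _).symm⟩] at h
  exact not_isUnit_zero h

@[simp]
theorem hom_t : Φ.hom Φ.t = 0 := (Φ.hom_eq_zero_iff _).2 ⟨1, (one_smul _ _).symm⟩

theorem t_mul_t [Nontrivial A] : Φ.t * Φ.t = 0 := Φ.maximalIdeal_mul_t _ Φ.t_mem_maximalIdeal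

/-- The kernel of `A' ⊗ R → A ⊗ R` is `(k t) • (A' ⊗ R)`, and `t a ∈ k t` for all `a`. This gives
every such element a well defined coefficient at `t`. -/
theorem eq_t_tmul {R : Type*} [CommRing R] [Algebra k R] {x : A' ⊗[k] R}
    (hx : tmap Φ.hom (AlgHom.id k R) x = 0) : x = Φ.t ⊗ₜ Φ.coeff R x := by
  have h := mem_of_tmap_eq_zero Φ.surjective hx
  clear hx
  induction h using Submodule.smul_induction_on' with
  | smul a ha y _ =>
    obtain ⟨c, rfl⟩ := (Φ.hom_eq_zero_iff a).1 ha
    have key : ∀ y : A' ⊗[k] R, ∃ r, (c • Φ.t) • y = Φ.t ⊗ₜ r := by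
      intro y
      induction y with
      | zero => exact ⟨0, by simp⟩
      | add x y hx hy =>
        obtain ⟨r, hr⟩ := hx
        obtain ⟨s, hs⟩ := hy
        exact ⟨r + s, by rw [smul_add, hr, hs, TensorProduct.tmul_add]⟩
      | tmul a r =>
        obtain ⟨d, hd⟩ := (Φ.hom_eq_zero_iff (Φ.t * a)).1 (by rw [map_mul, hom_t, zero_mul])
        refine ⟨c • d • r, ?_⟩
        rw [TensorProduct.smul_tmul', smul_eq_mul, smul_mul_assoc, hd, TensorProduct.tmul_smul,
          TensorProduct.tmul_smul, TensorProduct.smul_tmul', TensorProduct.smul_tmul']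
    obtain ⟨r, hr⟩ := key y
    rw [hr, coeff_t_tmul]
  | add x _ y _ hx hy => rw [map_add, TensorProduct.tmul_add, ← hx, ← hy]

/-- Multiplication by `t` kills what vanishes modulo `𝔪`. -/
theorem t_smul_eq_zero {R : Type*} [CommRing R] [Algebra k R] {x : A' ⊗[k] R}
    (hx : tmap (toResidue k A') (AlgHom.id k R) x = 0) : Φ.t • x = 0 := by
  have h := mem_maximalIdeal_smul_top hx
  clear hx
  induction h using Submodule.smul_induction_on' with
  | smul a ha y _ => rw [smul_smul, mul_comm, Φ.maximalIdeal_mul_t a ha, zero_smul]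
  | add x _ y _ hx hy => rw [smul_add, hx, hy, add_zero]

end SmallExtension

end SmallExtOb

namespace SmallExtOb

/-! ### `T¹` and derivations `T → R` -/

section T1

variable {k T R : Type*} [Field k] [CommRing T] [CommRing R]
  [Algebra k T] [Algebra T R] [Algebra k R] [IsScalarTower k T R]

theorem T1.mk_surjective : Function.Surjective (T1.mk k T R) :=
  Submodule.mkQ_surjective _

theorem T1.mk_eq_zero_iff {f : ConormalDual T R} :
    T1.mk k T R f = 0 ↔ ∃ g, conormalDualMap k T R g = f :=
  Submodule.Quotient.mk_eq_zero _

theorem conormalDualMap_toCotangent (g : (R ⊗[T] Ω[T⁄k]) →ₗ[R] R) (x : relIdeal T R) :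
    conormalDualMap k T R g ((relIdeal T R).toCotangent x) =
      g (1 ⊗ₜ KaehlerDifferential.D k T x) := by
  rw [← KaehlerDifferential.kerCotangentToTensor_toCotangent]
  rfl

theorem ConormalDual.ext {f g : ConormalDual T R}
    (h : ∀ x, f ((relIdeal T R).toCotangent x) = g ((relIdeal T R).toCotangent x)) : f = g :=
  LinearMap.ext fun y ↦ by
    obtain ⟨x, rfl⟩ := (relIdeal T R).toCotangent_surjective y
    exact h x

/-- By the universal property of `Ω`, homomorphisms `R ⊗ Ω → R` are derivations `T → R`. -/
theorem T1.mk_eq_zero_iff_derivation {f : ConormalDual T R} :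
    T1.mk k T R f = 0 ↔
      ∃ d : Derivation k T R, ∀ x : relIdeal T R, f ((relIdeal T R).toCotangent x) = d x := by
  rw [T1.mk_eq_zero_iff]
  constructor
  · rintro ⟨g, rfl⟩
    refine ⟨((g.restrictScalars T).comp
      ((TensorProduct.mk T R (Ω[T⁄k])) 1)).compDer (KaehlerDifferential.D k T), fun x ↦ ?_⟩
    rw [conormalDualMap_toCotangent]
    rfl
  · rintro ⟨d, hd⟩
    refine ⟨d.liftKaehlerDifferential.liftBaseChange R, ConormalDual.ext fun x ↦ ?_⟩
    rw [conormalDualMap_toCotangent, hd, LinearMap.liftBaseChange_tmul, one_smul,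
      Derivation.liftKaehlerDifferential_comp_D]

end T1

/-- The kernel is the ideal generated by `1 ⊗ I`. As `I` is an ideal of `T`, the `A`-span of `1 ⊗ I`
is already that ideal, so `A`-linear maps can be checked on `1 ⊗ I`. -/
theorem mem_span_of_tmap_id_eq_zero {k A T R : Type*} [Field k] [CommRing A] [Algebra k A]
    [CommRing T] [CommRing R] [Algebra k T] [Algebra k R] {u : T →ₐ[k] R}
    (hu : Function.Surjective u) {x : A ⊗[k] T} (hx : tmap (AlgHom.id k A) u x = 0) :
    x ∈ Submodule.span A {z | ∃ i ∈ RingHom.ker u, (1 : A) ⊗ₜ[k] i = z} := by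
  have hx' : x ∈ RingHom.ker (tmap (AlgHom.id k A) u) := hx
  rw [Algebra.TensorProduct.lTensor_ker u hu, Ideal.map] at hx'
  clear hx
  induction hx' using Submodule.span_induction with
  | mem x hx => exact Submodule.subset_span hx
  | zero => exact zero_mem _
  | add x y _ _ hx hy => exact add_mem hx hy
  | smul a x hx' hx =>
    clear hx'
    rw [smul_eq_mul]
    induction hx using Submodule.span_induction with
    | mem x hx =>
      obtain ⟨i, hi, rfl⟩ := hx
      induction a with
      | zero => rw [zero_mul]; exact zero_mem _
      | add x y hx hy => rw [add_mul]; exact add_mem hx hy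
      | tmul a b =>
        rw [Algebra.TensorProduct.tmul_mul_tmul, mul_one, ← mul_one a, ← smul_eq_mul,
          ← TensorProduct.smul_tmul']
        exact Submodule.smul_mem _ _ (Submodule.subset_span ⟨_, Ideal.mul_mem_left _ _ hi, rfl⟩)
    | zero => rw [mul_zero]; exact zero_mem _
    | add x y _ _ hx hy => rw [mul_add]; exact add_mem hx hy
    | smul c x _ hx => rw [mul_smul_comm]; exact Submodule.smul_mem _ _ hx

namespace SmallExtension

/-! ### `ob_Φ` as a homomorphism, its kernel and its functoriality -/

section Obstruction

variable {k A' A T R : Type*} [Field k] [CommRing A'] [Algebra k A'] [IsLocalRing A'] [CommRing A]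
  [Algebra k A] [IsLocalRing A] (Φ : SmallExtension k A' A)
  [CommRing T] [CommRing R] [Algebra k T] [Algebra T R] [Algebra k R] [IsScalarTower k T R]

/-- `f : I / I² → R` is the homomorphism given by `E` in the definition of the obstruction. -/
def Induces (E : HS k A' T) (f : ConormalDual T R) : Prop :=
  ∀ x : relIdeal T R, tmap (AlgHom.id k A') (pr k T R) (E.1 (1 ⊗ₜ (x : T))) =
    Φ.t ⊗ₜ f ((relIdeal T R).toCotangent x)

theorem isObstruction_iff {D : HS k A R} {τ : T1 k T R} :
    Φ.IsObstruction T R D τ ↔ ∃ E : HS k A' T, Lifts Φ.hom E.1 D.1 ∧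
      ∃ f, Φ.Induces E f ∧ T1.mk k T R f = τ := Iff.rfl

/-- `E` is the identity modulo `𝔪_{A'}`, which `t` kills; after multiplication by `t`, `E` is
invisible. -/
theorem t_smul_map_one_tmul (E : HS k A' T) (y : T) :
    Φ.t • tmap (AlgHom.id k A') (pr k T R) (E.1 (1 ⊗ₜ y)) = Φ.t ⊗ₜ algebraMap T R y := by
  have h : Φ.t • (E.1 (1 ⊗ₜ y) - 1 ⊗ₜ y) = 0 := Φ.t_smul_eq_zero (by
    rw [map_sub, mem_HS_iff.1 E.2]
    simp)
  rw [smul_sub, sub_eq_zero, TensorProduct.smul_tmul', smul_eq_mul, mul_one] at h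
  have h2 := congrArg (tmap (AlgHom.id k A') (pr k T R)) h
  rw [tmap_smul] at h2
  simpa using h2

theorem t_tmul_mul_map (E : HS k A' T) (r : R) (y : T) :
    (Φ.t ⊗ₜ r) * tmap (AlgHom.id k A') (pr k T R) (E.1 (1 ⊗ₜ y)) =
      Φ.t ⊗ₜ (r * algebraMap T R y) := by
  have : Φ.t ⊗ₜ[k] r = Φ.t • ((1 : A') ⊗ₜ[k] r) := by
    rw [TensorProduct.smul_tmul', smul_eq_mul, mul_one]
  rw [this, smul_mul_assoc, ← mul_smul_comm, t_smul_map_one_tmul,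
    Algebra.TensorProduct.tmul_mul_tmul, one_mul]

/-- If the composite of `E` with the projection to `A' ⊗ R` sends `I` to `t ⊗ R`, then it induces
a homomorphism `I / I² → R`. -/
theorem exists_induces (E : HS k A' T)
    (hE : ∀ x : relIdeal T R, tmap Φ.hom (pr k T R) (E.1 (1 ⊗ₜ (x : T))) = 0) :
    ∃ f : ConormalDual T R, Φ.Induces E f := by
  let π := tmap (AlgHom.id k A') (pr k T R)
  have h1 : ∀ x : relIdeal T R,
      π (E.1 (1 ⊗ₜ (x : T))) = Φ.t ⊗ₜ Φ.coeff R (π (E.1 (1 ⊗ₜ (x : T)))) := fun x ↦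
    Φ.eq_t_tmul (by rw [tmap_tmap]; exact hE x)
  let f₀ : relIdeal T R →ₗ[T] R :=
    { toFun := fun x ↦ Φ.coeff R (π (E.1 (1 ⊗ₜ (x : T))))
      map_add' := fun x y ↦ by simp only [Submodule.coe_add, TensorProduct.tmul_add, map_add]
      map_smul' := fun y x ↦ by
        have : (1 : A') ⊗ₜ[k] ((y • x : relIdeal T R) : T) = (1 ⊗ₜ (x : T)) * (1 ⊗ₜ y) := by
          simp [mul_comm]
        rw [this, map_mul, map_mul, h1 x, t_tmul_mul_map, coeff_t_tmul, coeff_t_tmul,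
          RingHom.id_apply, Algebra.smul_def, mul_comm] }
  refine ⟨Ideal.Cotangent.lift f₀ fun x y ↦ ?_, fun x ↦ ?_⟩
  · have hx : algebraMap T R x = 0 := x.2
    have : x * y = (x : T) • y := Subtype.ext (by simp)
    rw [this, map_smul, Algebra.smul_def, hx, zero_mul]
  · rw [Ideal.Cotangent.lift_toCotangent]
    exact h1 x

/-- Every element of `HS^A(R)` has an obstruction. -/
theorem exists_isObstruction [IsArtinianRing A'] (hT : IsLocalizationOfPolynomial k T)
    (hTR : Function.Surjective (algebraMap T R)) (D : HS k A R) :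
    ∃ τ, Φ.IsObstruction T R D τ := by
  obtain ⟨E, hE⟩ := exists_lifts hT hTR Φ.surjective D
  obtain ⟨f, hf⟩ := Φ.exists_induces E fun x ↦ by
    have hx : algebraMap T R x = 0 := x.2
    rw [lifts_iff.1 hE, hx, TensorProduct.tmul_zero, map_zero]
  exact ⟨_, E, hE, f, hf, rfl⟩

variable {Φ}

/-- An extension of `f` to a `k`-linear map `T → R` computes `E` on the ideal of `A' ⊗ R`. -/
theorem Induces.apply_eq (hTR : Function.Surjective (algebraMap T R)) {E : HS k A' T}
    {f : ConormalDual T R} (hf : Φ.Induces E f) {g : T →ₗ[k] R}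
    (hg : ∀ x : relIdeal T R, g x = f ((relIdeal T R).toCotangent x)) {z : A' ⊗[k] T}
    (hz : tmap (AlgHom.id k A') (pr k T R) z = 0) :
    tmap (AlgHom.id k A') (pr k T R) (E.1 z) = Φ.t • g.baseChange A' z := by
  have h := mem_span_of_tmap_id_eq_zero hTR hz
  clear hz
  induction h using Submodule.span_induction with
  | mem z hz =>
    obtain ⟨i, hi, rfl⟩ := hz
    rw [hf ⟨i, hi⟩, LinearMap.baseChange_tmul, ← hg ⟨i, hi⟩, TensorProduct.smul_tmul', smul_eq_mul,
      mul_one]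
  | zero => simp
  | add x y _ _ hx hy => rw [map_add, map_add, map_add, hx, hy, smul_add]
  | smul a x _ hx =>
    rw [map_smul, tmap_smul, map_smul, hx, smul_comm]
    rfl

/-- Write `E'(1 ⊗ x) = t ⊗ y + w`, where `y` lifts `f' x` and `w` vanishes in `A' ⊗ R`. Then `E`
leaves `t ⊗ y` unchanged and sends `w` to `t ⊗ f x`, since `t w = t (1 ⊗ x)`. -/
theorem Induces.mul (hTR : Function.Surjective (algebraMap T R)) {E E' : HS k A' T}
    {f f' : ConormalDual T R} (hf : Φ.Induces E f) (hf' : Φ.Induces E' f') :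
    Φ.Induces (E * E') (f + f') := by
  -- A `k`-linear extension of `f` to `T` allows `f` to be evaluated on all of `A' ⊗ T`, not only on
  -- `A' ⊗ I`.
  obtain ⟨g, hg⟩ := LinearMap.exists_extend (p := (relIdeal T R).restrictScalars k)
    ((f.restrictScalars k).comp
      ((relIdeal T R).toCotangent.restrictScalars k : (relIdeal T R).restrictScalars k →ₗ[k] _))
  have hg : ∀ x : relIdeal T R, g x = f ((relIdeal T R).toCotangent x) := fun x ↦
    DFunLike.congr_fun hg x
  intro x
  obtain ⟨y, hy⟩ := hTR (f' ((relIdeal T R).toCotangent x))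
  change tmap (AlgHom.id k A') (pr k T R) (E.1 (E'.1 (1 ⊗ₜ (x : T)))) = _
  have hw : tmap (AlgHom.id k A') (pr k T R) (E'.1 (1 ⊗ₜ (x : T)) - Φ.t ⊗ₜ y) = 0 := by
    rw [map_sub, hf' x, ← hy]
    simp
  have h1 := hf.apply_eq hTR hg hw
  have h2 : Φ.t • (E'.1 (1 ⊗ₜ (x : T)) - Φ.t ⊗ₜ y - 1 ⊗ₜ (x : T)) = 0 := by
    refine Φ.t_smul_eq_zero ?_
    have ht : toResidue k A' Φ.t = 0 := by
      have := Φ.t_mem_maximalIdeal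
      rw [← ker_toResidue (k := k)] at this
      exact this
    rw [map_sub, map_sub, mem_HS_iff.1 E'.2, Algebra.TensorProduct.map_tmul, ht]
    simp
  rw [smul_sub, sub_eq_zero, TensorProduct.smul_tmul', smul_eq_mul, mul_one] at h2
  rw [← map_smul, h2, LinearMap.baseChange_tmul, hg, map_sub, map_sub, map_tmul_eq_smul _ Φ.t,
    tmap_smul, AlgHom.id_apply, t_smul_map_one_tmul, hy, sub_eq_iff_eq_add] at h1
  rw [h1, LinearMap.add_apply, TensorProduct.tmul_add]

/-- A lift of the identity of `A ⊗ R` is of the form `1 + t ∂`. -/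
theorem exists_derivation_of_lifts_one {E : HS k A' T} (hE : Lifts (R := R) Φ.hom E.1 1) :
    ∃ d : Derivation k T R, ∀ y : T, tmap (AlgHom.id k A') (pr k T R) (E.1 (1 ⊗ₜ y)) =
      1 ⊗ₜ algebraMap T R y + Φ.t ⊗ₜ d y := by
  let φ : T →ₐ[k] A' ⊗[k] R := (tmap (AlgHom.id k A') (pr k T R)).comp (HS.toAlgHom E)
  have hφ' : ∀ y, φ y = tmap (AlgHom.id k A') (pr k T R) (E.1 (1 ⊗ₜ y)) := fun y ↦ rfl
  let d₀ : T →ₗ[k] R := (Φ.coeff R).comp (φ.toLinearMap -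
    (Algebra.TensorProduct.includeRight.comp (pr k T R)).toLinearMap)
  have hφ : ∀ y, φ y = 1 ⊗ₜ algebraMap T R y + Φ.t ⊗ₜ d₀ y := fun y ↦ by
    rw [← sub_eq_iff_eq_add']
    refine Φ.eq_t_tmul ?_
    rw [hφ', map_sub, tmap_tmap]
    have := lifts_iff.1 hE y
    rw [AlgEquiv.one_apply] at this
    rw [AlgHom.comp_id, AlgHom.id_comp, this]
    simp
  have hd : ∀ x y, d₀ (x * y) = x • d₀ y + y • d₀ x := fun x y ↦ by
    refine Φ.t_tmul_injective ?_
    have h1 : (Φ.t ⊗ₜ d₀ x) * φ y = Φ.t ⊗ₜ (d₀ x * algebraMap T R y) := Φ.t_tmul_mul_map E _ _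
    have h2 := map_mul φ x y
    rw [hφ (x * y), hφ x, add_mul, h1, hφ y, mul_add, Algebra.TensorProduct.tmul_mul_tmul,
      Algebra.TensorProduct.tmul_mul_tmul, one_mul, one_mul, map_mul, add_assoc,
      add_right_inj, ← TensorProduct.tmul_add] at h2
    rw [h2, Algebra.smul_def, Algebra.smul_def, mul_comm (d₀ x)]
  exact ⟨Derivation.mk' d₀ hd, hφ⟩

/-- Together with additivity this yields independence of the lift: two lifts of `D` differ by a lift
of the identity, which contributes a derivation. -/
theorem Induces.mk_eq_zero {E : HS k A' T} {f : ConormalDual T R} (hf : Φ.Induces E f)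
    (hE : Lifts (R := R) Φ.hom E.1 1) : T1.mk k T R f = 0 := by
  obtain ⟨d, hd⟩ := exists_derivation_of_lifts_one hE
  rw [T1.mk_eq_zero_iff_derivation]
  refine ⟨d, fun x ↦ Φ.t_tmul_injective ?_⟩
  have hx : algebraMap T R x = 0 := x.2
  rw [← hf x, hd, hx, TensorProduct.tmul_zero, zero_add]

/-- The elements of `HS^{A'}(R)` that become trivial in `HS^A(R)` are the `1 + t ∂`. -/
theorem exists_eq_oneAdd {D : HS k A' R} (hD : baseChange Φ.hom D.1 = 1) :
    ∃ d : Derivation k R R, D.1 = oneAdd Φ.t Φ.t_mul_t d := by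
  -- The trivial presentation with `T = R` and `I = 0`.
  obtain ⟨d, hd⟩ := exists_derivation_of_lifts_one (Φ := Φ) (T := R) (R := R) (E := D)
    (lifts_iff.2 fun y ↦ by
      rw [baseChange_eq_one_iff] at hD
      exact hD y)
  refine ⟨d, aut_ext fun r ↦ ?_⟩
  rw [oneAdd_one_tmul, ← tmap_id (D.1 _)]
  exact hd r

/-- An element of `HS^A(R)` whose obstruction vanishes lifts to `HS^{A'}(R)`. -/
theorem IsObstruction.exists_map_eq [IsArtinianRing A'] (hTR : Function.Surjective (algebraMap T R))
    {D : HS k A R} (h : Φ.IsObstruction T R D 0) :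
    ∃ D' : HS k A' R, HS.map Φ.hom D' = D := by
  obtain ⟨E, hE, f, hf, hfd⟩ := Φ.isObstruction_iff.1 h
  obtain ⟨d, hd⟩ := T1.mk_eq_zero_iff_derivation.1 hfd
  let ψ : T →ₐ[k] A' ⊗[k] R := (tmap (AlgHom.id k A') (pr k T R)).comp (HS.toAlgHom E)
  have hψ : ∀ y, ψ y = tmap (AlgHom.id k A') (pr k T R) (E.1 (1 ⊗ₜ y)) := fun y ↦ rfl
  have htψ : ∀ r y, (Φ.t ⊗ₜ r) * ψ y = Φ.t ⊗ₜ (r * algebraMap T R y) := Φ.t_tmul_mul_map E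
  have htt : ∀ r s : R, (Φ.t ⊗ₜ[k] r) * (Φ.t ⊗ₜ s) = 0 := fun r s ↦ by
    rw [Algebra.TensorProduct.tmul_mul_tmul, Φ.t_mul_t, TensorProduct.zero_tmul]
  -- On `I` the map `ψ` equals `t ⊗ f = t ⊗ d`. Subtracting `t ⊗ d` keeps it multiplicative and
  -- makes it kill `I`, hence factor through `R`.
  let φ : T →ₐ[k] A' ⊗[k] R :=
    { toFun := fun y ↦ ψ y - Φ.t ⊗ₜ d y
      map_one' := by simp
      map_mul' := fun x y ↦ by
        rw [map_mul, sub_mul, mul_sub, mul_sub, htψ, htt, mul_comm (ψ x) (_ ⊗ₜ _), htψ, Derivation.leibniz,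
          TensorProduct.tmul_add, Algebra.smul_def, Algebra.smul_def, mul_comm (d y),
          mul_comm (d x)]
        abel
      map_zero' := by simp
      map_add' := fun x y ↦ by simp only [map_add, TensorProduct.tmul_add]; abel
      commutes' := fun c ↦ by
        rw [AlgHom.commutes, Derivation.map_algebraMap, TensorProduct.tmul_zero, sub_zero] }
  have hφ : ∀ y, φ y = ψ y - Φ.t ⊗ₜ d y := fun y ↦ rfl
  let χ : R →ₐ[k] A' ⊗[k] R := AlgHom.liftOfSurjective (pr k T R) hTR φ fun x hx ↦ by
    have := hf ⟨x, hx⟩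
    change φ x = 0
    rw [hφ, hψ, this, hd, sub_self]
  have hχ : ∀ y : T, χ (algebraMap T R y) = φ y := fun y ↦
    AlgHom.liftOfSurjective_apply (pr k T R) hTR φ _ y
  have ht : toResidue k A' Φ.t = 0 := by
    have := Φ.t_mem_maximalIdeal
    rw [← ker_toResidue (k := k)] at this
    exact this
  have hres : ∀ r : R, tmap (toResidue k A') (AlgHom.id k R) (χ r) = 1 ⊗ₜ r := fun r ↦ by
    obtain ⟨y, rfl⟩ := hTR r
    rw [hχ, hφ, map_sub, Algebra.TensorProduct.map_tmul, ht, hψ, tmap_tmap, AlgHom.comp_id,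
      AlgHom.id_comp]
    have h1 := congrArg (tmap (AlgHom.id k _) (pr k T R)) (mem_HS_iff.1 E.2 y)
    rw [tmap_tmap, AlgHom.comp_id, AlgHom.id_comp] at h1
    rw [h1]
    simp
  refine ⟨HS.mk χ hres, HS.ext' fun r ↦ ?_⟩
  obtain ⟨y, rfl⟩ := hTR r
  rw [HS.coe_map, baseChange_one_tmul, HS.mk_one_tmul, hχ, hφ, map_sub,
    Algebra.TensorProduct.map_tmul, hom_t, hψ, tmap_tmap, AlgHom.comp_id, AlgHom.id_comp,
    lifts_iff.1 hE]
  simp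

/-- Any lift of `D'` itself to `HS^{A'}(T)` preserves `A' ⊗ I`, so it induces the zero map on `I /
I²`. -/
theorem isObstruction_map [IsArtinianRing A'] (hT : IsLocalizationOfPolynomial k T)
    (hTR : Function.Surjective (algebraMap T R)) (D' : HS k A' R) :
    Φ.IsObstruction T R (HS.map Φ.hom D') 0 := by
  obtain ⟨E, hE⟩ := exists_lifts hT hTR (h := AlgHom.id k A') Function.surjective_id D'
  refine Φ.isObstruction_iff.2 ⟨E, ?_, 0, fun x ↦ ?_, map_zero _⟩
  · have := hE.baseChange (AlgHom.id k A') Φ.hom (h' := Φ.hom) rfl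
    rwa [baseChange_id] at this
  · have hx : algebraMap T R x = 0 := x.2
    rw [lifts_iff.1 hE, hx]
    simp

theorem IsObstruction.mul (hTR : Function.Surjective (algebraMap T R)) {D D' : HS k A R}
    {τ τ' : T1 k T R} (h : Φ.IsObstruction T R D τ) (h' : Φ.IsObstruction T R D' τ') :
    Φ.IsObstruction T R (D * D') (τ + τ') := by
  obtain ⟨E, hE, f, hf, rfl⟩ := Φ.isObstruction_iff.1 h
  obtain ⟨E', hE', f', hf', rfl⟩ := Φ.isObstruction_iff.1 h'
  exact Φ.isObstruction_iff.2 ⟨E * E', hE.mul hE', f + f', hf.mul hTR hf', map_add _ _ _⟩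

theorem IsObstruction.eq_zero {τ : T1 k T R} (h : Φ.IsObstruction T R 1 τ) : τ = 0 := by
  obtain ⟨E, hE, f, hf, rfl⟩ := Φ.isObstruction_iff.1 h
  exact hf.mk_eq_zero hE

/-- Formal: `D⁻¹` has some obstruction `σ`, and `τ + σ` is an obstruction of the identity.
Uniqueness follows in the same way. -/
theorem IsObstruction.inv [IsArtinianRing A'] (hT : IsLocalizationOfPolynomial k T)
    (hTR : Function.Surjective (algebraMap T R)) {D : HS k A R} {τ : T1 k T R} (h : Φ.IsObstruction T R D τ) :
    Φ.IsObstruction T R D⁻¹ (-τ) := by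
  obtain ⟨σ, hσ⟩ := Φ.exists_isObstruction hT hTR D⁻¹
  have := h.mul hTR hσ
  rw [mul_inv_cancel] at this
  rwa [neg_eq_of_add_eq_zero_right this.eq_zero]

theorem IsObstruction.unique [IsArtinianRing A'] (hT : IsLocalizationOfPolynomial k T)
    (hTR : Function.Surjective (algebraMap T R)) {D : HS k A R} {τ τ' : T1 k T R} (h : Φ.IsObstruction T R D τ)
    (h' : Φ.IsObstruction T R D τ') : τ = τ' := by
  have := h.mul hTR (h'.inv hT hTR)
  rw [mul_inv_cancel] at this
  exact add_neg_eq_zero.1 this.eq_zero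

/-- The obstruction is compatible with morphisms of small extensions. -/
theorem IsObstruction.map {B' B : Type*} [CommRing B'] [Algebra k B'] [IsLocalRing B'] [CommRing B]
    [Algebra k B] [IsLocalRing B] {Ψ : SmallExtension k B' B} {D : HS k A R} {τ : T1 k T R}
    (H : Φ.IsObstruction T R D τ) (h' : A' →ₐ[k] B') [IsLocalHom h'] (h : A →ₐ[k] B) [IsLocalHom h]
    (hh : Ψ.hom.comp h' = h.comp Φ.hom) {c : k} (hc : h' Φ.t = c • Ψ.t) :
    Ψ.IsObstruction T R (HS.map h D) (algebraMap k R c • τ) := by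
  obtain ⟨E, hE, f, hf, rfl⟩ := Φ.isObstruction_iff.1 H
  refine Ψ.isObstruction_iff.2 ⟨HS.map h' E, hE.baseChange h' h hh, algebraMap k R c • f,
    fun x ↦ ?_, map_smul _ _ _⟩
  have h1 := congrArg (tmap h' (AlgHom.id k R)) (hf x)
  rw [tmap_tmap, AlgHom.comp_id, AlgHom.id_comp, Algebra.TensorProduct.map_tmul, hc] at h1
  rw [HS.coe_map, baseChange_one_tmul, tmap_tmap, AlgHom.comp_id, AlgHom.id_comp, h1,
    TensorProduct.smul_tmul, LinearMap.smul_apply, algebraMap_smul]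
  rfl

end Obstruction

end SmallExtension

end SmallExtOb

namespace SmallExtOb

/-! ### Truncated polynomial rings -/

/-- The truncated polynomial ring `k[ε] / εⁿ`. -/
abbrev TruncPoly (k : Type*) [Field k] (n : ℕ) : Type _ :=
  AdjoinRoot (Polynomial.X ^ n : Polynomial k)

namespace TruncPoly

variable {k : Type*} [Field k] {n : ℕ}

/-- The class of the variable. -/
def eps (k : Type*) [Field k] (n : ℕ) : TruncPoly k n := AdjoinRoot.root _

theorem eps_pow (m : ℕ) : eps k n ^ m = AdjoinRoot.mk _ (Polynomial.X ^ m) := by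
  rw [map_pow, AdjoinRoot.mk_X, eps]

theorem eps_pow_self : eps k n ^ n = 0 := by rw [eps_pow, AdjoinRoot.mk_self]

theorem eps_pow_eq_zero {m : ℕ} (h : n ≤ m) : eps k n ^ m = 0 := pow_eq_zero_of_le h eps_pow_self

section Eval

variable {A B : Type*} [CommRing A] [Algebra k A] [CommRing B] [Algebra k B]

/-- The evaluation `k[ε] / εⁿ → A` at an element `y` with `yⁿ = 0`. -/
def eval (y : A) (hy : y ^ n = 0) : TruncPoly k n →ₐ[k] A :=
  AdjoinRoot.liftAlgHom _ (Algebra.ofId k A) y (by simp [hy])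

@[simp]
theorem eval_eps (y : A) (hy : y ^ n = 0) : eval y hy (eps k n) = y :=
  AdjoinRoot.liftAlgHom_root _ _ _ _

theorem algHom_ext {φ ψ : TruncPoly k n →ₐ[k] A} (h : φ (eps k n) = ψ (eps k n)) : φ = ψ :=
  AdjoinRoot.algHom_ext h

theorem comp_eval (h : A →ₐ[k] B) (y : A) (hy : y ^ n = 0) :
    h.comp (eval y hy) = eval (h y) (by rw [← map_pow, hy, map_zero]) :=
  algHom_ext (by simp)

end Eval

theorem exists_eq_add (a : TruncPoly k n) :
    ∃ (c : k) (b : TruncPoly k n), a = algebraMap k _ c + eps k n * b := by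
  obtain ⟨f, rfl⟩ := AdjoinRoot.mk_surjective a
  refine ⟨f.coeff 0, AdjoinRoot.mk _ f.divX, ?_⟩
  conv_lhs => rw [← Polynomial.divX_mul_X_add f]
  rw [map_add, map_mul, AdjoinRoot.mk_X, AdjoinRoot.mk_C, eps, add_comm, mul_comm]
  rfl

theorem isUnit_add {c : k} (hc : c ≠ 0) (b : TruncPoly k n) :
    IsUnit (algebraMap k _ c + eps k n * b) := by
  have h1 : IsNilpotent (eps k n * b) :=
    (Commute.all _ _).isNilpotent_mul_right ⟨n, eps_pow_self⟩
  exact h1.isUnit_add_left_of_commute (hc.isUnit.map (algebraMap k _)) (Commute.all _ _)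

instance [NeZero n] : Nontrivial (TruncPoly k n) :=
  AdjoinRoot.nontrivial _ (by simpa using NeZero.ne n)

instance [NeZero n] : IsLocalRing (TruncPoly k n) :=
  IsLocalRing.of_isUnit_or_isUnit_one_sub_self fun a ↦ by
    obtain ⟨c, b, rfl⟩ := exists_eq_add a
    by_cases hc : c = 0
    · right
      convert isUnit_add (n := n) (one_ne_zero (α := k)) (-b) using 1
      simp [hc, sub_eq_add_neg]
    · exact Or.inl (isUnit_add hc b)

instance : Module.Finite k (TruncPoly k n) :=
  Polynomial.Monic.finite_adjoinRoot (Polynomial.monic_X_pow n)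

instance : IsArtinianRing (TruncPoly k n) := IsArtinianRing.of_finite k _

theorem exists_eq_eps_mul [NeZero n] {a : TruncPoly k n}
    (ha : a ∈ IsLocalRing.maximalIdeal (TruncPoly k n)) : ∃ b, a = eps k n * b := by
  obtain ⟨c, b, rfl⟩ := exists_eq_add a
  by_cases hc : c = 0
  · exact ⟨b, by simp [hc]⟩
  · exact absurd (isUnit_add hc b) ha

/-- The truncation `k[ε] / εⁿ → k[ε] / εᵐ`. -/
def trunc (k : Type*) [Field k] {n m : ℕ} (h : m ≤ n) : TruncPoly k n →ₐ[k] TruncPoly k m :=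
  eval (eps k m) (eps_pow_eq_zero h)

@[simp]
theorem trunc_eps {m : ℕ} (h : m ≤ n) : trunc k h (eps k n) = eps k m := eval_eps _ _

theorem trunc_mk {m : ℕ} (h : m ≤ n) (f : Polynomial k) :
    trunc k h (AdjoinRoot.mk _ f) = AdjoinRoot.mk _ f := by
  have h1 : ((trunc k h).comp (AdjoinRoot.mkₐ _)) = AdjoinRoot.mkₐ _ :=
    Polynomial.algHom_ext (by
      change trunc k h (AdjoinRoot.mk _ Polynomial.X) = AdjoinRoot.mk _ Polynomial.X
      rw [AdjoinRoot.mk_X, AdjoinRoot.mk_X]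
      exact trunc_eps h)
  exact DFunLike.congr_fun h1 f

variable (k n) in
/-- The small extension `0 → k εⁿ → k[ε] / εⁿ⁺¹ → k[ε] / εⁿ → 0`. -/
def smallExtension : SmallExtension k (TruncPoly k (n + 1)) (TruncPoly k n) where
  hom := trunc k n.le_succ
  t := eps k (n + 1) ^ n
  surjective x := by
    obtain ⟨f, rfl⟩ := AdjoinRoot.mk_surjective x
    exact ⟨AdjoinRoot.mk _ f, trunc_mk _ f⟩
  t_ne_zero := by
    rw [eps_pow, Ne, AdjoinRoot.mk_eq_zero, Polynomial.X_pow_dvd_iff]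
    intro h
    simpa using h n n.lt_succ_self
  maximalIdeal_mul_t x hx := by
    obtain ⟨b, rfl⟩ := exists_eq_eps_mul hx
    rw [mul_right_comm, ← pow_succ', eps_pow_self, zero_mul]
  hom_eq_zero_iff x := by
    constructor
    · obtain ⟨f, rfl⟩ := AdjoinRoot.mk_surjective x
      rw [trunc_mk, AdjoinRoot.mk_eq_zero]
      rintro ⟨g, rfl⟩
      obtain ⟨c, b, hb⟩ := exists_eq_add (AdjoinRoot.mk (Polynomial.X ^ (n + 1)) g)
      refine ⟨c, ?_⟩
      rw [map_mul, hb, ← eps_pow, mul_add, ← mul_assoc, ← pow_succ, eps_pow_self, zero_mul,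
        add_zero, mul_comm, ← Algebra.smul_def]
    · rintro ⟨c, rfl⟩
      rw [map_smul, map_pow, trunc_eps, eps_pow_self, smul_zero]

theorem smallExtension_hom : (smallExtension k n).hom = trunc k n.le_succ := rfl

theorem smallExtension_t : (smallExtension k n).t = eps k (n + 1) ^ n := rfl

end TruncPoly

/-! ### Substitutions -/

section Subst

variable {k : Type*} [Field k] {n : ℕ} [NeZero n] {A B R : Type*} [CommRing A] [Algebra k A]
  [IsLocalRing A] [CommRing B] [Algebra k B] [IsLocalRing B] [CommRing R] [Algebra k R]

/-- The substitution `ε ↦ y` in an element of `HS^{k[ε]/εⁿ}(R)`, where `yⁿ = 0`. -/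
def HS.subst (y : A) (hy : y ^ n = 0) : HS k (TruncPoly k n) R →* HS k A R :=
  HS.map (TruncPoly.eval y hy)

theorem HS.coe_subst (y : A) (hy : y ^ n = 0) (G : HS k (TruncPoly k n) R) :
    (HS.subst y hy G).1 = baseChange (TruncPoly.eval y hy) G.1 := rfl

theorem HS.map_subst [IsArtinianRing A] (h : A →ₐ[k] B) (y : A) (hy : y ^ n = 0)
    (G : HS k (TruncPoly k n) R) :
    HS.map h (HS.subst y hy G) = HS.subst (h y) (by rw [← map_pow, hy, map_zero]) G := by
  apply Subtype.ext
  rw [HS.coe_map, HS.coe_subst, HS.coe_subst, baseChange_baseChange, TruncPoly.comp_eval]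

theorem HS.subst_subst {m : ℕ} [NeZero m] (x : TruncPoly k m) (hx : x ^ n = 0) (y : A) (hy : y ^ m = 0)
    (G : HS k (TruncPoly k n) R) :
    HS.subst y hy (HS.subst x hx G) =
      HS.subst (TruncPoly.eval y hy x) (by rw [← map_pow, hx, map_zero]) G :=
  HS.map_subst _ _ _ _

theorem HS.eq_one_of_maximalIdeal_eq_bot (hA : IsLocalRing.maximalIdeal A = ⊥) (D : HS k A R) :
    D = 1 := by
  refine HS.ext' fun r ↦ ?_
  have h1 : D.1 (1 ⊗ₜ r) - 1 ⊗ₜ r ∈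
      IsLocalRing.maximalIdeal A • (⊤ : Submodule A (A ⊗[k] R)) :=
    mem_maximalIdeal_smul_top (by rw [map_sub, mem_HS_iff.1 D.2]; simp)
  rw [hA, Submodule.bot_smul, Submodule.mem_bot, sub_eq_zero] at h1
  exact h1

/-- The elements of `HS^{k[ε]/ε²}(R)` are the `1 + ε ∂`. -/
theorem HS.exists_eq_oneAdd (G : HS k (TruncPoly k 2) R) :
    ∃ d : Derivation k R R,
      G.1 = oneAdd (TruncPoly.eps k 2) (by rw [← pow_two]; exact TruncPoly.eps_pow_self) d := by
  obtain ⟨d, hd⟩ := SmallExtension.exists_eq_oneAdd (Φ := TruncPoly.smallExtension k 1) (D := G) (by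
    have h : IsLocalRing.maximalIdeal (TruncPoly k 1) = ⊥ := by
      rw [eq_bot_iff]
      intro x hx
      obtain ⟨b, rfl⟩ := TruncPoly.exists_eq_eps_mul hx
      rw [← pow_one (TruncPoly.eps k 1), TruncPoly.eps_pow_self, zero_mul]
      exact zero_mem _
    exact congrArg Subtype.val
      (HS.eq_one_of_maximalIdeal_eq_bot h (HS.map (TruncPoly.smallExtension k 1).hom G)))
  refine ⟨d, ?_⟩
  rw [hd]
  simp only [TruncPoly.smallExtension_t, pow_one]

end Subst

/-! ### Extension of truncated curves -/

/-- If `x ↦ xⁿ` were additive it would be an endomorphism of the field, hence injective. But `n = p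
^ e * u` with `u ≠ 1` prime to `p`, and a primitive `u`-th root of unity has the same image as `1`.
-/
theorem exists_add_pow_ne {k : Type*} [Field k] [IsAlgClosed k] (p : ℕ) [Fact p.Prime] [CharP k p]
    {n : ℕ} (hn : n ≠ 0) (hpow : ∀ j, n ≠ p ^ j) :
    ∃ c d : k, (c + d) ^ n ≠ c ^ n + d ^ n := by
  by_contra! H
  obtain ⟨e, u, hu, rfl⟩ := Nat.exists_eq_pow_mul_and_not_dvd hn p (Fact.out : p.Prime).ne_one
  have hu1 : u ≠ 1 := fun h ↦ hpow e (by rw [h, mul_one])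
  have : NeZero (u : k) := ⟨fun h ↦ hu ((CharP.cast_eq_zero_iff k p u).1 h)⟩
  obtain ⟨ζ, hζ⟩ := HasEnoughRootsOfUnity.exists_primitiveRoot k u
  let φ : k →+* k :=
    { toFun := fun x ↦ x ^ (p ^ e * u)
      map_one' := one_pow _
      map_mul' := fun x y ↦ mul_pow _ _ _
      map_zero' := zero_pow hn
      map_add' := H }
  have h1 : φ ζ = φ 1 := by
    change ζ ^ (p ^ e * u) = 1 ^ (p ^ e * u)
    rw [mul_comm, pow_mul, hζ.pow_eq_one, one_pow, one_pow]
  have h2 := hζ.eq_orderOf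
  rw [φ.injective h1, orderOf_one] at h2
  exact hu1 h2

section Leap

variable {k T R : Type*} [Field k] [CommRing T] [CommRing R] [Algebra k T] [Algebra T R]
  [Algebra k R] [IsScalarTower k T R]

open SmallExtOb.TruncPoly in
/-- A derivation that extends to a Hasse-Schmidt derivation of length `n - 1` extends to one of
length `n` if `n` is not a power of `p`. -/
theorem HS.exists_extension_of_ne_pow [IsAlgClosed k] (p : ℕ) [Fact p.Prime] [CharP k p]
    (hT : IsLocalizationOfPolynomial k T) (hTR : Function.Surjective (algebraMap T R))
    {n : ℕ} [NeZero n] (hn : 2 ≤ n) (hpow : ∀ j, n ≠ p ^ j) (G : HS k (TruncPoly k n) R) :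
    ∃ G' : HS k (TruncPoly k (n + 1)) R,
      HS.map (trunc k (hn.trans n.le_succ)) G' = HS.map (trunc k hn) G := by
  obtain ⟨τ, hτ⟩ := (smallExtension k n).exists_isObstruction hT hTR G
  have hz' : ∀ c : k, (c • eps k n) ^ n = 0 := fun c ↦ by
    rw [smul_pow, eps_pow_self, smul_zero]
  have hz'' : ∀ c : k, (c • eps k (n + 1)) ^ (n + 1) = 0 := fun c ↦ by
    rw [smul_pow, eps_pow_self, smul_zero]
  have htr : ∀ (c : k) (H : HS k (TruncPoly k n) R),
      HS.map (trunc k hn) (HS.subst (c • eps k n) (hz' c) H) = HS.subst (c • eps k 2) (by rw [smul_pow, eps_pow_self, smul_zero])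
        (HS.map (trunc k hn) H) := by
    intro c H
    rw [HS.map_subst, trunc]
    change _ = HS.subst _ _ (HS.subst _ _ H)
    rw [HS.subst_subst]
    congr 1
    simp
  obtain ⟨d, hd⟩ := HS.exists_eq_oneAdd (HS.map (trunc k hn) G)
  have h2 : ∀ c : k, (c • eps k 2) * (c • eps k 2) = 0 := fun c ↦ by
    rw [← pow_two, smul_pow, eps_pow_self, smul_zero]
  -- The pairs (multiple of `d`, multiple of `τ`) realized as first order part and obstruction of
  -- one curve. The aim is `(1, 0) ∈ W`, a curve with the first order part of `G` and no
  -- obstruction.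
  let W : AddSubgroup (k × k) :=
    { carrier := {x | ∃ H : HS k (TruncPoly k n) R,
        (HS.map (trunc k hn) H).1 = oneAdd (x.1 • eps k 2) (h2 _) d ∧
        (smallExtension k n).IsObstruction T R H (algebraMap k R x.2 • τ)}
      zero_mem' := by
        refine ⟨1, ?_, ?_⟩
        · rw [map_one]
          exact ((oneAdd_congr (zero_smul k _) _ _ (mul_zero (0 : TruncPoly k 2))).trans
            (oneAdd_zero d)).symm
        · obtain ⟨σ, hσ⟩ := (smallExtension k n).exists_isObstruction hT hTR (1 : HS k _ R)
          rw [Prod.snd_zero, map_zero, zero_smul]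
          rwa [hσ.eq_zero] at hσ
      add_mem' := by
        rintro ⟨a, b⟩ ⟨a', b'⟩ ⟨H, hH, hb⟩ ⟨H', hH', hb'⟩
        refine ⟨H * H', ?_, ?_⟩
        · rw [map_mul, Subgroup.coe_mul, hH, hH', oneAdd_mul _ _ _ _ (by
            rw [smul_mul_smul_comm, ← pow_two, eps_pow_self, smul_zero])]
          exact oneAdd_congr (add_smul _ _ _).symm _ _ _
        · have := hb.mul hTR hb'
          rwa [← add_smul, ← map_add] at this
      neg_mem' := by
        rintro ⟨a, b⟩ ⟨H, hH, hb⟩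
        refine ⟨H⁻¹, ?_, ?_⟩
        · rw [map_inv, Subgroup.coe_inv, hH, oneAdd_inv]
          exact oneAdd_congr (neg_smul _ _).symm _ _ _
        · have := hb.inv hT hTR
          rwa [← neg_smul, ← map_neg] at this }
  -- Substituting `c ε` for `ε` multiplies `d` by `c` and the obstruction by `cⁿ`.
  have hW1 : ∀ c, (c, c ^ n) ∈ W := fun c ↦ by
    refine ⟨HS.subst (c • eps k n) (hz' c) G, ?_, ?_⟩
    · rw [htr, HS.coe_subst, hd, baseChange_oneAdd]
      exact oneAdd_congr (eval_eps _ _) _ _ _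
    · exact hτ.map (eval _ (hz'' c)) (eval _ (hz' c)) (algHom_ext (by
        simp [smallExtension_hom])) (by simp [smallExtension_t, smul_pow])
  have hW2 : ∀ l c d, (c, d) ∈ W → (l * c, l ^ n * d) ∈ W := by
    rintro l a b ⟨H, hH, hb⟩
    refine ⟨HS.subst (l • eps k n) (hz' l) H, ?_, ?_⟩
    · rw [htr, HS.coe_subst, hH, baseChange_oneAdd]
      exact oneAdd_congr (by rw [map_smul, eval_eps, smul_smul, mul_comm]) _ _ _
    · have := hb.map (Ψ := smallExtension k n) (eval _ (hz'' l)) (eval _ (hz' l)) (algHom_ext (by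
        simp [smallExtension_hom])) (c := l ^ n) (by simp [smallExtension_t, smul_pow])
      rwa [smul_smul, ← map_mul] at this
  -- Non-additivity of `c ↦ cⁿ` puts some `(0, w)` with `w ≠ 0` in `W`. Rescaling by an `n`-th root
  -- of `w⁻¹` turns it into `(0, 1)`, which is subtracted from `(1, 1)`.
  have hW : (1, 0) ∈ W := by
    obtain ⟨a, b, hab⟩ := exists_add_pow_ne (k := k) p (NeZero.ne n) hpow
    have h1 := W.sub_mem (W.sub_mem (hW1 (a + b)) (hW1 a)) (hW1 b)
    simp only [Prod.mk_sub_mk, add_sub_cancel_left, sub_self] at h1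
    have hw : (a + b) ^ n - a ^ n - b ^ n ≠ 0 := by
      rwa [sub_sub, sub_ne_zero]
    obtain ⟨l, hl⟩ := IsAlgClosed.exists_pow_nat_eq ((a + b) ^ n - a ^ n - b ^ n)⁻¹
      (Nat.pos_of_ne_zero (NeZero.ne n))
    have h2 := hW2 l _ _ h1
    rw [hl, inv_mul_cancel₀ hw, mul_zero] at h2
    have h3 := W.sub_mem (hW1 1) h2
    simpa using h3
  obtain ⟨H, hH, hH'⟩ := hW
  rw [map_zero, zero_smul] at hH'
  obtain ⟨G', rfl⟩ := hH'.exists_map_eq hTR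
  refine ⟨G', Subtype.ext ?_⟩
  rw [hd]
  simp only [one_smul] at hH
  rw [← hH, HS.coe_map, HS.coe_map, HS.coe_map, baseChange_baseChange, smallExtension_hom]
  congr 1
  exact congrArg _ (TruncPoly.algHom_ext (by simp))

open SmallExtOb.TruncPoly in
/-- A derivation that extends to a Hasse-Schmidt derivation of length `p ^ j` extends to one of
length `p ^ (j + 1) - 1`. -/
theorem HS.exists_extension_pow [IsAlgClosed k] (p : ℕ) [Fact p.Prime] [CharP k p]
    (hT : IsLocalizationOfPolynomial k T) (hTR : Function.Surjective (algebraMap T R))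
    {j : ℕ} (h₀ : 2 ≤ p ^ j + 1) (G : HS k (TruncPoly k (p ^ j + 1)) R) :
    ∀ (m : ℕ) [NeZero m] (hm : p ^ j + 1 ≤ m), m ≤ p ^ (j + 1) →
      ∃ G' : HS k (TruncPoly k m) R,
        HS.map (trunc k (h₀.trans hm)) G' = HS.map (trunc k h₀) G := by
  intro m
  induction m with
  | zero => intro _ hm; omega
  | succ m ih =>
    intro _ hm hm'
    -- The base case: `G` itself lives over `k[ε]/ε^(p^j + 1)`.
    by_cases heq : p ^ j = m
    · subst heq
      exact ⟨G, rfl⟩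
    · have h : p ^ j < m := by omega
      have : NeZero m := ⟨by omega⟩
      obtain ⟨G₁, hG₁⟩ := ih h (by omega)
      -- `m` lies strictly between consecutive powers of `p`.
      have hpow : ∀ i, m ≠ p ^ i := by
        rintro i rfl
        have h1 := (Nat.pow_lt_pow_iff_right (Fact.out : p.Prime).one_lt).1 h
        have h2 := (Nat.pow_lt_pow_iff_right (Fact.out : p.Prime).one_lt).1
          (Nat.lt_of_succ_le hm')
        omega
      obtain ⟨G₂, hG₂⟩ := HS.exists_extension_of_ne_pow p hT hTR (h₀.trans h) hpow G₁
      exact ⟨G₂, hG₂.trans hG₁⟩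

end Leap

end SmallExtOb

namespace SmallExtOb

/-! ### Congruence subgroups -/

section Congruence

variable {k A B R : Type*} [Field k] [CommRing A] [Algebra k A] [IsLocalRing A]
  [CommRing B] [Algebra k B] [CommRing R] [Algebra k R]

/-- The automorphisms in `HS^A(R)` that are the identity modulo `J`. -/
def HS.congruence (R : Type*) [CommRing R] [Algebra k R] (J : Ideal A) : Subgroup (HS k A R) :=
  ((baseChange (Ideal.Quotient.mkₐ k J)).comp (HS k A R).subtype).ker

theorem HS.mem_congruence {J : Ideal A} {D : HS k A R} :
    D ∈ HS.congruence R J ↔ baseChange (Ideal.Quotient.mkₐ k J) D.1 = 1 := Iff.rfl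

theorem baseChange_eq_one_iff_mem {h : A →ₐ[k] B} (hh : Function.Surjective h)
    {D : (A ⊗[k] R) ≃ₐ[A] (A ⊗[k] R)} :
    baseChange h D = 1 ↔
      ∀ r : R, D (1 ⊗ₜ r) - 1 ⊗ₜ r ∈ RingHom.ker h • (⊤ : Submodule A (A ⊗[k] R)) := by
  have h1 : ∀ r : R, tmap h (AlgHom.id k R) (1 ⊗ₜ r) = 1 ⊗ₜ r := fun r ↦ by simp
  rw [baseChange_eq_one_iff]
  refine forall_congr' fun r ↦ ⟨fun H ↦ mem_of_tmap_eq_zero hh ?_, fun H ↦ ?_⟩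
  · rw [map_sub, H, h1, sub_self]
  · rw [← sub_eq_zero, ← h1, ← map_sub]
    generalize D (1 ⊗ₜ r) - 1 ⊗ₜ r = z at H
    induction H using Submodule.smul_induction_on' with
    | smul a ha y _ => rw [tmap_smul, show h a = 0 from ha, zero_smul]
    | add x _ y _ hx hy => rw [map_add, hx, hy, add_zero]

theorem HS.mem_congruence_iff {J : Ideal A} {D : HS k A R} :
    D ∈ HS.congruence R J ↔
      ∀ r : R, D.1 (1 ⊗ₜ r) - 1 ⊗ₜ r ∈ J • (⊤ : Submodule A (A ⊗[k] R)) := by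
  rw [HS.mem_congruence, baseChange_eq_one_iff_mem (Ideal.Quotient.mkₐ_surjective k J),
    show RingHom.ker (Ideal.Quotient.mkₐ k J) = J from Ideal.mk_ker]

theorem HS.congruence_maximalIdeal (D : HS k A R) :
    D ∈ HS.congruence R (IsLocalRing.maximalIdeal A) := by
  rw [HS.mem_congruence_iff, ← ker_toResidue (k := k),
    ← baseChange_eq_one_iff_mem toResidue_surjective, ← mem_HS_iff_baseChange]
  exact D.2

theorem HS.eq_one_of_mem_congruence_bot {D : HS k A R} (hD : D ∈ HS.congruence R (⊥ : Ideal A)) :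
    D = 1 := by
  refine HS.ext' fun r ↦ ?_
  have h1 := HS.mem_congruence_iff.1 hD r
  rw [Submodule.bot_smul, Submodule.mem_bot, sub_eq_zero] at h1
  exact h1

theorem HS.baseChange_eq_one {J : Ideal A} {D : HS k A R} (hD : D ∈ HS.congruence R J)
    {h : A →ₐ[k] B} (hJ : J ≤ RingHom.ker h) : baseChange h D.1 = 1 := by
  have h1 : h = (Ideal.Quotient.liftₐ J h hJ).comp (Ideal.Quotient.mkₐ k J) := by
    ext a
    rfl
  rw [h1, ← baseChange_baseChange, HS.mem_congruence.1 hD, map_one]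

theorem HS.map_mem_congruence [IsLocalRing B] {J : Ideal A} {D : HS k A R}
    (hD : D ∈ HS.congruence R J) {h : A →ₐ[k] B} [IsLocalHom h] :
    HS.map h D ∈ HS.congruence R (J.map h) := by
  rw [HS.mem_congruence, HS.coe_map, baseChange_baseChange]
  refine HS.baseChange_eq_one hD fun x hx ↦ ?_
  change Ideal.Quotient.mk _ (h x) = 0
  exact Ideal.Quotient.eq_zero_iff_mem.2 (Ideal.mem_map_of_mem h hx)

theorem HS.inv_mul_mem_congruence {J : Ideal A} {D E : HS k A R} :
    E⁻¹ * D ∈ HS.congruence R J ↔ baseChange (Ideal.Quotient.mkₐ k J) D.1 =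
      baseChange (Ideal.Quotient.mkₐ k J) E.1 := by
  rw [HS.mem_congruence, Subgroup.coe_mul, map_mul, Subgroup.coe_inv, map_inv, inv_mul_eq_one,
    eq_comm]

/-- The value of a truncated curve at a point of square zero depends on its first order part
only. -/
theorem baseChange_subst_eq {n n' : ℕ} [NeZero n] [NeZero n'] (hn : 2 ≤ n) (hn' : 2 ≤ n')
    {G : HS k (TruncPoly k n) R} {G' : HS k (TruncPoly k n') R}
    (hG : HS.map (TruncPoly.trunc k hn) G = HS.map (TruncPoly.trunc k hn') G') {y : B}
    (hy : y ^ 2 = 0) :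
    baseChange (TruncPoly.eval y (pow_eq_zero_of_le hn hy)) G.1 =
      baseChange (TruncPoly.eval y (pow_eq_zero_of_le hn' hy)) G'.1 := by
  have h1 : TruncPoly.eval y (pow_eq_zero_of_le hn hy) =
      (TruncPoly.eval (k := k) y hy).comp (TruncPoly.trunc k hn) := TruncPoly.algHom_ext (by simp)
  have h2 : TruncPoly.eval y (pow_eq_zero_of_le hn' hy) =
      (TruncPoly.eval (k := k) y hy).comp (TruncPoly.trunc k hn') := TruncPoly.algHom_ext (by simp)
  rw [h1, h2, ← baseChange_baseChange, ← baseChange_baseChange,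
    ← HS.coe_map (TruncPoly.trunc k hn), ← HS.coe_map (TruncPoly.trunc k hn'), hG]

theorem HS.subst_zero {n : ℕ} [NeZero n] (G : HS k (TruncPoly k n) R) :
    HS.subst (0 : A) (zero_pow (NeZero.ne n)) G = 1 := by
  refine Subtype.ext (HS.baseChange_eq_one (HS.congruence_maximalIdeal G) fun x hx ↦ ?_)
  obtain ⟨b, rfl⟩ := TruncPoly.exists_eq_eps_mul hx
  rw [RingHom.mem_ker, map_mul, TruncPoly.eval_eps, zero_mul]

end Congruence

/-! ### Ideals of artinian local rings -/

section Ideals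

variable {k A : Type*} [Field k] [CommRing A] [Algebra k A] [IsLocalRing A]

theorem exists_sub_algebraMap_mem
    (hA : Function.Bijective (algebraMap k (IsLocalRing.ResidueField A))) (a : A) :
    ∃ c : k, a - algebraMap k A c ∈ IsLocalRing.maximalIdeal A := by
  obtain ⟨c, hc⟩ := hA.2 (IsLocalRing.residue A a)
  refine ⟨c, ?_⟩
  rw [← IsLocalRing.ker_residue, RingHom.mem_ker, map_sub, ← hc, sub_eq_zero]
  rfl

/-- `J / J'` is simple, so Nakayama gives `𝔪 J ⊆ J'`. -/
theorem mul_mem_of_covBy [IsArtinianRing A] {J' J : Ideal A} (h : J' ⋖ J) {a x : A}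
    (ha : a ∈ IsLocalRing.maximalIdeal A) (hx : x ∈ J) : a * x ∈ J' := by
  have h1 : IsLocalRing.maximalIdeal A • J ≤ J' := by
    rcases h.eq_or_eq (le_sup_left (b := IsLocalRing.maximalIdeal A • J))
      (sup_le h.le Submodule.smul_le_right) with h2 | h2
    · exact sup_eq_left.1 h2
    · exfalso
      refine h.lt.not_ge (Submodule.le_of_le_smul_of_le_jacobson_bot
        (I := IsLocalRing.maximalIdeal A) (IsNoetherian.noetherian J) ?_ h2.ge)
      rw [IsLocalRing.jacobson_eq_maximalIdeal ⊥ bot_ne_top]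
  exact h1 (Submodule.smul_mem_smul ha hx)

/-- `J / J'` is a simple module over a ring with residue field `k`, so it is a line over `k`. -/
theorem exists_smul_of_covBy [IsArtinianRing A]
    (hA : Function.Bijective (algebraMap k (IsLocalRing.ResidueField A))) {J' J : Ideal A}
    (h : J' ⋖ J) : ∃ s ∈ J, s ∉ J' ∧ ∀ x ∈ J, ∃ c : k, x - c • s ∈ J' := by
  obtain ⟨s, hs, hs'⟩ := SetLike.exists_of_lt h.lt
  refine ⟨s, hs, hs', fun x hx ↦ ?_⟩
  have h1 : J' ⊔ Ideal.span {s} = J := by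
    refine (h.eq_or_eq le_sup_left (sup_le h.le ?_)).resolve_left fun h2 ↦ hs' ?_
    · rwa [Ideal.span_singleton_le_iff_mem]
    · rw [← h2]
      exact Ideal.mem_sup_right (Ideal.mem_span_singleton_self s)
  rw [← h1, Submodule.mem_sup] at hx
  obtain ⟨j, hj, z, hz, rfl⟩ := hx
  obtain ⟨a, rfl⟩ := Ideal.mem_span_singleton'.1 hz
  obtain ⟨c, hc⟩ := exists_sub_algebraMap_mem hA a
  refine ⟨c, ?_⟩
  have := J'.add_mem hj (mul_mem_of_covBy h hc hs)
  rwa [sub_mul, ← Algebra.smul_def, ← add_sub_assoc] at this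

theorem bijective_residue_of_surjective {B : Type*} [CommRing B] [Algebra k B] [IsLocalRing B]
    (hA : Function.Bijective (algebraMap k (IsLocalRing.ResidueField A)))
    {h : A →ₐ[k] B} (hh : Function.Surjective h) [IsLocalHom h] :
    Function.Bijective (algebraMap k (IsLocalRing.ResidueField B)) := by
  refine ⟨(algebraMap k _).injective, fun x ↦ ?_⟩
  obtain ⟨b, rfl⟩ := IsLocalRing.residue_surjective x
  obtain ⟨a, rfl⟩ := hh b
  obtain ⟨c, hc⟩ := exists_sub_algebraMap_mem hA a
  refine ⟨c, ?_⟩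
  have h1 : h (a - algebraMap k A c) ∈ IsLocalRing.maximalIdeal B :=
    fun hu ↦ hc (isUnit_of_map_unit h _ hu)
  rw [map_sub, AlgHom.commutes, ← IsLocalRing.ker_residue, RingHom.mem_ker, map_sub,
    sub_eq_zero] at h1
  exact h1.symm

/-- The small extension `0 → k s → A → A / (s) → 0`. -/
def SmallExtension.ofSocle
    (hA : Function.Bijective (algebraMap k (IsLocalRing.ResidueField A))) {s : A} (h0 : s ≠ 0)
    (hs : ∀ x ∈ IsLocalRing.maximalIdeal A, x * s = 0) :
    SmallExtension k A (A ⧸ Ideal.span {s}) where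
  hom := Ideal.Quotient.mkₐ k _
  t := s
  surjective := Ideal.Quotient.mkₐ_surjective k _
  t_ne_zero := h0
  maximalIdeal_mul_t := hs
  hom_eq_zero_iff x := by
    change Ideal.Quotient.mk _ x = 0 ↔ _
    rw [Ideal.Quotient.eq_zero_iff_mem, Ideal.mem_span_singleton']
    constructor
    · rintro ⟨a, rfl⟩
      obtain ⟨c, hc⟩ := exists_sub_algebraMap_mem hA a
      have := hs _ hc
      rw [sub_mul, sub_eq_zero, ← Algebra.smul_def] at this
      exact ⟨c, this⟩
    · rintro ⟨c, rfl⟩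
      exact ⟨algebraMap k A c, (Algebra.smul_def _ _).symm⟩

end Ideals

/-! ### Obstructions of curves -/

section ObCurves

variable {k T R : Type*} [Field k] [CommRing T] [CommRing R] [Algebra k T] [Algebra T R]
  [Algebra k R] [IsScalarTower k T R]

section

variable {A' A : Type*} [CommRing A'] [Algebra k A'] [IsLocalRing A'] [IsArtinianRing A']
  [CommRing A] [Algebra k A] [IsLocalRing A] (Φ : SmallExtension k A' A)

theorem SmallExtension.exists_eq_smul_t {n : ℕ} {y' : A'} (hy : Φ.hom y' ^ n = 0) :
    ∃ c : k, y' ^ n = c • Φ.t :=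
  (Φ.hom_eq_zero_iff _).1 (by rw [map_pow, hy])

/-- The evaluations `ε ↦ y'` and `ε ↦ Φ.hom y'` form a morphism of small extensions that sends `εⁿ`
to `c t`. -/
theorem SmallExtension.isObstruction_subst {n : ℕ} [NeZero n]
    {y' : A'} (hy : Φ.hom y' ^ n = 0) {c : k} (hc : y' ^ n = c • Φ.t)
    {G : HS k (TruncPoly k n) R} {τ : T1 k T R}
    (hG : (TruncPoly.smallExtension k n).IsObstruction T R G τ) :
    Φ.IsObstruction T R (HS.subst (Φ.hom y') hy G) (algebraMap k R c • τ) := by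
  have hm : y' ∈ IsLocalRing.maximalIdeal A' := by
    intro hu
    have h1 := (hu.map Φ.hom).pow n
    rw [hy] at h1
    exact not_isUnit_zero h1
  -- One more power is needed: the total ring of the curve's extension is `k[ε]/εⁿ⁺¹`. It vanishes
  -- as `𝔪 t = 0`.
  have hy' : y' ^ (n + 1) = 0 := by
    rw [pow_succ', hc, mul_smul_comm, Φ.maximalIdeal_mul_t _ hm, smul_zero]
  exact hG.map (TruncPoly.eval y' hy') (TruncPoly.eval (Φ.hom y') hy)
    (TruncPoly.algHom_ext (by simp [TruncPoly.smallExtension_hom]))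
    (by simp [TruncPoly.smallExtension_t, hc])

/-- `Ob^Φ` as a subgroup of `T¹`. -/
def SmallExtension.obSubgroup (hT : IsLocalizationOfPolynomial k T)
    (hTR : Function.Surjective (algebraMap T R)) : AddSubgroup (T1 k T R) where
  carrier := Φ.ob T R
  zero_mem' := ⟨1, by
    have := Φ.isObstruction_map hT hTR (1 : HS k A' R)
    rwa [map_one] at this⟩
  add_mem' := by
    rintro _ _ ⟨D, hD⟩ ⟨D', hD'⟩
    exact ⟨D * D', hD.mul hTR hD'⟩
  neg_mem' := by
    rintro _ ⟨D, hD⟩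
    exact ⟨D⁻¹, hD.inv hT hTR⟩

/-- The elements of `HS^A(R)` with obstruction in `V`. -/
def SmallExtension.obstructionIn (hT : IsLocalizationOfPolynomial k T)
    (hTR : Function.Surjective (algebraMap T R)) (V : AddSubgroup (T1 k T R)) :
    Subgroup (HS k A R) where
  carrier := {D | ∃ τ ∈ V, Φ.IsObstruction T R D τ}
  one_mem' := ⟨0, V.zero_mem, by
    have := Φ.isObstruction_map hT hTR (1 : HS k A' R)
    rwa [map_one] at this⟩
  mul_mem' := by
    rintro _ _ ⟨τ, hτ, h⟩ ⟨τ', hτ', h'⟩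
    exact ⟨τ + τ', V.add_mem hτ hτ', h.mul hTR h'⟩
  inv_mem' := by
    rintro _ ⟨τ, hτ, h⟩
    exact ⟨-τ, V.neg_mem hτ, h.inv hT hTR⟩

end

/-- `Ob` of the truncated polynomial rings grows with the length along multiples. -/
theorem ob_smallExtension_subset_mul {n m N : ℕ} [NeZero n] [NeZero N] (hN : n * m = N) :
    (TruncPoly.smallExtension k n).ob T R ⊆ (TruncPoly.smallExtension k N).ob T R := by
  subst hN
  rintro τ ⟨G, hG⟩
  have h := (TruncPoly.smallExtension k (n * m)).isObstruction_subst
    (y' := TruncPoly.eps k (n * m + 1) ^ m) (c := 1) (by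
      rw [map_pow, TruncPoly.smallExtension_hom, TruncPoly.trunc_eps, ← pow_mul,
        mul_comm m, TruncPoly.eps_pow_self]) (by
      rw [one_smul, TruncPoly.smallExtension_t, ← pow_mul, mul_comm m]) hG
  rw [map_one, one_smul] at h
  exact ⟨_, h⟩

theorem ob_smallExtension_pow_mono {p : ℕ} [Fact p.Prime] {i j : ℕ} (h : i ≤ j) :
    (TruncPoly.smallExtension k (p ^ i)).ob T R ⊆
      (TruncPoly.smallExtension k (p ^ j)).ob T R := by
  obtain ⟨e, rfl⟩ := Nat.exists_eq_add_of_le h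
  exact ob_smallExtension_subset_mul (pow_add p i e).symm

/-- Substitute `b ε` with `bⁿ = c`; this uses that `k` is algebraically closed. -/
theorem smul_mem_ob_smallExtension [IsAlgClosed k] {n : ℕ} [NeZero n] {τ : T1 k T R}
    (h : τ ∈ (TruncPoly.smallExtension k n).ob T R) (c : k) :
    algebraMap k R c • τ ∈ (TruncPoly.smallExtension k n).ob T R := by
  obtain ⟨G, hG⟩ := h
  obtain ⟨b, hb⟩ := IsAlgClosed.exists_pow_nat_eq c (Nat.pos_of_ne_zero (NeZero.ne n))
  exact ⟨_, (TruncPoly.smallExtension k n).isObstruction_subst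
    (y' := b • TruncPoly.eps k (n + 1)) (c := c) (by
      rw [map_smul, TruncPoly.smallExtension_hom, TruncPoly.trunc_eps, smul_pow,
        TruncPoly.eps_pow_self, smul_zero]) (by
      rw [smul_pow, hb, TruncPoly.smallExtension_t]) hG⟩

end ObCurves

end SmallExtOb

namespace SmallExtOb

/-! ### Decomposition of elements of `HS^A(R)` into curves -/

section Decomposition

/-- Elements of `HS^A(R)` that are trivial modulo `J` are modulo `J' ⋖ J` values of truncated
curves whose length is at least that of the point at which they are evaluated. -/
def ApproximableByCurves (k : Type*) (p : ℕ) [Fact p.Prime] (A R : Type*) [Field k] [CommRing A]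
    [Algebra k A] [IsLocalRing A] [CommRing R] [Algebra k R] : Prop :=
  ∀ J' J : Ideal A, J' ⋖ J → J ≤ IsLocalRing.maximalIdeal A → ∀ D ∈ HS.congruence R J,
    ∃ (j : ℕ) (y : A) (_ : y ∈ J) (hy : y ^ p ^ (j + 1) = 0)
      (G : HS k (TruncPoly k (p ^ (j + 1))) R),
      (HS.subst y hy G)⁻¹ * D ∈ HS.congruence R J'

variable {k : Type*} [Field k] (p : ℕ) [Fact p.Prime]

theorem two_le_pow (j : ℕ) : 2 ≤ p ^ (j + 1) :=
  (Fact.out : p.Prime).two_le.trans (Nat.le_self_pow j.succ_ne_zero p)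

/-- Values of truncated curves at points of `J` generate the congruence subgroup of `J`. -/
theorem ApproximableByCurves.congruence_le {A R : Type*} [CommRing A]
    [Algebra k A] [IsLocalRing A] [IsArtinianRing A] [CommRing R] [Algebra k R]
    (H : ApproximableByCurves k p A R) (Q : Subgroup (HS k A R)) (J : Ideal A)
    (hJ : J ≤ IsLocalRing.maximalIdeal A)
    (hQ : ∀ (j : ℕ) (y : A) (_ : y ∈ J) (hy : y ^ p ^ (j + 1) = 0)
      (G : HS k (TruncPoly k (p ^ (j + 1))) R), HS.subst y hy G ∈ Q) :
    HS.congruence R J ≤ Q := by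
  induction J using WellFoundedLT.induction with
  | ind J ih =>
    by_cases h0 : J = ⊥
    · subst h0
      intro D hD
      rw [HS.eq_one_of_mem_congruence_bot hD]
      exact Q.one_mem
    · obtain ⟨J', hJ'⟩ := exists_covBy_of_wellFoundedGT (a := J) (by rwa [isMin_iff_eq_bot])
      have h1 := ih J' hJ'.lt (hJ'.le.trans hJ) fun j y hy ↦ hQ j y (hJ'.le hy)
      intro D hD
      obtain ⟨j, y, hyJ, hy, G, hG⟩ := H J' J hJ' hJ D hD
      have := Q.mul_mem (hQ j y hyJ hy G) (h1 hG)
      rwa [mul_inv_cancel_left] at this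

theorem map_covBy_map {A B : Type*} [CommRing A] [CommRing B] {f : A →+* B}
    (hf : Function.Surjective f) {J' J : Ideal A} (h : J' ⋖ J) (hk : RingHom.ker f ≤ J') :
    J'.map f ⋖ J.map f := by
  have h1 : ∀ I : Ideal A, RingHom.ker f ≤ I → (I.map f).comap f = I := fun I hI ↦ by
    rw [Ideal.comap_map_of_surjective f hf, ← RingHom.ker_eq_comap_bot, sup_eq_left.2 hI]
  refine ⟨lt_of_le_of_ne (Ideal.map_mono h.le) fun he ↦ h.lt.ne ?_, fun I hI hI' ↦ ?_⟩
  · rw [← h1 J' hk, he, h1 J (hk.trans h.le)]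
  · have h2 := Ideal.map_comap_of_surjective f hf I
    rcases h.eq_or_eq (c := I.comap f)
      (by rw [← h1 J' hk]; exact Ideal.comap_mono hI.le)
      (by rw [← h1 J (hk.trans h.le)]; exact Ideal.comap_mono hI'.le) with h3 | h3
    · rw [← h2, h3] at hI; exact hI.false
    · rw [← h2, h3] at hI'; exact hI'.false

variable {T R : Type*} [CommRing T] [CommRing R] [Algebra k T] [Algebra T R]
  [Algebra k R] [IsScalarTower k T R] [IsAlgClosed k] [CharP k p]

/-- If the obstruction of a curve of length `p ^ (j + 1) - 1` is that of a shorter one, then its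
first order part extends to length `p ^ (j + 2) - 1`. -/
theorem HS.exists_extension_of_isObstruction (hT : IsLocalizationOfPolynomial k T)
    (hTR : Function.Surjective (algebraMap T R)) {j : ℕ} {G : HS k (TruncPoly k (p ^ (j + 1))) R}
    {τ : T1 k T R} (hG : (TruncPoly.smallExtension k (p ^ (j + 1))).IsObstruction T R G τ)
    (hτ : τ ∈ (TruncPoly.smallExtension k (p ^ j)).ob T R) :
    ∃ G' : HS k (TruncPoly k (p ^ (j + 2))) R,
      HS.map (TruncPoly.trunc k (two_le_pow p (j + 1))) G' =
        HS.map (TruncPoly.trunc k (two_le_pow p j)) G := by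
  obtain ⟨F, hF⟩ := hτ
  have hp : 2 ≤ p := (Fact.out : p.Prime).two_le
  -- The obstruction of `F(εᵖ)` is again `τ`, so `G F(εᵖ)⁻¹` is unobstructed.
  have h1 := (TruncPoly.smallExtension k (p ^ (j + 1))).isObstruction_subst
    (y' := TruncPoly.eps k (p ^ (j + 1) + 1) ^ p) (c := 1) (by
      rw [map_pow, TruncPoly.smallExtension_hom, TruncPoly.trunc_eps, ← pow_mul, ← pow_succ',
        TruncPoly.eps_pow_self]) (by
      rw [one_smul, TruncPoly.smallExtension_t, ← pow_mul, ← pow_succ']) hF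
  rw [map_one, one_smul] at h1
  have h2 := hG.mul hTR (h1.inv hT hTR)
  rw [add_neg_cancel] at h2
  obtain ⟨G₁, hG₁⟩ := h2.exists_map_eq hTR
  -- Beyond `p ^ (j + 1)` nothing obstructs before the next power of `p`.
  obtain ⟨G₂, hG₂⟩ := HS.exists_extension_pow p hT hTR
    ((two_le_pow p j).trans (Nat.le_succ _)) G₁ (p ^ (j + 2))
    (Nat.pow_lt_pow_right hp (Nat.lt_succ_self _)) le_rfl
  refine ⟨G₂, hG₂.trans ?_⟩
  have h3 : HS.map (TruncPoly.trunc k ((two_le_pow p j).trans (Nat.le_succ _))) G₁ =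
      HS.map (TruncPoly.trunc k (two_le_pow p j))
        (HS.map (TruncPoly.smallExtension k (p ^ (j + 1))).hom G₁) := by
    refine Subtype.ext ?_
    rw [HS.coe_map, HS.coe_map, HS.coe_map, baseChange_baseChange]
    exact congrArg (fun h ↦ baseChange h G₁.1)
      (TruncPoly.algHom_ext (by simp [TruncPoly.smallExtension_hom]))
  rw [h3, hG₁, map_mul, map_inv, HS.map_subst, mul_eq_left, inv_eq_one]
  -- `F(εᵖ)` has no first order part because `p ≥ 2`.
  have h4 : TruncPoly.trunc k (two_le_pow p j)
      ((TruncPoly.smallExtension k (p ^ (j + 1))).hom (TruncPoly.eps k (p ^ (j + 1) + 1) ^ p)) =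
      0 := by
    rw [map_pow, TruncPoly.smallExtension_hom, TruncPoly.trunc_eps, map_pow, TruncPoly.trunc_eps,
      TruncPoly.eps_pow_eq_zero hp]
  simp only [h4]
  exact HS.subst_zero F

/-- As `t ∈ J'`, approximating `D` modulo `J'` can be done over `B`. The difficulty is that the
point `y` found there may satisfy `y^(p^(j+1)) = c t ≠ 0` in `A`. Either `y` can be moved within its
class modulo `J'` to a point where `G` is defined, or `G` can be replaced by a longer curve with the
same first order part. -/
theorem approximableByCurves_step (hT : IsLocalizationOfPolynomial k T)
    (hTR : Function.Surjective (algebraMap T R)) {A B : Type*} [CommRing A] [Algebra k A]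
    [IsLocalRing A] [IsArtinianRing A] [CommRing B] [Algebra k B] [IsLocalRing B]
    [IsArtinianRing B] (Φ : SmallExtension k A B) (hB : ApproximableByCurves k p B R)
    {J' J : Ideal A} (hJ : J' ⋖ J) (hJm : J ≤ IsLocalRing.maximalIdeal A) (ht : Φ.t ∈ J')
    {D : HS k A R} (hD : D ∈ HS.congruence R J) :
    ∃ (j : ℕ) (y : A) (_ : y ∈ J) (hy : y ^ p ^ (j + 1) = 0)
      (G : HS k (TruncPoly k (p ^ (j + 1))) R),
      (HS.subst y hy G)⁻¹ * D ∈ HS.congruence R J' := by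
  have hker : RingHom.ker (Φ.hom : A →+* B) ≤ J' := fun x hx ↦ by
    obtain ⟨c, rfl⟩ := (Φ.hom_eq_zero_iff x).1 hx
    rw [Algebra.smul_def]
    exact J'.mul_mem_left _ ht
  have hmap : J.map (Φ.hom : A →+* B) ≤ IsLocalRing.maximalIdeal B := by
    rw [Ideal.map_le_iff_le_comap]
    intro x hx hu
    exact hJm hx (isUnit_of_map_unit Φ.hom _ hu)
  obtain ⟨j, y', hyJ', hy', G, hG⟩ := hB _ _ (map_covBy_map Φ.surjective hJ hker) hmap
    (HS.map Φ.hom D) (HS.map_mem_congruence hD)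
  obtain ⟨y, hyJ, rfl⟩ := (Ideal.mem_map_iff_of_surjective (Φ.hom : A →+* B) Φ.surjective).1 hyJ'
  change Φ.hom y ^ _ = 0 at hy'
  change (HS.subst (Φ.hom y) hy' G)⁻¹ * _ ∈ _ at hG
  obtain ⟨c, hc⟩ := Φ.exists_eq_smul_t hy'
  -- reduction modulo `J'` of the point and of `D`
  let g : B →ₐ[k] A ⧸ J' := AlgHom.liftOfSurjective Φ.hom Φ.surjective (Ideal.Quotient.mkₐ k J')
    fun x hx ↦ Ideal.Quotient.eq_zero_iff_mem.2 (hker hx)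
  have hg : ∀ x, g (Φ.hom x) = Ideal.Quotient.mkₐ k J' x := fun x ↦
    AlgHom.liftOfSurjective_apply _ _ _ _ x
  have hgc : g.comp Φ.hom = Ideal.Quotient.mkₐ k J' := AlgHom.ext hg
  -- `J² ⊆ 𝔪 J ⊆ J'`, so modulo `J'` only the first order part of a curve matters at `y`.
  have hy2 : (Ideal.Quotient.mkₐ k J' y) ^ 2 = 0 := by
    rw [← map_pow, pow_two]
    exact Ideal.Quotient.eq_zero_iff_mem.2 (mul_mem_of_covBy hJ (hJm hyJ) hyJ)
  have hDJ : baseChange (Ideal.Quotient.mkₐ k J') D.1 =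
      baseChange (TruncPoly.eval (Ideal.Quotient.mkₐ k J' y)
        (pow_eq_zero_of_le (two_le_pow p j) hy2)) G.1 := by
    have h1 := HS.baseChange_eq_one hG (h := g) (by
      rw [Ideal.map_le_iff_le_comap]
      intro x hx
      change g (Φ.hom x) = 0
      rw [hg]
      exact Ideal.Quotient.eq_zero_iff_mem.2 hx)
    rw [Subgroup.coe_mul, map_mul, Subgroup.coe_inv, map_inv, inv_mul_eq_one, HS.coe_map,
      baseChange_baseChange, hgc, HS.coe_subst, baseChange_baseChange] at h1
    rw [← h1]
    exact congrArg (fun h ↦ baseChange h G.1) (TruncPoly.algHom_ext (by simp [hg]))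
  -- Any curve with the first order part of `G`, evaluated at any admissible point congruent to `y`
  -- modulo `J'`, is an acceptable answer.
  have key : ∀ (i : ℕ) (z : A) (hz : z ^ p ^ (i + 1) = 0) (G' : HS k (TruncPoly k (p ^ (i + 1))) R),
      y - z ∈ J' → HS.map (TruncPoly.trunc k (two_le_pow p i)) G' =
        HS.map (TruncPoly.trunc k (two_le_pow p j)) G →
      (HS.subst z hz G')⁻¹ * D ∈ HS.congruence R J' := by
    intro i z hz G' hyz hG'
    have h1 : Ideal.Quotient.mkₐ k J' y = Ideal.Quotient.mkₐ k J' z := Ideal.Quotient.eq.2 hyz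
    rw [HS.inv_mul_mem_congruence, hDJ, HS.coe_subst, baseChange_baseChange,
      baseChange_subst_eq (two_le_pow p j) (two_le_pow p i) hG'.symm hy2]
    exact congrArg (fun h ↦ baseChange h G'.1) (TruncPoly.algHom_ext (by simp [h1]))
  by_cases hex : ∃ z : A, y - z ∈ J' ∧ z ^ p ^ (j + 1) = 0
  · obtain ⟨z, hyz, hz⟩ := hex
    refine ⟨j, z, ?_, hz, G, key j z hz G hyz rfl⟩
    have := J.sub_mem hyJ (hJ.le hyz)
    rwa [sub_sub_cancel] at this
  push Not at hex
  have hc0 : c ≠ 0 := by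
    rintro rfl
    exact hex y (by simp) (by rw [hc, zero_smul])
  obtain ⟨τ, hτ⟩ := (TruncPoly.smallExtension k (p ^ (j + 1))).exists_isObstruction hT hTR G
  let V := (TruncPoly.smallExtension k (p ^ j)).obSubgroup (T := T) (R := R) hT hTR
  have hEob : Φ.IsObstruction T R ((HS.subst (Φ.hom y) hy' G)⁻¹ * HS.map Φ.hom D)
      (-(algebraMap k R c • τ)) := by
    have h1 := ((Φ.isObstruction_subst hy' hc hτ).inv hT hTR).mul hTR
      (Φ.isObstruction_map hT hTR D)
    rwa [add_zero] at h1
  -- By induction the congruence subgroup of `J' B` is generated by values `G'(z)` with `z ∈ J'`. It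
  -- contains the error `G(y)⁻¹ D`, whose obstruction is `-c ob(G)`, so it remains to bound the
  -- obstructions of the generators.
  have hEV : HS.congruence R (J'.map (Φ.hom : A →+* B)) ≤ Φ.obstructionIn hT hTR V := by
    refine hB.congruence_le p _ _ ((Ideal.map_mono hJ.le).trans hmap) ?_
    intro l z' hz'J hz' G'
    obtain ⟨z, hzJ, rfl⟩ := (Ideal.mem_map_iff_of_surjective (Φ.hom : A →+* B) Φ.surjective).1 hz'J
    change Φ.hom z ^ _ = 0 at hz'
    obtain ⟨d, hd⟩ := Φ.exists_eq_smul_t hz'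
    obtain ⟨σ, hσ⟩ := (TruncPoly.smallExtension k (p ^ (l + 1))).exists_isObstruction hT hTR G'
    refine ⟨_, ?_, Φ.isObstruction_subst hz' hd hσ⟩
    by_cases hd0 : d = 0
    · rw [hd0, map_zero, zero_smul]
      exact V.zero_mem
    -- Otherwise `z^(p^(l-j))`, suitably scaled, has the same `p ^ (j + 1)`-th power as `y`.
    -- Subtracting it moves `y` within its class to a point of the excluded kind.
    have hlj : l + 1 ≤ j := by
      by_contra! hlt
      obtain ⟨e, rfl⟩ := Nat.exists_eq_add_of_le (Nat.le_of_lt_succ hlt)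
      have : CharP A p := charP_of_injective_algebraMap (algebraMap k A).injective p
      obtain ⟨a, ha⟩ := IsAlgClosed.exists_pow_nat_eq (c / d)
        (Nat.pos_of_ne_zero (NeZero.ne (p ^ (j + 1))))
      refine hex (y - a • z ^ p ^ e) ?_ ?_
      · rw [sub_sub_cancel, Algebra.smul_def]
        exact J'.mul_mem_left _ (Ideal.pow_mem_of_mem J' hzJ _ (Nat.pos_of_ne_zero (NeZero.ne _)))
      · rw [sub_pow_char_pow, smul_pow, ha, ← pow_mul, ← pow_add, ← add_assoc, add_comm e j, hd,
          hc, smul_smul, div_mul_cancel₀ _ hd0, sub_self]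
    exact ob_smallExtension_pow_mono hlj (smul_mem_ob_smallExtension ⟨G', hσ⟩ d)
  obtain ⟨σ, hσV, hσ⟩ := hEV hG
  have hτV : τ ∈ (TruncPoly.smallExtension k (p ^ j)).ob T R := by
    rw [hσ.unique hT hTR hEob] at hσV
    have h1 : algebraMap k R c • τ ∈ (TruncPoly.smallExtension k (p ^ j)).ob T R :=
      V.neg_mem_iff.1 hσV
    have h2 := smul_mem_ob_smallExtension h1 c⁻¹
    rwa [smul_smul, ← map_mul, inv_mul_cancel₀ hc0, map_one, one_smul] at h2
  obtain ⟨G', hG'⟩ := HS.exists_extension_of_isObstruction p hT hTR hτ hτV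
  -- The longer curve can be evaluated at `y` itself, since `(c t)ᵖ = 0`.
  have hyz : y ^ p ^ (j + 1 + 1) = 0 := by
    rw [pow_succ p, pow_mul, hc, smul_pow,
      pow_eq_zero_of_le (Fact.out : p.Prime).two_le ((pow_two _).trans Φ.t_mul_t), smul_zero]
  exact ⟨j + 1, y, hyJ, hyz, G', key (j + 1) y hyz G' (by simp) hG'⟩

/-- Here `D = 1 + t ∂`. The derivation `∂` extends to length `p - 1` without obstruction, and `tᵖ =
0`. -/
theorem approximableByCurves_bot (hT : IsLocalizationOfPolynomial k T)
    (hTR : Function.Surjective (algebraMap T R)) {A B : Type*} [CommRing A] [Algebra k A]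
    [IsLocalRing A] [CommRing B] [Algebra k B] [IsLocalRing B]
    (Φ : SmallExtension k A B) {D : HS k A R} (hD : baseChange Φ.hom D.1 = 1) :
    ∃ (hy : Φ.t ^ p ^ 1 = 0) (G : HS k (TruncPoly k (p ^ 1)) R), HS.subst Φ.t hy G = D := by
  have hp : 2 ≤ p := (Fact.out : p.Prime).two_le
  have ht : Φ.t ^ 2 = 0 := (pow_two _).trans Φ.t_mul_t
  obtain ⟨d, hd⟩ := Φ.exists_eq_oneAdd hD
  -- The case `j = 0` of `HS.exists_extension_pow`: `p ^ 0 + 1 = 2`.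
  let F : HS k (TruncPoly k (p ^ 0 + 1)) R := ⟨oneAdd (TruncPoly.eps k _)
    ((pow_two _).symm.trans (TruncPoly.eps_pow_eq_zero (by simp))) d, oneAdd_mem_HS _ _⟩
  obtain ⟨G, hG⟩ := HS.exists_extension_pow p hT hTR (j := 0) (by simp) F (p ^ 1)
    (by simpa using hp) le_rfl
  refine ⟨pow_eq_zero_of_le (by simpa using hp) ht, G, Subtype.ext ?_⟩
  rw [HS.coe_subst, baseChange_subst_eq (by simpa using hp) (by simp) hG ht, hd, baseChange_oneAdd]
  exact oneAdd_congr (TruncPoly.eval_eps _ _) _ _ _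

/-- The induction passes from `A` to `A/(t)`. To make it well founded, all rings are quotients of a
fixed noetherian `A₀`, and the kernel grows strictly. -/
theorem approximableByCurves_aux (hT : IsLocalizationOfPolynomial k T)
    (hTR : Function.Surjective (algebraMap T R)) {A₀ : Type v} [CommRing A₀] [Algebra k A₀]
    [IsNoetherianRing A₀] (a : Ideal A₀) :
    ∀ (A : Type v) [CommRing A] [Algebra k A] [IsLocalRing A] [IsArtinianRing A]
      (_ : Function.Bijective (algebraMap k (IsLocalRing.ResidueField A)))
      (h : A₀ →ₐ[k] A), Function.Surjective h → RingHom.ker h = a →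
      ApproximableByCurves k p A R := by
  induction a using WellFoundedGT.induction with
  | ind a ih =>
    intro A _ _ _ _ hA h hh hker J' J hJ hJm D hD
    have quot : ∀ s ∈ IsLocalRing.maximalIdeal A, IsLocalRing (A ⧸ Ideal.span {s}) := fun s hs ↦ by
      have : Nontrivial (A ⧸ Ideal.span {s}) := Ideal.Quotient.nontrivial_iff.2 (by
        rwa [Ne, Ideal.span_singleton_eq_top])
      exact IsLocalRing.of_surjective' (Ideal.Quotient.mk _) Ideal.Quotient.mk_surjective
    by_cases h0 : J' = ⊥
    · subst h0
      obtain ⟨s, hsJ, hs0, hs⟩ := exists_smul_of_covBy hA hJ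
      have : IsLocalRing (A ⧸ Ideal.span {s}) := quot s (hJm hsJ)
      let Φ := SmallExtension.ofSocle hA (s := s) (by simpa using hs0) fun x hx ↦ by
        simpa using mul_mem_of_covBy hJ hx hsJ
      have hJs : J ≤ RingHom.ker Φ.hom := fun x hx ↦ by
        obtain ⟨c, hc⟩ := hs x hx
        exact (Φ.hom_eq_zero_iff x).2 ⟨c, sub_eq_zero.1 (show x - c • s = 0 by simpa using hc)⟩
      obtain ⟨hy, G, rfl⟩ := approximableByCurves_bot p hT hTR Φ (HS.baseChange_eq_one hD hJs)
      exact ⟨0, s, hsJ, hy, G, by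
        rw [show HS.subst s hy G = HS.subst Φ.t hy G from rfl, inv_mul_cancel]
        exact Subgroup.one_mem _⟩
    -- A minimal nonzero ideal inside `J'` is spanned by a socle element `t`.
    · obtain ⟨I, hI, hIJ⟩ := (bot_lt_iff_ne_bot.2 h0).exists_covby_le
      obtain ⟨t, htI, ht0, -⟩ := exists_smul_of_covBy hA hI
      have htm := hJm (hJ.le (hIJ htI))
      have : IsLocalRing (A ⧸ Ideal.span {t}) := quot t htm
      let Φ := SmallExtension.ofSocle hA (s := t) (by simpa using ht0) fun x hx ↦ by
        simpa using mul_mem_of_covBy hI hx htI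
      refine approximableByCurves_step p hT hTR Φ ?_ hJ hJm (hIJ htI) hD
      refine ih (RingHom.ker (Φ.hom.comp h)) ?_ _
        (bijective_residue_of_surjective hA Φ.surjective) _ (Φ.surjective.comp hh) rfl
      rw [← hker]
      refine lt_of_le_of_ne (fun x hx ↦ ?_) fun he ↦ ?_
      · rw [RingHom.mem_ker, AlgHom.comp_apply, show h x = 0 from hx, map_zero]
      · obtain ⟨x, hx⟩ := hh t
        have : x ∈ RingHom.ker (Φ.hom.comp h) := by
          rw [RingHom.mem_ker, AlgHom.comp_apply, hx]
          exact Φ.hom_t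
        rw [← he, RingHom.mem_ker, hx] at this
        exact ht0 (by simpa using this)

theorem approximableByCurves (hT : IsLocalizationOfPolynomial k T)
    (hTR : Function.Surjective (algebraMap T R)) {A : Type v} [CommRing A] [Algebra k A]
    [IsLocalRing A] [IsArtinianRing A]
    (hA : Function.Bijective (algebraMap k (IsLocalRing.ResidueField A))) :
    ApproximableByCurves k p A R :=
  approximableByCurves_aux p hT hTR _ A hA (AlgHom.id k A) Function.surjective_id rfl

/-- One inclusion is checked on the generators of `HS^A(R)`, the other by substituting a `q`-th root
of `t`. -/
theorem SmallExtension.ob_eq (hT : IsLocalizationOfPolynomial k T)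
    (hTR : Function.Surjective (algebraMap T R)) {A' A : Type*} [CommRing A'] [Algebra k A']
    [IsLocalRing A'] [IsArtinianRing A'] [CommRing A] [Algebra k A] [IsLocalRing A]
    [IsArtinianRing A] (hA : Function.Bijective (algebraMap k (IsLocalRing.ResidueField A)))
    (Φ : SmallExtension k A' A) :
    Φ.ob T R = (TruncPoly.smallExtension k (p ^ Φ.index p)).ob T R := by
  have hmax := Φ.isGreatest_index p (Fact.out : p.Prime).one_lt
  apply Set.Subset.antisymm
  · rintro τ ⟨D, hD⟩
    let V := (TruncPoly.smallExtension k (p ^ Φ.index p)).obSubgroup (T := T) (R := R) hT hTR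
    have h1 : HS.congruence R (IsLocalRing.maximalIdeal A) ≤ Φ.obstructionIn hT hTR V := by
      refine (approximableByCurves p hT hTR hA).congruence_le p _ _ le_rfl ?_
      intro l z' hz'm hz' G
      obtain ⟨z, rfl⟩ := Φ.surjective z'
      have hzm : z ∈ IsLocalRing.maximalIdeal A' := fun hu ↦ hz'm (hu.map Φ.hom)
      obtain ⟨d, hd⟩ := Φ.exists_eq_smul_t hz'
      obtain ⟨σ, hσ⟩ := (TruncPoly.smallExtension k (p ^ (l + 1))).exists_isObstruction hT hTR G
      refine ⟨_, ?_, Φ.isObstruction_subst hz' hd hσ⟩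
      by_cases hd0 : d = 0
      · rw [hd0, map_zero, zero_smul]
        exact V.zero_mem
      -- `z` itself shows that `p ^ (l + 1)` is an exponent of `Φ`.
      have hle : l + 1 ≤ Φ.index p := hmax.2 ⟨p ^ (l + 1),
        ⟨Nat.pos_of_ne_zero (NeZero.ne _), z, hzm, ⟨d, hd⟩, by
          rw [hd]; exact smul_ne_zero hd0 Φ.t_ne_zero⟩, dvd_rfl⟩
      exact ob_smallExtension_pow_mono hle (smul_mem_ob_smallExtension ⟨G, hσ⟩ d)
    obtain ⟨σ, hσV, hσ⟩ := h1 (HS.congruence_maximalIdeal D)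
    rw [hD.unique hT hTR hσ]
    exact hσV
  · rintro τ ⟨G, hG⟩
    obtain ⟨_, ⟨hn, x, hxm, ⟨c, hc⟩, hx0⟩, ⟨e, rfl⟩⟩ := hmax.1
    have hc0 : c ≠ 0 := by
      rintro rfl
      exact hx0 (by rw [hc, zero_smul])
    obtain ⟨a, ha⟩ := IsAlgClosed.exists_pow_nat_eq c⁻¹
      (Nat.pos_of_ne_zero (NeZero.ne (p ^ Φ.index p)))
    -- With `xⁿ = c t` and `n = q e`, the scalar `a` is a `q`-th root of `c⁻¹`.
    have hy : (a • x ^ e) ^ p ^ Φ.index p = (1 : k) • Φ.t := by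
      rw [smul_pow, ha, ← pow_mul, mul_comm e, hc, smul_smul, inv_mul_cancel₀ hc0]
    have hy' : Φ.hom (a • x ^ e) ^ p ^ Φ.index p = 0 := by rw [← map_pow, hy, one_smul, hom_t]
    have h := Φ.isObstruction_subst hy' hy hG
    rw [map_one, one_smul] at h
    exact ⟨_, h⟩

end Decomposition

end SmallExtOb

namespace SmallExtOb

/-! ### Hasse-Schmidt derivations and truncated polynomial rings -/

namespace TruncPoly

variable {k : Type*} [Field k] {m : ℕ}

/-- The coefficient of `εⁱ`. -/
def coef (k : Type*) [Field k] (m i : ℕ) : TruncPoly k m →ₗ[k] k :=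
  (Polynomial.lcoeff k i).comp (AdjoinRoot.modByMonicHom (Polynomial.monic_X_pow m))

theorem coef_mk {i : ℕ} (hi : i < m) (f : Polynomial k) :
    coef k m i (AdjoinRoot.mk _ f) = f.coeff i := by
  rw [coef, LinearMap.comp_apply, AdjoinRoot.modByMonicHom_mk, Polynomial.lcoeff_apply]
  conv_rhs => rw [← Polynomial.modByMonic_add_div f (Polynomial.X ^ m)]
  rw [Polynomial.coeff_add, Polynomial.coeff_X_pow_mul', if_neg (by omega), add_zero]

theorem coef_eq_zero {i : ℕ} (hi : m ≤ i) : coef k m i = 0 := by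
  refine LinearMap.ext fun x ↦ ?_
  obtain ⟨f, rfl⟩ := AdjoinRoot.mk_surjective x
  rw [coef, LinearMap.comp_apply, AdjoinRoot.modByMonicHom_mk, Polynomial.lcoeff_apply]
  refine Polynomial.coeff_eq_zero_of_degree_lt
    ((Polynomial.degree_modByMonic_lt f (Polynomial.monic_X_pow m)).trans_le ?_)
  rw [Polynomial.degree_X_pow]
  exact_mod_cast hi

theorem coef_eps_pow {i : ℕ} (hi : i < m) (j : ℕ) :
    coef k m i (eps k m ^ j) = if i = j then 1 else 0 := by
  rw [eps_pow, coef_mk hi, Polynomial.coeff_X_pow]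

theorem coef_mul {i : ℕ} (hi : i < m) (a b : TruncPoly k m) :
    coef k m i (a * b) = ∑ jl ∈ Finset.HasAntidiagonal.antidiagonal i,
      coef k m jl.1 a * coef k m jl.2 b := by
  obtain ⟨f, rfl⟩ := AdjoinRoot.mk_surjective a
  obtain ⟨g, rfl⟩ := AdjoinRoot.mk_surjective b
  rw [← map_mul, coef_mk hi, Polynomial.coeff_mul]
  refine Finset.sum_congr rfl fun jl hjl ↦ ?_
  have := Finset.HasAntidiagonal.mem_antidiagonal.1 hjl
  rw [coef_mk (by omega), coef_mk (by omega)]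

theorem eq_sum_coef (a : TruncPoly k m) :
    a = ∑ i ∈ Finset.range m, coef k m i a • eps k m ^ i := by
  obtain ⟨f, rfl⟩ := AdjoinRoot.mk_surjective a
  have h : ∀ i ∈ Finset.range m, coef k m i (AdjoinRoot.mk _ f) • eps k m ^ i =
      AdjoinRoot.mk _ (Polynomial.C (f.coeff i) * Polynomial.X ^ i) := fun i hi ↦ by
    rw [coef_mk (Finset.mem_range.1 hi), map_mul, ← eps_pow, Algebra.smul_def]
    rfl
  rw [Finset.sum_congr rfl h, ← map_sum, ← sub_eq_zero, ← map_sub, AdjoinRoot.mk_eq_zero,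
    Polynomial.X_pow_dvd_iff]
  intro d hd
  simp [Polynomial.finsetSum_coeff, Polynomial.coeff_C_mul, Polynomial.coeff_X_pow, hd]

section

variable {R : Type*} [CommRing R] [Algebra k R]

/-- The coefficient of `εⁱ` of an element of `k[ε]/εᵐ ⊗ R`. -/
def tcoef (m : ℕ) (R : Type*) [CommRing R] [Algebra k R] (i : ℕ) : TruncPoly k m ⊗[k] R →ₗ[k] R :=
  (TensorProduct.lid k R).toLinearMap ∘ₗ LinearMap.rTensor R (coef k m i)

@[simp]
theorem tcoef_tmul (i : ℕ) (a : TruncPoly k m) (r : R) :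
    tcoef m R i (a ⊗ₜ r) = coef k m i a • r := by
  simp [tcoef]

theorem eq_sum_tcoef (z : TruncPoly k m ⊗[k] R) :
    z = ∑ i ∈ Finset.range m, (eps k m ^ i) ⊗ₜ tcoef m R i z := by
  induction z with
  | zero => simp
  | add x y hx hy =>
    simp only [map_add, TensorProduct.tmul_add, Finset.sum_add_distrib]
    rw [← hx, ← hy]
  | tmul a r =>
    conv_lhs => rw [eq_sum_coef a, TensorProduct.sum_tmul]
    exact Finset.sum_congr rfl fun i _ ↦ by rw [tcoef_tmul, TensorProduct.smul_tmul]

theorem tensor_ext {z w : TruncPoly k m ⊗[k] R} (h : ∀ i < m, tcoef m R i z = tcoef m R i w) :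
    z = w := by
  rw [eq_sum_tcoef z, eq_sum_tcoef w]
  exact Finset.sum_congr rfl fun i hi ↦ by rw [h i (Finset.mem_range.1 hi)]

theorem tcoef_mul {i : ℕ} (hi : i < m) (z w : TruncPoly k m ⊗[k] R) :
    tcoef m R i (z * w) = ∑ jl ∈ Finset.HasAntidiagonal.antidiagonal i,
      tcoef m R jl.1 z * tcoef m R jl.2 w := by
  induction z with
  | zero => simp
  | add x y hx hy => simp only [add_mul, map_add, hx, hy, Finset.sum_add_distrib]
  | tmul a r =>
    induction w with
    | zero => simp
    | add x y hx hy => simp only [mul_add, map_add, hx, hy, Finset.sum_add_distrib]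
    | tmul b s =>
      simp only [Algebra.TensorProduct.tmul_mul_tmul, tcoef_tmul, coef_mul hi, Finset.sum_smul,
        smul_mul_smul_comm]

theorem tcoef_sum {i : ℕ} (hi : i < m) (c : ℕ → R) :
    tcoef m R i (∑ j ∈ Finset.range m, (eps k m ^ j) ⊗ₜ c j) = c i := by
  simp [map_sum, coef_eps_pow hi, hi]

theorem tcoef_tmap {S : Type*} [CommRing S] [Algebra k S] (u : R →ₐ[k] S) (i : ℕ)
    (z : TruncPoly k m ⊗[k] R) :
    tcoef m S i (tmap (AlgHom.id k _) u z) = u (tcoef m R i z) := by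
  induction z with
  | zero => simp
  | add x y hx hy => simp only [map_add, hx, hy]
  | tmul a r => simp

theorem tcoef_zero_of_residue [NeZero m] {z : TruncPoly k m ⊗[k] R}
    (hz : tmap (toResidue k (TruncPoly k m)) (AlgHom.id k R) z = 0) : tcoef m R 0 z = 0 := by
  have h := mem_maximalIdeal_smul_top hz
  clear hz
  induction h using Submodule.smul_induction_on' with
  | smul a ha y _ =>
    obtain ⟨b, rfl⟩ := exists_eq_eps_mul ha
    have h0 : coef k m 0 (eps k m) = 0 := by
      simpa using coef_eps_pow (k := k) (Nat.pos_of_ne_zero (NeZero.ne m)) 1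
    rw [← one_mul y, ← smul_mul_assoc, tcoef_mul (Nat.pos_of_ne_zero (NeZero.ne m)),
      Algebra.TensorProduct.one_def, TensorProduct.smul_tmul']
    simp [coef_mul (Nat.pos_of_ne_zero (NeZero.ne m)), h0]
  | add x _ y _ hx hy => rw [map_add, hx, hy, add_zero]

end

end TruncPoly

namespace HasseSchmidt

open SmallExtOb.TruncPoly

variable {k R : Type*} [Field k] [CommRing R] [Algebra k R] {n : ℕ}

/-- The linear map `r ↦ ∑ᵢ εⁱ ⊗ Dᵢ r`. -/
def toLin (D : HasseSchmidt k R n) : R →ₗ[k] TruncPoly k (n + 1) ⊗[k] R :=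
  ∑ i ∈ Finset.range (n + 1), (TensorProduct.mk k _ R (eps k (n + 1) ^ i)).comp (D.comp i)

theorem toLin_apply (D : HasseSchmidt k R n) (r : R) :
    D.toLin r = ∑ i ∈ Finset.range (n + 1), (eps k (n + 1) ^ i) ⊗ₜ D.comp i r := by
  simp [toLin]

theorem tcoef_toLin (D : HasseSchmidt k R n) {i : ℕ} (hi : i < n + 1) (r : R) :
    tcoef (n + 1) R i (D.toLin r) = D.comp i r := by
  rw [toLin_apply]
  exact tcoef_sum hi fun j ↦ D.comp j r

theorem toLin_mul (D : HasseSchmidt k R n) (r s : R) :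
    D.toLin (r * s) = D.toLin r * D.toLin s := by
  refine tensor_ext fun i hi ↦ ?_
  rw [tcoef_toLin D hi, tcoef_mul hi, D.leibniz i (by omega)]
  refine Finset.sum_congr rfl fun jl hjl ↦ ?_
  have := Finset.HasAntidiagonal.mem_antidiagonal.1 hjl
  rw [tcoef_toLin D (by omega), tcoef_toLin D (by omega)]

theorem residue_toLin (D : HasseSchmidt k R n) (r : R) :
    tmap (toResidue k (TruncPoly k (n + 1))) (AlgHom.id k R) (D.toLin r) = 1 ⊗ₜ r := by
  have h : IsLocalRing.residue (TruncPoly k (n + 1)) (eps k (n + 1)) = 0 := by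
    have : eps k (n + 1) ∈ IsLocalRing.maximalIdeal (TruncPoly k (n + 1)) := fun hu ↦ by
      have := hu.pow (n + 1)
      rw [eps_pow_self] at this
      exact not_isUnit_zero this
    rwa [← IsLocalRing.ker_residue] at this
  rw [toLin_apply, map_sum, Finset.sum_range_succ']
  simp [h, D.comp_zero]

/-- The element of `HS^{k[ε]/εⁿ⁺¹}(R)` that corresponds to a Hasse-Schmidt derivation. -/
def toHS (D : HasseSchmidt k R n) : HS k (TruncPoly k (n + 1)) R :=
  HS.mk (AlgHom.ofLinearMap D.toLin (by
    -- The image of `1` is idempotent, and a unit because its residue is `1`; hence it is `1`.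
    have h1 : IsUnit (D.toLin 1) :=
      isUnit_of_map_unit (tmap (toResidue k (TruncPoly k (n + 1))) (AlgHom.id k R)) _ (by
        rw [residue_toLin, ← Algebra.TensorProduct.one_def]
        exact isUnit_one)
    have h2 := D.toLin_mul 1 1
    rw [mul_one] at h2
    exact h1.mul_eq_left.1 h2.symm) D.toLin_mul) D.residue_toLin

theorem toHS_one_tmul (D : HasseSchmidt k R n) (r : R) : D.toHS.1 (1 ⊗ₜ r) = D.toLin r :=
  HS.mk_one_tmul _ _ r

theorem tcoef_toHS (D : HasseSchmidt k R n) {i : ℕ} (hi : i ≤ n) (r : R) :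
    tcoef (n + 1) R i (D.toHS.1 (1 ⊗ₜ r)) = D.comp i r := by
  rw [toHS_one_tmul, tcoef_toLin D (by omega)]

/-- The Hasse-Schmidt derivation that corresponds to an element of `HS^{k[ε]/εⁿ⁺¹}(R)`. -/
def ofHS (E : HS k (TruncPoly k (n + 1)) R) : HasseSchmidt k R n where
  comp i := (tcoef (n + 1) R i).comp (HS.toAlgHom E).toLinearMap
  comp_zero := LinearMap.ext fun r ↦ by
    have h := tcoef_zero_of_residue (z := E.1 (1 ⊗ₜ r) - 1 ⊗ₜ r) (by
      rw [map_sub, mem_HS_iff.1 E.2]; simp)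
    rw [map_sub, sub_eq_zero] at h
    refine h.trans ?_
    have h1 := coef_eps_pow (k := k) n.succ_pos 0
    rw [pow_zero, if_pos rfl] at h1
    rw [tcoef_tmul, h1, one_smul]
    rfl
  leibniz i hi x y := by
    simp only [LinearMap.comp_apply, AlgHom.toLinearMap_apply, map_mul]
    exact tcoef_mul (by omega) _ _
  comp_of_lt i hi := by
    rw [tcoef, coef_eq_zero (by omega)]
    simp

theorem ofHS_comp (E : HS k (TruncPoly k (n + 1)) R) (i : ℕ) (r : R) :
    (ofHS E).comp i r = tcoef (n + 1) R i (E.1 (1 ⊗ₜ r)) := rfl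

end HasseSchmidt

/-! ### `Ob^m` as the `Ob^Φ` of truncated polynomial rings -/

section

variable {k T R : Type*} [Field k] [CommRing T] [CommRing R] [Algebra k T] [Algebra T R]
  [Algebra k R] [IsScalarTower k T R]

/-- An automorphism that preserves the ideal of `A ⊗ R` modulo the kernel of `A' → A` descends. -/
theorem SmallExtension.exists_descent {A' A : Type*} [CommRing A'] [Algebra k A'] [IsLocalRing A']
    [IsArtinianRing A'] [CommRing A] [Algebra k A] [IsLocalRing A] [IsArtinianRing A]
    (Φ : SmallExtension k A' A) (hTR : Function.Surjective (algebraMap T R)) (E : HS k A' T)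
    (hE : ∀ x : relIdeal T R, tmap Φ.hom (pr k T R) (E.1 (1 ⊗ₜ (x : T))) = 0) :
    ∃ D : HS k A R, Lifts Φ.hom E.1 D.1 := by
  let φ : R →ₐ[k] A ⊗[k] R := AlgHom.liftOfSurjective (pr k T R) hTR
    ((tmap Φ.hom (pr k T R)).comp (HS.toAlgHom E)) fun x hx ↦ hE ⟨x, hx⟩
  have hφ : ∀ y : T, φ (algebraMap T R y) = tmap Φ.hom (pr k T R) (E.1 (1 ⊗ₜ y)) := fun y ↦
    AlgHom.liftOfSurjective_apply (pr k T R) hTR _ _ y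
  have hres : ∀ r, tmap (toResidue k A) (AlgHom.id k R) (φ r) = 1 ⊗ₜ r := fun r ↦ by
    obtain ⟨y, rfl⟩ := hTR r
    have h1 := mem_HS_iff.1 (HS.map Φ.hom E).2 y
    rw [HS.coe_map, baseChange_one_tmul, tmap_tmap] at h1
    have h2 := congrArg (tmap (AlgHom.id k _) (pr k T R)) h1
    rw [tmap_tmap] at h2
    rw [hφ, tmap_tmap]
    simpa using h2
  refine ⟨HS.mk φ hres, lifts_iff.2 fun y ↦ ?_⟩
  rw [HS.mk_one_tmul, hφ]

/-- A lift to `T` that sends `I` into `t ⊗ R` descends to `R` modulo `t`, so it determines `D`. This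
removes `D` from the comparison with `Ob^m`. -/
theorem SmallExtension.mem_ob_iff {A' A : Type*} [CommRing A'] [Algebra k A'] [IsLocalRing A']
    [IsArtinianRing A'] [CommRing A] [Algebra k A] [IsLocalRing A] [IsArtinianRing A]
    (Φ : SmallExtension k A' A) (hTR : Function.Surjective (algebraMap T R)) {τ : T1 k T R} :
    τ ∈ Φ.ob T R ↔ ∃ (E : HS k A' T) (f : ConormalDual T R),
      Φ.Induces E f ∧ T1.mk k T R f = τ := by
  constructor
  · rintro ⟨D, E, -, f, hf⟩
    exact ⟨E, f, hf⟩
  · rintro ⟨E, f, hf, rfl⟩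
    obtain ⟨D, hD⟩ := Φ.exists_descent hTR E fun x ↦ by
      have h := congrArg (tmap Φ.hom (AlgHom.id k R)) (hf x)
      rw [tmap_tmap, AlgHom.comp_id, AlgHom.id_comp] at h
      rw [h]
      simp
    exact ⟨D, E, hD, f, hf, rfl⟩

/-- A Hasse-Schmidt derivation of `T` that preserves `I` up to order `n` descends. -/
theorem HasseSchmidt.exists_descent (hTR : Function.Surjective (algebraMap T R)) {n : ℕ}
    (hn : n ≠ 0) (E : HasseSchmidt k T n)
    (hE : ∀ i < n, ∀ x : relIdeal T R, algebraMap T R (E.comp i x) = 0) :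
    ∃ D : HasseSchmidt k R (n - 1),
      ∀ i < n, ∀ x : T, algebraMap T R (E.comp i x) = D.comp i (algebraMap T R x) := by
  have h1 : ∀ i < n, ∃ d : R →ₗ[k] R, ∀ x, algebraMap T R (E.comp i x) = d (algebraMap T R x) := by
    intro i hi
    have h0 : ∀ x y, algebraMap T R x = algebraMap T R y →
        algebraMap T R (E.comp i x) = algebraMap T R (E.comp i y) := fun x y hxy ↦ by
      rw [← sub_eq_zero, ← map_sub, ← map_sub]
      exact hE i hi ⟨x - y, by rw [RingHom.mem_ker, map_sub, hxy, sub_self]⟩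
    have hs := Function.surjInv_eq hTR
    refine ⟨{ toFun := fun r ↦ algebraMap T R (E.comp i (Function.surjInv hTR r)),
              map_add' := fun r s ↦ ?_, map_smul' := fun c r ↦ ?_ }, fun x ↦ h0 _ _ (hs _).symm⟩
    · rw [← map_add, ← map_add]
      exact h0 _ _ (by rw [map_add, hs, hs, hs])
    · have h2 : ∀ (c : k) (y : T), algebraMap T R (c • y) = c • algebraMap T R y :=
        fun c y ↦ map_smul (pr k T R) c y
      rw [RingHom.id_apply, ← h2, ← map_smul]
      exact h0 _ _ (by rw [hs, h2, hs])
  choose! d hd using h1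
  -- The maps `d i` are unspecified for `i ≥ n`, hence the cut-off by zero.
  refine ⟨{ comp := fun i ↦ if i < n then d i else 0, comp_zero := ?_, leibniz := ?_,
            comp_of_lt := fun i hi ↦ if_neg (by omega) }, fun i hi x ↦ ?_⟩
  · rw [if_pos (Nat.pos_of_ne_zero hn)]
    refine LinearMap.ext fun r ↦ ?_
    obtain ⟨y, rfl⟩ := hTR r
    rw [← hd 0 (Nat.pos_of_ne_zero hn), E.comp_zero]
    rfl
  · intro i hi r s
    obtain ⟨x, rfl⟩ := hTR r
    obtain ⟨y, rfl⟩ := hTR s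
    rw [if_pos (by omega), ← map_mul, ← hd i (by omega), E.leibniz i (by omega), map_sum]
    refine Finset.sum_congr rfl fun jl hjl ↦ ?_
    have := Finset.HasAntidiagonal.mem_antidiagonal.1 hjl
    rw [if_pos (by omega), if_pos (by omega), map_mul, hd _ (by omega), hd _ (by omega)]
  · change _ = (if i < n then d i else 0) _
    rw [if_pos hi, hd i hi]

theorem mem_obHS_iff (hTR : Function.Surjective (algebraMap T R)) {n : ℕ} (hn : n ≠ 0)
    {τ : T1 k T R} :
    τ ∈ obHS k T R n ↔ ∃ E : HasseSchmidt k T n,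
      (∀ i < n, ∀ x : relIdeal T R, algebraMap T R (E.comp i x) = 0) ∧
      ∃ f : ConormalDual T R,
        (∀ x : relIdeal T R, algebraMap T R (E.comp n x) = f ((relIdeal T R).toCotangent x)) ∧
        T1.mk k T R f = τ := by
  constructor
  · rintro ⟨D, E, hE, f, hf⟩
    refine ⟨E, fun i hi x ↦ ?_, f, hf⟩
    have hx : algebraMap T R x = 0 := x.2
    rw [hE i hi, hx, map_zero]
  · rintro ⟨E, hE, f, hf⟩
    obtain ⟨D, hD⟩ := E.exists_descent hTR hn hE
    exact ⟨D, E, hD, f, hf⟩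

/-- `Ob^m` is `Ob^Φ` for the extension of truncated polynomial rings. -/
theorem obHS_eq_ob (hTR : Function.Surjective (algebraMap T R)) (n : ℕ) [NeZero n] :
    obHS k T R n = (TruncPoly.smallExtension k n).ob T R := by
  -- Comparison of coefficients. The components are abstracted to `c` so that both directions of the
  -- correspondence can use it.
  have key : ∀ (E : HS k (TruncPoly k (n + 1)) T) (c : ℕ → T → T)
      (_ : ∀ i ≤ n, ∀ x, TruncPoly.tcoef (n + 1) T i (E.1 (1 ⊗ₜ x)) = c i x)
      (f : ConormalDual T R), (TruncPoly.smallExtension k n).Induces E f ↔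
      (∀ i < n, ∀ x : relIdeal T R, algebraMap T R (c i x) = 0) ∧
        ∀ x : relIdeal T R, algebraMap T R (c n x) = f ((relIdeal T R).toCotangent x) := by
    intro E c hc f
    have hco : ∀ i ≤ n, ∀ x : T, TruncPoly.tcoef (n + 1) R i
        (tmap (AlgHom.id k _) (pr k T R) (E.1 (1 ⊗ₜ x))) = algebraMap T R (c i x) := fun i hi x ↦ by
      rw [TruncPoly.tcoef_tmap, hc i hi]
      rfl
    constructor
    · intro H
      refine ⟨fun i hi x ↦ ?_, fun x ↦ ?_⟩
      · rw [← hco i hi.le, H x, TruncPoly.smallExtension_t, TruncPoly.tcoef_tmul,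
          TruncPoly.coef_eps_pow (by omega), if_neg hi.ne, zero_smul]
      · rw [← hco n le_rfl, H x, TruncPoly.smallExtension_t, TruncPoly.tcoef_tmul,
          TruncPoly.coef_eps_pow (by omega), if_pos rfl, one_smul]
    · rintro ⟨H, H'⟩ x
      refine TruncPoly.tensor_ext fun i hi ↦ ?_
      rw [hco i (by omega), TruncPoly.smallExtension_t, TruncPoly.tcoef_tmul,
        TruncPoly.coef_eps_pow hi]
      split_ifs with h
      · rw [h, H', one_smul]
      · rw [H i (by omega), zero_smul]
  ext τ
  rw [mem_obHS_iff hTR (NeZero.ne n), SmallExtension.mem_ob_iff _ hTR]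
  constructor
  · rintro ⟨E, hE, f, hf, hτ⟩
    exact ⟨E.toHS, f, (key _ _ (fun i hi x ↦ E.tcoef_toHS hi x) f).2 ⟨hE, hf⟩, hτ⟩
  · rintro ⟨E, f, hf, hτ⟩
    obtain ⟨h1, h2⟩ := (key E _ (fun i hi x ↦ (HasseSchmidt.ofHS_comp E i x).symm) f).1 hf
    exact ⟨HasseSchmidt.ofHS E, h1, f, h2, hτ⟩

end

end SmallExtOb

namespace SmallExtOb

/-! ### Finiteness -/

section Finiteness

variable {k T R : Type*} [Field k] [CommRing T] [CommRing R] [Algebra k T] [Algebra T R]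
  [Algebra k R] [IsScalarTower k T R]

theorem T1.smul_def {R₀ : Type*} [CommRing R₀] [Algebra R₀ R] (r : R₀) (τ : T1 k T R) :
    r • τ = algebraMap R₀ R r • τ := rfl

instance T1.isScalarTower {R₀ : Type*} [CommRing R₀] [Algebra R₀ R] :
    IsScalarTower R₀ R (T1 k T R) :=
  ⟨fun r s τ ↦ by rw [T1.smul_def r, smul_smul, Algebra.smul_def]⟩

theorem isNoetherianRing_of_isLocalizationOfPolynomial (hT : IsLocalizationOfPolynomial k T) :
    IsNoetherianRing T := by
  obtain ⟨n, f, M, hf⟩ := hT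
  let _ := f.toRingHom.toAlgebra
  exact IsLocalization.isNoetherianRing M T inferInstance

/-- Values on finitely many generators of `I / I²` embed `Hom(I / I², R)` in a power of `R`. -/
instance T1.finite [IsNoetherianRing T] [IsNoetherianRing R] : Module.Finite R (T1 k T R) := by
  have : Module.Finite T (relIdeal T R).Cotangent :=
    Module.Finite.of_surjective (relIdeal T R).toCotangent (relIdeal T R).toCotangent_surjective
  obtain ⟨n, s, hs⟩ := Module.Finite.exists_fin (R := T) (M := (relIdeal T R).Cotangent)
  let e : ConormalDual T R →ₗ[R] (Fin n → R) :=
    { toFun := fun f i ↦ f (s i)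
      map_add' := fun f g ↦ rfl
      map_smul' := fun r f ↦ rfl }
  have he : Function.Injective e := fun f g h ↦
    LinearMap.ext_on_range hs fun i ↦ congrFun h i
  have := isNoetherian_of_injective e he
  exact Module.Finite.of_surjective (T1.mk k T R) T1.mk_surjective

/-- Multiplication of the `i`-th component by `aⁱ`. -/
def HasseSchmidt.scale {n : ℕ} (E : HasseSchmidt k R n) (a : R) : HasseSchmidt k R n where
  comp i := LinearMap.mulLeft k (a ^ i) ∘ₗ E.comp i
  comp_zero := by rw [E.comp_zero]; ext; simp
  leibniz i hi x y := by
    simp only [LinearMap.comp_apply, LinearMap.mulLeft_apply, E.leibniz i hi, Finset.mul_sum]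
    refine Finset.sum_congr rfl fun jl hjl ↦ ?_
    rw [← Finset.HasAntidiagonal.mem_antidiagonal.1 hjl, pow_add]
    ring
  comp_of_lt i hi := by rw [E.comp_of_lt i hi, LinearMap.comp_zero]

theorem HasseSchmidt.scale_comp {n : ℕ} (E : HasseSchmidt k R n) (a : R) (i : ℕ) (x : R) :
    (E.scale a).comp i x = a ^ i * E.comp i x := rfl

/-- Scaling the `i`-th component by `aⁱ`, with `a ∈ T` a lift of `r`, multiplies the last one by
`aⁿ`. -/
theorem pow_smul_mem_obHS (hTR : Function.Surjective (algebraMap T R)) {n : ℕ} (hn : n ≠ 0)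
    {τ : T1 k T R} (hτ : τ ∈ obHS k T R n) (r : R) : r ^ n • τ ∈ obHS k T R n := by
  rw [mem_obHS_iff hTR hn] at hτ ⊢
  obtain ⟨E, hE, f, hf, rfl⟩ := hτ
  obtain ⟨a, rfl⟩ := hTR r
  refine ⟨E.scale a, fun i hi x ↦ ?_, algebraMap T R a ^ n • f, fun x ↦ ?_, map_smul _ _ _⟩
  · rw [HasseSchmidt.scale_comp, map_mul, hE i hi, mul_zero]
  · rw [HasseSchmidt.scale_comp, map_mul, hf, map_pow, LinearMap.smul_apply, smul_eq_mul]

variable (p : ℕ) [Fact p.Prime] [CharP k p]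

/-- The module `Ob^q`, where `q = p ^ i`. -/
def obModule (hT : IsLocalizationOfPolynomial k T) (hTR : Function.Surjective (algebraMap T R))
    (i : ℕ) : Submodule (powSubring k p R i) (T1 k T R) where
  carrier := obHS k T R (p ^ i)
  zero_mem' := by
    rw [obHS_eq_ob hTR]
    exact ((TruncPoly.smallExtension k (p ^ i)).obSubgroup hT hTR).zero_mem
  add_mem' := by
    rw [obHS_eq_ob hTR]
    exact ((TruncPoly.smallExtension k (p ^ i)).obSubgroup hT hTR).add_mem
  smul_mem' := by
    rintro ⟨_, y, rfl⟩ τ hτ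
    exact pow_smul_mem_obHS hTR (NeZero.ne _) hτ y

variable (k R) in
/-- The surjection `R → R^q`, `y ↦ y^q`. -/
def powHom (i : ℕ) : R →+* powSubring k p R i where
  toFun y := ⟨y ^ p ^ i, y, rfl⟩
  map_one' := Subtype.ext (one_pow _)
  map_mul' x y := Subtype.ext (mul_pow _ _ _)
  map_zero' := Subtype.ext (zero_pow (NeZero.ne _))
  map_add' x y := Subtype.ext (by
    cases subsingleton_or_nontrivial R
    · exact Subsingleton.elim _ _
    · have : CharP R p := charP_of_injective_algebraMap (algebraMap k R).injective p
      exact add_pow_char_pow x y p i)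

theorem powHom_surjective (i : ℕ) : Function.Surjective (powHom k R p i) := by
  rintro ⟨_, y, rfl⟩
  exact ⟨y, rfl⟩

theorem isNoetherianRing_powSubring [IsNoetherianRing R] (i : ℕ) :
    IsNoetherianRing (powSubring k p R i) :=
  isNoetherianRing_of_surjective _ _ (powHom k R p i) (powHom_surjective p i)

/-- `R` is integral over `R^q` since `y^q ∈ R^q`, and of finite type over it: the image of `k` lies
in `R^q`, and inverting an element only requires inverting its `q`-th power. -/
theorem finite_powSubring [IsAlgClosed k] [Algebra.EssFiniteType k R] (i : ℕ) :
    Module.Finite (powSubring k p R i) R := by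
  obtain ⟨s, hs⟩ := (Algebra.essFiniteType_iff k R).1 inferInstance
  let C := Algebra.adjoin (powSubring k p R i) (s : Set R)
  have hpow : ∀ y : R, y ^ p ^ i ∈ C := fun y ↦
    C.algebraMap_mem (⟨y ^ p ^ i, y, rfl⟩ : powSubring k p R i)
  have hk : ∀ c : k, algebraMap k R c ∈ C := fun c ↦ by
    obtain ⟨b, rfl⟩ := IsAlgClosed.exists_pow_nat_eq c (Nat.pos_of_ne_zero (NeZero.ne (p ^ i)))
    rw [map_pow]
    exact hpow _
  have hB : ∀ b ∈ Algebra.adjoin k (s : Set R), b ∈ C := by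
    intro b hb
    induction hb using Algebra.adjoin_induction with
    | mem x hx => exact Algebra.subset_adjoin hx
    | algebraMap c => exact hk c
    | add x y _ _ hx hy => exact add_mem hx hy
    | mul x y _ _ hx hy => exact mul_mem hx hy
  have hC : C = ⊤ := by
    rw [eq_top_iff]
    rintro x -
    obtain ⟨u, hu, hu', hux⟩ := hs x
    obtain ⟨v, hv⟩ := hu'.exists_right_inv
    -- `v` inverts the denominator `u`, and `v^q` already lies in `R^q`.
    have h1 : x = v ^ p ^ i * (u ^ (p ^ i - 1) * (x * u)) := by
      have h2 : u ^ (p ^ i - 1) * u = u ^ p ^ i :=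
        pow_sub_one_mul (NeZero.ne _) u
      calc x = (u * v) ^ p ^ i * x := by rw [hv, one_pow, one_mul]
        _ = v ^ p ^ i * (u ^ (p ^ i - 1) * u * x) := by rw [h2]; ring
        _ = _ := by ring
    rw [h1]
    exact mul_mem (hpow v) (mul_mem (pow_mem (hB u hu) _) (hB _ hux))
  have h1 : Algebra.FiniteType (powSubring k p R i) R := ⟨s, hC⟩
  have h2 : Algebra.IsIntegral (powSubring k p R i) R := ⟨fun y ↦ by
    refine IsIntegral.of_pow (Nat.pos_of_ne_zero (NeZero.ne (p ^ i))) ?_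
    exact isIntegral_algebraMap (x := (⟨y ^ p ^ i, y, rfl⟩ : powSubring k p R i))⟩
  exact Algebra.IsIntegral.finite

/-- `T¹` is finite over `R`, hence over `R^q`, which is noetherian as an image of `R` under the
`q`-th power map. -/
theorem obModule_fg [IsAlgClosed k] [Algebra.EssFiniteType k R]
    (hT : IsLocalizationOfPolynomial k T) (hTR : Function.Surjective (algebraMap T R)) (i : ℕ) :
    (obModule p hT hTR i).FG := by
  have := isNoetherianRing_of_isLocalizationOfPolynomial hT
  have : IsNoetherianRing R := Algebra.EssFiniteType.isNoetherianRing k R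
  have := isNoetherianRing_powSubring (k := k) (R := R) p i
  have := finite_powSubring (k := k) (R := R) p i
  have : Module.Finite (powSubring k p R i) (T1 k T R) := Module.Finite.trans R _
  exact IsNoetherian.noetherian _

end Finiteness

end SmallExtOb

namespace SmallExtOb

/-! ### Localization -/

section Localization

variable {k T R T' R' : Type*} [Field k] [CommRing T] [CommRing R] [Algebra k T] [Algebra T R]
  [Algebra k R] [IsScalarTower k T R] [CommRing T'] [CommRing R'] [Algebra k T'] [Algebra T' R']
  [Algebra k R'] [IsScalarTower k T' R'] [Algebra T T'] [Algebra R R'] [IsScalarTower k T T']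
  [IsScalarTower k R R'] [Algebra T R'] [IsScalarTower T T' R'] [IsScalarTower T R R']

/-- The homomorphism `I / I² → R` given by a derivation. -/
theorem exists_mk_eq_zero (d : Derivation k T R) :
    ∃ f : ConormalDual T R, T1.mk k T R f = 0 ∧
      ∀ x : relIdeal T R, f ((relIdeal T R).toCotangent x) = d x := by
  refine ⟨conormalDualMap k T R (d.liftKaehlerDifferential.liftBaseChange R),
    T1.mk_eq_zero_iff.2 ⟨_, rfl⟩, fun x ↦ ?_⟩
  rw [conormalDualMap_toCotangent, LinearMap.liftBaseChange_tmul, one_smul,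
    Derivation.liftKaehlerDifferential_comp_D]

theorem IsLocalizationOfPolynomial.of_isLocalization (hT : IsLocalizationOfPolynomial k T)
    (S : Submonoid T) [IsLocalization S T'] : IsLocalizationOfPolynomial k T' := by
  obtain ⟨n, f, M, hf⟩ := hT
  let _ := f.toRingHom.toAlgebra
  let _ : Algebra (MvPolynomial (Fin n) k) T' :=
    (((IsScalarTower.toAlgHom k T T').comp f).toRingHom).toAlgebra
  have : IsScalarTower (MvPolynomial (Fin n) k) T T' := IsScalarTower.of_algebraMap_eq fun x ↦ rfl
  exact ⟨n, (IsScalarTower.toAlgHom k T T').comp f, _,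
    IsLocalization.localization_localization_isLocalization M S T'⟩

theorem algebraMap_algebraMap (x : T) :
    algebraMap T' R' (algebraMap T T' x) = algebraMap R R' (algebraMap T R x) := by
  rw [← IsScalarTower.algebraMap_apply, ← IsScalarTower.algebraMap_apply]

variable (T R T' R') in
/-- The localization map `I → I'`. -/
def relIdealMap : relIdeal T R →ₗ[T] relIdeal T' R' where
  toFun x := ⟨algebraMap T T' x, by
    have hx : algebraMap T R x = 0 := x.2
    rw [RingHom.mem_ker, algebraMap_algebraMap (R := R), hx, map_zero]⟩
  map_add' x y := Subtype.ext (map_add _ _ _)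
  map_smul' a x := Subtype.ext (by simp [Algebra.smul_def])

@[simp]
theorem coe_relIdealMap (x : relIdeal T R) :
    (relIdealMap T R T' R' x : T') = algebraMap T T' x := rfl

theorem algebraMap_surjective_of_isLocalization (S : Submonoid R) [IsLocalization S R']
    [IsLocalization (S.comap (algebraMap T R)) T'] (hTR : Function.Surjective (algebraMap T R)) :
    Function.Surjective (algebraMap T' R') := by
  intro r'
  obtain ⟨r, s, rfl⟩ := IsLocalization.exists_mk'_eq S r'
  obtain ⟨x, rfl⟩ := hTR r
  obtain ⟨σ, hσ⟩ := hTR s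
  have hσ' : σ ∈ S.comap (algebraMap T R) := by
    rw [Submonoid.mem_comap, hσ]
    exact s.2
  refine ⟨IsLocalization.mk' T' x (⟨σ, hσ'⟩ : S.comap (algebraMap T R)), ?_⟩
  rw [IsLocalization.eq_mk'_iff_mul_eq, ← hσ, ← algebraMap_algebraMap (T' := T') (x := σ),
    ← map_mul, IsLocalization.mk'_spec T' x (⟨σ, hσ'⟩ : S.comap (algebraMap T R)),
    algebraMap_algebraMap (R := R)]

theorem isUnit_algebraMap_end {M : Type*} [AddCommGroup M] [Module T M] [Module T' M]
    [IsScalarTower T T' M] (S : Submonoid T) [IsLocalization S T'] (σ : S) :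
    IsUnit (algebraMap T (Module.End T M) σ) := by
  have h := (IsLocalization.map_units T' σ).map (Algebra.lsmul T T M)
  convert h using 1
  ext x
  simp

/-- An `x ∈ T` that vanishes in `R'` is killed in `R` by some `s ∈ S`. Multiplied by a lift of `s`,
it lies in `I`; that lift belongs to the full preimage of `S`. -/
theorem isLocalizedModule_relIdealMap (S : Submonoid R) [IsLocalization S R']
    [IsLocalization (S.comap (algebraMap T R)) T'] (hTR : Function.Surjective (algebraMap T R)) :
    IsLocalizedModule (S.comap (algebraMap T R)) (relIdealMap T R T' R') where
  map_units σ := isUnit_algebraMap_end (T' := T') _ σ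
  surj x' := by
    obtain ⟨⟨x, σ⟩, hx⟩ := IsLocalization.surj (S.comap (algebraMap T R)) (x' : T')
    have h0 : algebraMap T' R' x' = 0 := x'.2
    have h1 := congrArg (algebraMap T' R') hx
    rw [map_mul, h0, zero_mul, algebraMap_algebraMap (R := R)] at h1
    obtain ⟨s, hs⟩ := (IsLocalization.map_eq_zero_iff S R' _).1 h1.symm
    obtain ⟨ρ, hρ⟩ := hTR s
    have hρ' : ρ ∈ S.comap (algebraMap T R) := by
      rw [Submonoid.mem_comap, hρ]
      exact s.2
    refine ⟨⟨⟨ρ * x, ?_⟩, ⟨ρ, hρ'⟩ * σ⟩, Subtype.ext ?_⟩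
    · rw [RingHom.mem_ker, map_mul, hρ, hs]
    · simp only [Submonoid.smul_def, Submodule.coe_smul_of_tower, Algebra.smul_def, coe_relIdealMap,
        Submonoid.coe_mul, map_mul]
      rw [← hx]
      ring
  exists_of_eq {x y} h := by
    obtain ⟨c, hc⟩ := IsLocalization.exists_of_eq (M := S.comap (algebraMap T R))
      (congrArg Subtype.val h)
    exact ⟨c, Subtype.ext hc⟩

/-- `f'` extends `f`. -/
def IsExtension (f : ConormalDual T R) (f' : ConormalDual T' R') : Prop :=
  ∀ x : relIdeal T R, f' ((relIdeal T' R').toCotangent (relIdealMap T R T' R' x)) =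
    algebraMap R R' (f ((relIdeal T R).toCotangent x))

theorem ConormalDual.ext_of_isLocalization (S : Submonoid R) [IsLocalization S R']
    [IsLocalization (S.comap (algebraMap T R)) T'] (hTR : Function.Surjective (algebraMap T R))
    {f g : ConormalDual T' R'}
    (h : ∀ x : relIdeal T R, f ((relIdeal T' R').toCotangent (relIdealMap T R T' R' x)) =
      g ((relIdeal T' R').toCotangent (relIdealMap T R T' R' x))) : f = g := by
  have := isLocalizedModule_relIdealMap (T' := T') (R' := R') S hTR
  have hb := (isLocalizedModule_iff_isBaseChange (S.comap (algebraMap T R)) T'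
    (relIdealMap T R T' R')).1 this
  have h1 : f.comp (relIdeal T' R').toCotangent = g.comp (relIdeal T' R').toCotangent :=
    hb.algHom_ext _ _ h
  exact ConormalDual.ext fun x ↦ LinearMap.congr_fun h1 x

theorem IsExtension.unique (S : Submonoid R) [IsLocalization S R']
    [IsLocalization (S.comap (algebraMap T R)) T'] (hTR : Function.Surjective (algebraMap T R))
    {f : ConormalDual T R} {f' f'' : ConormalDual T' R'} (h : IsExtension f f')
    (h' : IsExtension f f'') : f' = f'' :=
  ConormalDual.ext_of_isLocalization S hTR fun x ↦ by rw [h, h']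

/-- `I'` is the base change of `I`, so `I → R → R'` extends linearly. The extension kills `I'²`
because `I'` acts as zero on `R'`. -/
theorem exists_isExtension (S : Submonoid R) [IsLocalization S R']
    [IsLocalization (S.comap (algebraMap T R)) T'] (hTR : Function.Surjective (algebraMap T R))
    (f : ConormalDual T R) : ∃ f' : ConormalDual T' R', IsExtension f f' := by
  have := isLocalizedModule_relIdealMap (T' := T') (R' := R') S hTR
  have hb := (isLocalizedModule_iff_isBaseChange (S.comap (algebraMap T R)) T'
    (relIdealMap T R T' R')).1 this
  let g : relIdeal T R →ₗ[T] R' :=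
    (IsScalarTower.toAlgHom T R R').toLinearMap ∘ₗ f ∘ₗ (relIdeal T R).toCotangent
  refine ⟨Ideal.Cotangent.lift (hb.lift g) fun x y ↦ ?_, fun x ↦ ?_⟩
  · have hx : algebraMap T' R' x = 0 := x.2
    have : x * y = (x : T') • y := Subtype.ext (by simp)
    rw [this, map_smul, Algebra.smul_def, hx, zero_mul]
  · rw [Ideal.Cotangent.lift_toCotangent, hb.lift_eq]
    rfl

theorem exists_derivation_extension (S : Submonoid T) [IsLocalization S T']
    (d : Derivation k T R) :
    ∃ d' : Derivation k T' R', ∀ x, d' (algebraMap T T' x) = algebraMap R R' (d x) := by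
  have hb := (isLocalizedModule_iff_isBaseChange S T'
    (KaehlerDifferential.map k k T T')).1 inferInstance
  let g : Ω[T⁄k] →ₗ[T] R' :=
    (IsScalarTower.toAlgHom T R R').toLinearMap ∘ₗ d.liftKaehlerDifferential
  refine ⟨(hb.lift g).compDer (KaehlerDifferential.D k T'), fun x ↦ ?_⟩
  have h := hb.lift_eq g (KaehlerDifferential.D k T x)
  rw [KaehlerDifferential.map_D] at h
  refine h.trans ?_
  change algebraMap R R' (d.liftKaehlerDifferential _) = _
  rw [Derivation.liftKaehlerDifferential_comp_D]

theorem IsExtension.mk_eq_zero (S : Submonoid R) [IsLocalization S R']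
    [IsLocalization (S.comap (algebraMap T R)) T'] (hTR : Function.Surjective (algebraMap T R))
    {f : ConormalDual T R} {f' : ConormalDual T' R'} (h : IsExtension f f')
    (hf : T1.mk k T R f = 0) : T1.mk k T' R' f' = 0 := by
  obtain ⟨d, hd⟩ := T1.mk_eq_zero_iff_derivation.1 hf
  obtain ⟨d', hd'⟩ := exists_derivation_extension (T' := T') (R' := R')
    (S.comap (algebraMap T R)) d
  obtain ⟨g, hg0, hg⟩ := exists_mk_eq_zero d'
  rw [h.unique S hTR (f'' := g) fun x ↦ ?_, hg0]
  rw [hg, coe_relIdealMap, hd', hd]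

variable (k T R T' R') in
/-- There is a canonical map `T¹_{R/k} → T¹_{R'/k}`. -/
theorem exists_isLocalizationMap (S : Submonoid R) [IsLocalization S R']
    [IsLocalization (S.comap (algebraMap T R)) T'] (hTR : Function.Surjective (algebraMap T R)) :
    ∃ u : T1 k T R →ₗ[R] T1 k T' R', ∀ (f : ConormalDual T R) (f' : ConormalDual T' R'),
      IsExtension f f' → u (T1.mk k T R f) = T1.mk k T' R' f' := by
  -- Uniqueness of extensions makes the chosen map additive and semilinear.
  choose F hF using exists_isExtension (T' := T') (R' := R') S hTR
  have hadd : ∀ f g, F (f + g) = F f + F g := fun f g ↦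
    (hF _).unique S hTR fun x ↦ by simp [hF f x, hF g x]
  have hsmul : ∀ (r : R) f, F (r • f) = algebraMap R R' r • F f := fun r f ↦
    (hF _).unique S hTR fun x ↦ by simp [hF f x, Algebra.smul_def]
  let l : ConormalDual T R →ₗ[R] T1 k T' R' :=
    { toFun := fun f ↦ T1.mk k T' R' (F f)
      map_add' := fun f g ↦ by rw [hadd, map_add]
      map_smul' := fun r f ↦ by rw [hsmul, map_smul]; rfl }
  have hl : LinearMap.range (conormalDualMap k T R) ≤ LinearMap.ker l := by
    rintro _ ⟨g, rfl⟩
    exact (hF _).mk_eq_zero S hTR (T1.mk_eq_zero_iff.2 ⟨g, rfl⟩)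
  let q := (LinearMap.range (conormalDualMap k T R)).liftQ l hl
  refine ⟨{ toFun := q, map_add' := fun x y ↦ q.map_add x y,
            map_smul' := fun r x ↦ q.map_smul r x }, fun f f' hf ↦ ?_⟩
  rw [← (hF f).unique S hTR hf]
  rfl

end Localization

end SmallExtOb

namespace SmallExtOb

/-! ### The kernel of `T¹_{R/k} → T¹_{R'/k}` -/

section LocalizationKernel

variable {k T R T' R' : Type*} [Field k] [CommRing T] [CommRing R] [Algebra k T] [Algebra T R]
  [Algebra k R] [IsScalarTower k T R] [CommRing T'] [CommRing R'] [Algebra k T'] [Algebra T' R']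
  [Algebra k R'] [IsScalarTower k T' R'] [Algebra T T'] [Algebra R R'] [IsScalarTower k T T']
  [IsScalarTower k R R'] [Algebra T R'] [IsScalarTower T T' R'] [IsScalarTower T R R']

theorem TruncPoly.coef_zero_one {m : ℕ} (hm : 0 < m) : TruncPoly.coef k m 0 1 = 1 := by
  have h := TruncPoly.coef_eps_pow (k := k) hm 0
  rwa [pow_zero, if_pos rfl] at h

/-- Derivations with prescribed values on the coordinates. -/
theorem exists_derivation {n : ℕ} (f : MvPolynomial (Fin n) k →ₐ[k] T)
    {M : Submonoid (MvPolynomial (Fin n) k)}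
    (hf : @IsLocalization _ _ M T _ f.toRingHom.toAlgebra) (c : Fin n → R) :
    ∃ d : Derivation k T R, ∀ i, d (f (MvPolynomial.X i)) = c i := by
  have hres : ∀ z : R, tmap (toResidue k (TruncPoly k 2)) (AlgHom.id k R)
      (TruncPoly.eps k 2 ⊗ₜ z) = 0 := fun z ↦ by
    have : TruncPoly.eps k 2 ∈ IsLocalRing.maximalIdeal (TruncPoly k 2) := fun hu ↦ by
      have := hu.pow 2
      rw [TruncPoly.eps_pow_self] at this
      exact not_isUnit_zero this
    rw [← ker_toResidue (k := k)] at this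
    rw [Algebra.TensorProduct.map_tmul, this]
    simp
  -- A derivation is the `ε`-coefficient of a homomorphism `T → R[ε]/ε²` that lifts the projection.
  obtain ⟨φ, hφ, hφ'⟩ := exists_algHom_of_isLocalization f hf
    (tmap (toResidue k (TruncPoly k 2)) (AlgHom.id k R))
    (Algebra.TensorProduct.includeRight.comp (pr k T R))
    (fun i ↦ 1 ⊗ₜ pr k T R (f (MvPolynomial.X i)) + TruncPoly.eps k 2 ⊗ₜ c i)
    (fun i ↦ by rw [map_add, hres]; simp)
  have h0 : ∀ x, TruncPoly.tcoef 2 R 0 (φ x) = algebraMap T R x := fun x ↦ by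
    have h := TruncPoly.tcoef_zero_of_residue (z := φ x - 1 ⊗ₜ algebraMap T R x) (by
      have := DFunLike.congr_fun hφ' x
      rw [AlgHom.comp_apply] at this
      rw [map_sub, this]
      simp)
    rwa [map_sub, sub_eq_zero, TruncPoly.tcoef_tmul, TruncPoly.coef_zero_one two_pos, one_smul] at h
  refine ⟨Derivation.mk' ((TruncPoly.tcoef 2 R 1).comp φ.toLinearMap) fun x y ↦ ?_, fun i ↦ ?_⟩
  · simp only [LinearMap.comp_apply, AlgHom.toLinearMap_apply, map_mul]
    have h2 : Finset.HasAntidiagonal.antidiagonal 1 = {(0, 1), (1, 0)} := rfl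
    rw [TruncPoly.tcoef_mul one_lt_two, h2, Finset.sum_pair (by simp), h0, h0, Algebra.smul_def,
      Algebra.smul_def, mul_comm (TruncPoly.tcoef 2 R 1 (φ x))]
  · have h1 := TruncPoly.coef_eps_pow (k := k) one_lt_two 1
    have h2 := TruncPoly.coef_eps_pow (k := k) one_lt_two 0
    rw [pow_one, if_pos rfl] at h1
    rw [pow_zero, if_neg one_ne_zero] at h2
    change TruncPoly.tcoef 2 R 1 (φ _) = _
    rw [hφ, map_add, TruncPoly.tcoef_tmul, TruncPoly.tcoef_tmul, h1, h2, zero_smul, zero_add,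
      one_smul]

theorem derivation_ext_of_isLocalization {n : ℕ} (f : MvPolynomial (Fin n) k →ₐ[k] T)
    {M : Submonoid (MvPolynomial (Fin n) k)}
    (hf : @IsLocalization _ _ M T _ f.toRingHom.toAlgebra) {d e : Derivation k T R'}
    (h : ∀ i, d (f (MvPolynomial.X i)) = e (f (MvPolynomial.X i))) : d = e := by
  let _ := f.toRingHom.toAlgebra
  have h1 : ∀ y, d (f y) = e (f y) := fun y ↦ by
    let _ : Algebra (MvPolynomial (Fin n) k) R' := ((algebraMap T R').comp f.toRingHom).toAlgebra
    have : IsScalarTower (MvPolynomial (Fin n) k) T R' := IsScalarTower.of_algebraMap_eq fun x ↦ rfl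
    induction y using MvPolynomial.induction_on with
    | C a =>
      have : f (MvPolynomial.C a) = algebraMap k T a := f.commutes a
      rw [this, Derivation.map_algebraMap, Derivation.map_algebraMap]
    | add x y hx hy => rw [map_add, map_add, map_add, hx, hy]
    | mul_X x i hx => rw [map_mul, Derivation.leibniz, Derivation.leibniz, hx, h]
  ext x
  obtain ⟨⟨y, s⟩, hs⟩ := IsLocalization.surj M x
  have hs : x * f s = f y := hs
  have hu : IsUnit (algebraMap T R' (f s)) :=
    (IsLocalization.map_units T s).map (algebraMap T R')
  have h2 := h1 y
  rw [← hs, Derivation.leibniz, Derivation.leibniz, h1, add_right_inj, Algebra.smul_def,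
    Algebra.smul_def] at h2
  exact hu.mul_left_cancel h2

theorem exists_mul_eq_zero_of_isLocalization (S : Submonoid R) [IsLocalization S R'] {ι : Type*}
    [Finite ι] (r : ι → R) (hr : ∀ i, algebraMap R R' (r i) = 0) :
    ∃ s : S, ∀ i, s * r i = 0 := by
  have := Fintype.ofFinite ι
  choose s hs using fun i ↦ (IsLocalization.map_eq_zero_iff S R' (r i)).1 (hr i)
  refine ⟨∏ i, s i, fun i ↦ ?_⟩
  obtain ⟨c, hc⟩ := Finset.dvd_prod_of_mem s (Finset.mem_univ i)
  rw [hc, Submonoid.coe_mul, mul_right_comm, hs, zero_mul]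

/-- Let `f'` come from a derivation `d'`. A common denominator `b` of its values on the coordinates
gives a derivation `d : T → R` that localizes to `b d'`. Then `b f - d` vanishes in `R'`, and as `I`
is finitely generated a single `s` kills it. -/
theorem IsExtension.exists_smul_eq_zero (hT : IsLocalizationOfPolynomial k T) (S : Submonoid R)
    [IsLocalization S R'] (hTR : Function.Surjective (algebraMap T R))
    {f : ConormalDual T R} {f' : ConormalDual T' R'} (h : IsExtension f f')
    (hf : T1.mk k T' R' f' = 0) : ∃ s : S, (s : R) • T1.mk k T R f = 0 := by
  have := isNoetherianRing_of_isLocalizationOfPolynomial hT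
  obtain ⟨d', hd'⟩ := T1.mk_eq_zero_iff_derivation.1 hf
  obtain ⟨n, F, M, hF⟩ := hT
  obtain ⟨b, hb⟩ := IsLocalization.exist_integer_multiples_of_finite S
    fun i ↦ d' (algebraMap T T' (F (MvPolynomial.X i)))
  choose c hc using hb
  obtain ⟨d, hd⟩ := exists_derivation F hF c
  obtain ⟨σ, hσ⟩ := hTR b
  have : IsScalarTower k T R' := IsScalarTower.of_algebraMap_eq fun c ↦ by
    rw [IsScalarTower.algebraMap_apply T R R', ← IsScalarTower.algebraMap_apply k T R,
      ← IsScalarTower.algebraMap_apply k R R']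
  have h1 : (IsScalarTower.toAlgHom T R R').toLinearMap.compDer d = σ • d'.compAlgebraMap T :=
    derivation_ext_of_isLocalization F hF fun i ↦ by
      change algebraMap R R' (d _) = σ • d' (algebraMap T T' _)
      rw [hd, hc, ← hσ, algebraMap_smul]
  obtain ⟨g, hg0, hg⟩ := exists_mk_eq_zero d
  have h2 : ∀ x : relIdeal T R, algebraMap R R' (((b : R) • f - g) ((relIdeal T R).toCotangent x)) = 0 := by
    intro x
    have h3 : algebraMap R R' (d x) = σ • d' (algebraMap T T' x) := DFunLike.congr_fun h1 (x : T)
    rw [LinearMap.sub_apply, map_sub, hg, h3, LinearMap.smul_apply, smul_eq_mul, map_mul, ← h x,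
      hd', coe_relIdealMap, Algebra.smul_def, ← hσ, ← IsScalarTower.algebraMap_apply, sub_self]
  have : Module.Finite T (relIdeal T R).Cotangent :=
    Module.Finite.of_surjective (relIdeal T R).toCotangent (relIdeal T R).toCotangent_surjective
  obtain ⟨m, e, he⟩ := Module.Finite.exists_fin (R := T) (M := (relIdeal T R).Cotangent)
  obtain ⟨s, hs⟩ := exists_mul_eq_zero_of_isLocalization (R' := R') S
    (fun i ↦ ((b : R) • f - g) (e i)) fun i ↦ by
      obtain ⟨x, hx⟩ := (relIdeal T R).toCotangent_surjective (e i)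
      rw [← hx]
      exact h2 x
  have h3 : (s : R) • ((b : R) • f - g) = 0 := LinearMap.ext_on_range he fun i ↦ hs i
  have h4 := congrArg (T1.mk k T R) h3
  rw [map_smul, map_sub, hg0, sub_zero, map_smul, map_zero, smul_smul] at h4
  exact ⟨s * b, h4⟩

end LocalizationKernel

end SmallExtOb

namespace SmallExtOb

/-! ### `Ob^n` and localization -/

section LocalizationOb

variable {k T R T' R' : Type*} [Field k] [CommRing T] [CommRing R] [Algebra k T] [Algebra T R]
  [Algebra k R] [IsScalarTower k T R] [CommRing T'] [CommRing R'] [Algebra k T'] [Algebra T' R']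
  [Algebra k R'] [IsScalarTower k T' R'] [Algebra T T'] [Algebra R R'] [IsScalarTower k T T']
  [IsScalarTower k R R'] [Algebra T R'] [IsScalarTower T T' R'] [IsScalarTower T R R']

namespace HasseSchmidt

variable {m : ℕ}

/-- The first component that does not send `x` into `I` behaves linearly: all other Leibniz terms
contain a lower component of `x`. -/
theorem algebraMap_comp_mul (E : HasseSchmidt k T m) {j : ℕ} (hj : j ≤ m) {x : T}
    (hx : ∀ i < j, algebraMap T R (E.comp i x) = 0) (y : T) :
    algebraMap T R (E.comp j (y * x)) = algebraMap T R y * algebraMap T R (E.comp j x) := by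
  rw [E.leibniz j hj, map_sum, Finset.sum_eq_single (0, j)]
  · rw [map_mul, E.comp_zero, LinearMap.id_apply]
  · intro jl hjl hne
    have h := Finset.HasAntidiagonal.mem_antidiagonal.1 hjl
    rw [map_mul, hx jl.2, mul_zero]
    refine lt_of_le_of_ne (by omega) fun h0 ↦ hne (Prod.ext ?_ h0)
    change jl.1 = 0
    omega
  · intro h
    exact absurd (Finset.HasAntidiagonal.mem_antidiagonal.2 (zero_add j)) h

/-- It suffices to check on generators of `I` that a Hasse-Schmidt derivation preserves `I`. -/
theorem algebraMap_comp_eq_zero (E : HasseSchmidt k T m) {n : ℕ} (hn : n ≤ m + 1) {s : Set T}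
    (hs : Ideal.span s = relIdeal T R) (h : ∀ x ∈ s, ∀ j < n, algebraMap T R (E.comp j x) = 0)
    (x : relIdeal T R) : ∀ j < n, algebraMap T R (E.comp j x) = 0 := by
  obtain ⟨x, hx⟩ := x
  have hxs : x ∈ Ideal.span s := hs ▸ hx
  change ∀ j < n, algebraMap T R (E.comp j x) = 0
  clear hx
  induction hxs using Submodule.span_induction with
  | mem x hx => exact h x hx
  | zero => simp
  | add x y _ _ hx hy => intro j hj; rw [map_add, map_add, hx j hj, hy j hj, add_zero]
  | smul a x _ hx =>
    intro j hj
    rw [smul_eq_mul, E.algebraMap_comp_mul (by omega) fun i hi ↦ hx i (by omega), hx j hj,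
      mul_zero]

/-- A Hasse-Schmidt derivation that preserves `I` up to order `m` induces a homomorphism. -/
theorem exists_conormalDual (E : HasseSchmidt k T m)
    (hE : ∀ i < m, ∀ x : relIdeal T R, algebraMap T R (E.comp i x) = 0) :
    ∃ f : ConormalDual T R,
      ∀ x : relIdeal T R, algebraMap T R (E.comp m x) = f ((relIdeal T R).toCotangent x) := by
  let g : relIdeal T R →ₗ[T] R :=
    { toFun := fun x ↦ algebraMap T R (E.comp m x)
      map_add' := fun x y ↦ by simp
      map_smul' := fun a x ↦ by
        rw [RingHom.id_apply, Algebra.smul_def]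
        exact E.algebraMap_comp_mul le_rfl (fun i hi ↦ hE i hi x) a }
  refine ⟨Ideal.Cotangent.lift g fun x y ↦ ?_, fun x ↦ ?_⟩
  · have hx : algebraMap T R x = 0 := x.2
    have : x * y = (x : T) • y := Subtype.ext (by simp)
    rw [this, map_smul, Algebra.smul_def, hx, zero_mul]
  · rw [Ideal.Cotangent.lift_toCotangent]
    rfl

/-- The element of `k[ε]/εᵐ⁺¹ ⊗ T` with given coefficients reduces to its constant term. -/
theorem _root_.SmallExtOb.TruncPoly.residue_sum (c : ℕ → T) :
    tmap (toResidue k (TruncPoly k (m + 1))) (AlgHom.id k T)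
      (∑ j ∈ Finset.range (m + 1), (TruncPoly.eps k (m + 1) ^ j) ⊗ₜ c j) = 1 ⊗ₜ c 0 := by
  have h : IsLocalRing.residue (TruncPoly k (m + 1)) (TruncPoly.eps k (m + 1)) = 0 := by
    have : TruncPoly.eps k (m + 1) ∈ IsLocalRing.maximalIdeal (TruncPoly k (m + 1)) := fun hu ↦ by
      have := hu.pow (m + 1)
      rw [TruncPoly.eps_pow_self] at this
      exact not_isUnit_zero this
    rwa [← IsLocalRing.ker_residue] at this
  rw [map_sum, Finset.sum_range_succ']
  simp [h]

/-- Hasse-Schmidt derivations with prescribed values on the coordinates. -/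
theorem exists_comp_eq {n : ℕ} (f : MvPolynomial (Fin n) k →ₐ[k] T)
    {M : Submonoid (MvPolynomial (Fin n) k)}
    (hf : @IsLocalization _ _ M T _ f.toRingHom.toAlgebra) (m : ℕ) (a : Fin n → ℕ → T)
    (ha : ∀ i, a i 0 = f (MvPolynomial.X i)) :
    ∃ D : HasseSchmidt k T m, ∀ i, ∀ j ≤ m, D.comp j (f (MvPolynomial.X i)) = a i j := by
  obtain ⟨φ, hφ, hφ'⟩ := exists_algHom_of_isLocalization f hf
    (tmap (toResidue k (TruncPoly k (m + 1))) (AlgHom.id k T))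
    Algebra.TensorProduct.includeRight
    (fun i ↦ ∑ j ∈ Finset.range (m + 1), (TruncPoly.eps k (m + 1) ^ j) ⊗ₜ a i j)
    (fun i ↦ by rw [TruncPoly.residue_sum, ha]; rfl)
  have hres : ∀ r, tmap (toResidue k (TruncPoly k (m + 1))) (AlgHom.id k T) (φ r) = 1 ⊗ₜ r :=
    fun r ↦ DFunLike.congr_fun hφ' r
  refine ⟨ofHS (HS.mk φ hres), fun i j hj ↦ ?_⟩
  rw [ofHS_comp, HS.mk_one_tmul, hφ, TruncPoly.tcoef_sum (by omega)]

theorem algebraMap_comp_eq_of_coordinates {n : ℕ} (f : MvPolynomial (Fin n) k →ₐ[k] T)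
    {M : Submonoid (MvPolynomial (Fin n) k)}
    (hf : @IsLocalization _ _ M T _ f.toRingHom.toAlgebra) (D : HasseSchmidt k T m)
    (E : HasseSchmidt k T' m) (h : ∀ i, ∀ j ≤ m, algebraMap T T' (D.comp j (f (MvPolynomial.X i))) =
      E.comp j (algebraMap T T' (f (MvPolynomial.X i)))) {j : ℕ} (hj : j ≤ m) (x : T) :
    algebraMap T T' (D.comp j x) = E.comp j (algebraMap T T' x) := by
  have h1 : (tmap (AlgHom.id k _) (pr k T T')).comp (HS.toAlgHom D.toHS) =
      (HS.toAlgHom E.toHS).comp (pr k T T') :=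
    algHom_ext_of_isLocalization f hf fun i ↦ TruncPoly.tensor_ext fun j hj ↦ by
      rw [AlgHom.comp_apply, TruncPoly.tcoef_tmap, AlgHom.comp_apply, HS.toAlgHom_apply,
        HS.toAlgHom_apply, tcoef_toHS _ (by omega), tcoef_toHS _ (by omega)]
      exact h i j (by omega)
  have h2 := congrArg (TruncPoly.tcoef (m + 1) T' j) (DFunLike.congr_fun h1 x)
  rw [AlgHom.comp_apply, TruncPoly.tcoef_tmap, AlgHom.comp_apply, HS.toAlgHom_apply,
    HS.toAlgHom_apply, tcoef_toHS _ hj, tcoef_toHS _ hj] at h2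
  exact h2

/-- Hasse-Schmidt derivations extend to localizations. -/
theorem exists_extension (S : Submonoid T) [IsLocalization S T'] (E : HasseSchmidt k T m) :
    ∃ E' : HasseSchmidt k T' m, ∀ j ≤ m, ∀ x,
      E'.comp j (algebraMap T T' x) = algebraMap T T' (E.comp j x) := by
  let φ := (tmap (AlgHom.id k _) (pr k T T')).comp (HS.toAlgHom E.toHS)
  have hres : ∀ x, tmap (toResidue k (TruncPoly k (m + 1))) (AlgHom.id k T') (φ x) =
      1 ⊗ₜ algebraMap T T' x := fun x ↦ by
    have h1 := congrArg (tmap (AlgHom.id k _) (pr k T T')) (mem_HS_iff.1 E.toHS.2 x)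
    rw [tmap_tmap] at h1
    rw [AlgHom.comp_apply, HS.toAlgHom_apply, tmap_tmap]
    simpa using h1
  have hu : ∀ s : S, IsUnit (φ s) := fun s ↦ by
    refine isUnit_of_map_unit (tmap (toResidue k (TruncPoly k (m + 1))) (AlgHom.id k T')) _ ?_
    rw [hres]
    exact (IsLocalization.map_units T' s).map
      (Algebra.TensorProduct.includeRight : T' →ₐ[k] IsLocalRing.ResidueField _ ⊗[k] T')
  let ψ : T' →ₐ[k] TruncPoly k (m + 1) ⊗[k] T' := IsLocalization.liftAlgHom (M := S) hu
  have hψ : ∀ x, ψ (algebraMap T T' x) = φ x := fun x ↦ IsLocalization.lift_eq hu x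
  have hψ' : (tmap (toResidue k (TruncPoly k (m + 1))) (AlgHom.id k T')).comp ψ =
      Algebra.TensorProduct.includeRight := by
    refine AlgHom.coe_ringHom_injective (IsLocalization.ringHom_ext S (RingHom.ext fun x ↦ ?_))
    exact (congrArg _ (hψ x)).trans (hres x)
  have hres' : ∀ r, tmap (toResidue k (TruncPoly k (m + 1))) (AlgHom.id k T') (ψ r) = 1 ⊗ₜ r :=
    fun r ↦ DFunLike.congr_fun hψ' r
  refine ⟨ofHS (HS.mk ψ hres'), fun j hj x ↦ ?_⟩
  rw [ofHS_comp, HS.mk_one_tmul, hψ, AlgHom.comp_apply, TruncPoly.tcoef_tmap, HS.toAlgHom_apply,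
    tcoef_toHS _ hj]
  rfl

end HasseSchmidt

theorem isUnit_of_mem_comap (S : Submonoid R) [IsLocalization S R']
    (σ : S.comap (algebraMap T R)) : IsUnit (algebraMap T R' σ) := by
  rw [IsScalarTower.algebraMap_apply T R R']
  exact IsLocalization.map_units R' (⟨_, σ.2⟩ : S)

/-- Localization maps `Ob^n` to `Ob^n`. -/
theorem IsExtension.mk_mem_obHS (S : Submonoid R) [IsLocalization S R']
    [IsLocalization (S.comap (algebraMap T R)) T'] (hTR : Function.Surjective (algebraMap T R))
    {n : ℕ} (hn : n ≠ 0) {E : HasseSchmidt k T n}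
    (hE : ∀ i < n, ∀ x : relIdeal T R, algebraMap T R (E.comp i x) = 0)
    {f : ConormalDual T R} {f' : ConormalDual T' R'} (h : IsExtension f f')
    (hf : ∀ x : relIdeal T R, algebraMap T R (E.comp n x) = f ((relIdeal T R).toCotangent x)) :
    T1.mk k T' R' f' ∈ obHS k T' R' n := by
  have hTR' := algebraMap_surjective_of_isLocalization (T' := T') (R' := R') S hTR
  have hloc := isLocalizedModule_relIdealMap (T' := T') (R' := R') S hTR
  obtain ⟨E', hE'⟩ := E.exists_extension (T' := T') (S.comap (algebraMap T R))
  have h0 : ∀ i < n, ∀ x' : relIdeal T' R', algebraMap T' R' (E'.comp i x') = 0 := by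
    intro i
    induction i using Nat.strong_induction_on with
    -- The components of `E'` are not linear, so a denominator can be pulled out only once all lower
    -- components vanish on `I'`.
    | _ i ih =>
      intro hi x'
      obtain ⟨⟨x, σ⟩, hx⟩ := IsLocalizedModule.surj (S.comap (algebraMap T R))
        (relIdealMap T R T' R') x'
      have hx1 : algebraMap T T' σ * (x' : T') = algebraMap T T' x := by
        rw [← Algebra.smul_def]
        exact congrArg Subtype.val hx
      have h1 := E'.algebraMap_comp_mul (R := R') (x := (x' : T')) hi.le
        (fun l hl ↦ ih l hl (by omega) x') (algebraMap T T' σ)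
      rw [hx1, hE' i hi.le, algebraMap_algebraMap (R := R), hE i hi, map_zero,
        ← IsScalarTower.algebraMap_apply] at h1
      exact ((isUnit_of_mem_comap S σ).mul_right_eq_zero).1 h1.symm
  rw [mem_obHS_iff hTR' hn]
  obtain ⟨g, hg⟩ := E'.exists_conormalDual h0
  refine ⟨E', h0, g, hg, ?_⟩
  rw [h.unique S hTR (f'' := g) fun x ↦ ?_]
  rw [← hg, coe_relIdealMap, hE' n le_rfl, algebraMap_algebraMap (R := R), hf]

/-- Elements of `Ob^n` of a localization are fractions. -/
theorem exists_pow_smul_eq (hT : IsLocalizationOfPolynomial k T) (S : Submonoid R)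
    [IsLocalization S R'] [IsLocalization (S.comap (algebraMap T R)) T']
    (hTR : Function.Surjective (algebraMap T R)) {n : ℕ} (hn : n ≠ 0)
    {τ' : T1 k T' R'} (hτ' : τ' ∈ obHS k T' R' n) :
    ∃ s : S, ∃ (f : ConormalDual T R) (f' : ConormalDual T' R'), IsExtension f f' ∧
      T1.mk k T R f ∈ obHS k T R n ∧ T1.mk k T' R' f' = (s : R) ^ n • τ' := by
  have hTR' := algebraMap_surjective_of_isLocalization (T' := T') (R' := R') S hTR
  have := isNoetherianRing_of_isLocalizationOfPolynomial hT
  obtain ⟨E', hE', f', hf', rfl⟩ := (mem_obHS_iff hTR' hn).1 hτ'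
  obtain ⟨N, F, M, hF⟩ := hT
  -- `σ` clears the denominators of every component on every coordinate.
  obtain ⟨σ, hσ⟩ := IsLocalization.exist_integer_multiples_of_finite (S.comap (algebraMap T R))
    fun ij : Fin N × Fin (n + 1) ↦ E'.comp ij.2 (algebraMap T T' (F (MvPolynomial.X ij.1)))
  choose c hc using hσ
  -- These are the values of `σʲ E'_j`, written as `σ^(j-1)` times the integral `σ E'_j`. Component
  -- zero is separate, since it must be the identity. For `j ≤ n` the index in `Fin (n + 1)` does
  -- not wrap around.
  let a : Fin N → ℕ → T := fun i j ↦
    if j = 0 then F (MvPolynomial.X i) else σ ^ (j - 1) * c (i, Fin.ofNat (n + 1) j)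
  obtain ⟨D, hD⟩ := HasseSchmidt.exists_comp_eq F hF n a fun i ↦ if_pos rfl
  have hDE : ∀ j ≤ n, ∀ x, algebraMap T T' (D.comp j x) =
      algebraMap T T' σ ^ j * E'.comp j (algebraMap T T' x) := fun j hj x ↦ by
    refine HasseSchmidt.algebraMap_comp_eq_of_coordinates F hF D (E'.scale (algebraMap T T' σ))
      (fun i j hj ↦ ?_) hj x
    rw [hD i j hj, HasseSchmidt.scale_comp]
    rcases j with - | j
    · rw [pow_zero, one_mul, E'.comp_zero]
      rfl
    · change algebraMap T T' (σ ^ j * c (i, Fin.ofNat (n + 1) (j + 1))) = _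
      have hj' : ((Fin.ofNat (n + 1) (j + 1) : Fin (n + 1)) : ℕ) = j + 1 :=
        Nat.mod_eq_of_lt (by omega)
      rw [map_mul, hc, hj', Algebra.smul_def, map_pow, pow_succ, mul_assoc]
  have hDI : ∀ j < n, ∀ x : relIdeal T R, algebraMap R R' (algebraMap T R (D.comp j x)) = 0 := by
    intro j hj x
    rw [← algebraMap_algebraMap (T' := T'), hDE j hj.le, map_mul, ← coe_relIdealMap (R' := R') (T' := T') x,
      hE' j hj, mul_zero]
  obtain ⟨G, hG⟩ := (IsNoetherian.noetherian (relIdeal T R))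
  have hGI : ∀ x ∈ G, x ∈ relIdeal T R := fun x hx ↦ hG ▸ Submodule.subset_span hx
  -- The components of `D` below `n` preserve `I` only after localization; `s` repairs this on
  -- generators of `I`.
  obtain ⟨s, hs⟩ := exists_mul_eq_zero_of_isLocalization (R' := R') S
    (fun xj : G × Fin n ↦ algebraMap T R (D.comp xj.2 xj.1))
    fun xj ↦ hDI xj.2 xj.2.2 ⟨xj.1, hGI _ xj.1.2⟩
  obtain ⟨ρ, hρ⟩ := hTR s
  have hD2 : ∀ j < n, ∀ x : relIdeal T R, algebraMap T R ((D.scale ρ).comp j x) = 0 :=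
    fun j hj x ↦ (D.scale ρ).algebraMap_comp_eq_zero (n := n) (by omega) hG (fun x hx j hj ↦ by
      rw [HasseSchmidt.scale_comp, map_mul, map_pow, hρ]
      -- Scaling by `ρ⁰ = 1` does nothing in order zero, but there the component is the identity.
      rcases j with - | j
      · have : algebraMap T R x = 0 := hGI x hx
        rw [D.comp_zero, LinearMap.id_apply, this, mul_zero]
      · rw [pow_succ, mul_assoc, hs (⟨x, hx⟩, ⟨j + 1, hj⟩), mul_zero]) x j hj
  obtain ⟨g, hg⟩ := (D.scale ρ).exists_conormalDual hD2
  refine ⟨s * ⟨_, σ.2⟩, g, algebraMap R R' ((s * ⟨_, σ.2⟩ : S) : R) ^ n • f', fun x ↦ ?_,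
    (mem_obHS_iff hTR hn).2 ⟨_, hD2, g, hg, rfl⟩, ?_⟩
  · rw [← hg, HasseSchmidt.scale_comp, map_mul, map_mul, map_pow, hρ,
      ← algebraMap_algebraMap (T' := T') (D.comp n x), hDE n le_rfl, map_mul,
      ← coe_relIdealMap (R' := R') (T' := T') x, hf', LinearMap.smul_apply, smul_eq_mul, Submonoid.coe_mul, map_mul,
      map_pow, map_pow, algebraMap_algebraMap (T' := T') (R := R) (σ : T), mul_pow, mul_assoc]
  · rw [map_smul, T1.smul_def (R := R') ((_ : R) ^ n), map_pow]

end LocalizationOb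

end SmallExtOb

namespace SmallExtOb

/-! ### `Ob^q` as a localized `R^q`-module -/

section LocalizationModule

variable {k T R T' R' : Type*} [Field k] [CommRing T] [CommRing R] [Algebra k T] [Algebra T R]
  [Algebra k R] [IsScalarTower k T R] [CommRing T'] [CommRing R'] [Algebra k T'] [Algebra T' R']
  [Algebra k R'] [IsScalarTower k T' R'] [Algebra T T'] [Algebra R R'] [IsScalarTower k T T']
  [IsScalarTower k R R'] [Algebra T R'] [IsScalarTower T T' R'] [IsScalarTower T R R']
  (p : ℕ) [Fact p.Prime] [CharP k p]

/-- `Ob^q` of an `R`-algebra, as an `R^q`-module. -/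
def obModuleOver (R : Type*) [CommRing R] [Algebra k R] [Algebra R R'] [IsScalarTower k R R']
    (hT' : IsLocalizationOfPolynomial k T')
    (hTR' : Function.Surjective (algebraMap T' R')) (i : ℕ) :
    Submodule (powSubring k p R i) (T1 k T' R') where
  carrier := obHS k T' R' (p ^ i)
  zero_mem' := (obModule p hT' hTR' i).zero_mem
  add_mem' := (obModule p hT' hTR' i).add_mem
  smul_mem' := by
    rintro ⟨_, y, rfl⟩ τ hτ
    have h := pow_smul_mem_obHS hTR' (NeZero.ne _) hτ (algebraMap R R' y)
    rwa [← map_pow] at h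

theorem pow_mem_powSubmonoid {S : Submonoid R} (s : S) (i : ℕ) :
    (⟨(s : R) ^ p ^ i, s, rfl⟩ : powSubring k p R i) ∈ powSubmonoid k p i S :=
  ⟨s, s.2, rfl⟩

theorem isLocalizedModule_obModule (hT : IsLocalizationOfPolynomial k T) (S : Submonoid R)
    [IsLocalization S R'] [IsLocalization (S.comap (algebraMap T R)) T']
    (hTR : Function.Surjective (algebraMap T R)) (hT' : IsLocalizationOfPolynomial k T')
    (hTR' : Function.Surjective (algebraMap T' R')) (i : ℕ)
    {u : T1 k T R →ₗ[R] T1 k T' R'} (hu : ∀ (f : ConormalDual T R) (f' : ConormalDual T' R'),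
      IsExtension f f' → u (T1.mk k T R f) = T1.mk k T' R' f') :
    ∃ g : obModule p hT hTR i →ₗ[powSubring k p R i] obModuleOver (T' := T') (R' := R') p R hT' hTR' i,
      (∀ x, (g x : T1 k T' R') = u x) ∧ IsLocalizedModule (powSubmonoid k p i S) g := by
  have hmem : ∀ τ ∈ obHS k T R (p ^ i), u τ ∈ obHS k T' R' (p ^ i) := fun τ hτ ↦ by
    obtain ⟨E, hE, f, hf, rfl⟩ := (mem_obHS_iff hTR (NeZero.ne _)).1 hτ
    obtain ⟨f', hf'⟩ := exists_isExtension (T' := T') (R' := R') S hTR f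
    rw [hu f f' hf']
    exact hf'.mk_mem_obHS S hTR (NeZero.ne _) hE hf
  let g : obModule p hT hTR i →ₗ[powSubring k p R i]
      obModuleOver (T' := T') (R' := R') p R hT' hTR' i :=
    { toFun := fun x ↦ ⟨u x, hmem _ x.2⟩
      map_add' := fun x y ↦ Subtype.ext (u.map_add x y)
      map_smul' := fun r x ↦ Subtype.ext (u.map_smul (r : R) x) }
  refine ⟨g, fun x ↦ rfl, ⟨?_, ?_, ?_⟩⟩
  -- The inverse of `s^q` on `Ob^q` of `R'` is `w^q`, where `w` inverts `s` in `R'`; this `Ob^q` is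
  -- stable under `q`-th powers from `R'`.
  · rintro ⟨⟨r, hr⟩, s, hs, hsr⟩
    obtain rfl : s ^ p ^ i = r := hsr
    obtain ⟨w, hw⟩ := (IsLocalization.map_units R' (⟨s, hs⟩ : S)).exists_left_inv
    have hw1 : w ^ p ^ i * algebraMap R R' (s ^ p ^ i) = 1 := by
      rw [map_pow, ← mul_pow, hw, one_pow]
    have hw2 : algebraMap R R' (s ^ p ^ i) * w ^ p ^ i = 1 := by rw [mul_comm, hw1]
    rw [Module.End.isUnit_iff]
    constructor
    · intro x y hxy
      have h1 : algebraMap R R' (s ^ p ^ i) • (x : T1 k T' R') =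
        algebraMap R R' (s ^ p ^ i) • (y : T1 k T' R') := congrArg Subtype.val hxy
      have h2 := congrArg (w ^ p ^ i • ·) h1
      simp only [smul_smul, hw1, one_smul] at h2
      exact Subtype.ext h2
    · intro y
      refine ⟨⟨w ^ p ^ i • (y : T1 k T' R'), pow_smul_mem_obHS hTR' (NeZero.ne _) y.2 w⟩,
        Subtype.ext ?_⟩
      change algebraMap R R' (s ^ p ^ i) • w ^ p ^ i • (y : T1 k T' R') = y
      rw [smul_smul, hw2, one_smul]
  · rintro ⟨y, hy⟩
    obtain ⟨s, f, f', hff', hf, hf'⟩ :=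
      exists_pow_smul_eq (T := T) (T' := T') hT S hTR (NeZero.ne (p ^ i)) hy
    refine ⟨⟨⟨_, hf⟩, ⟨_, pow_mem_powSubmonoid p s i⟩⟩, Subtype.ext ?_⟩
    change (s : R) ^ p ^ i • y = u (T1.mk k T R f)
    rw [hu f f' hff', hf']
  · intro x y hxy
    obtain ⟨f, hf⟩ := T1.mk_surjective (x - y : T1 k T R)
    obtain ⟨f', hf'⟩ := exists_isExtension (T' := T') (R' := R') S hTR f
    have h1 : u x = u y := congrArg Subtype.val hxy
    obtain ⟨s, hs⟩ := hf'.exists_smul_eq_zero hT S hTR (by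
      rw [← hu f f' hf', hf, map_sub, h1, sub_self])
    refine ⟨⟨_, pow_mem_powSubmonoid p s i⟩, Subtype.ext ?_⟩
    change (s : R) ^ p ^ i • (x : T1 k T R) = (s : R) ^ p ^ i • (y : T1 k T R)
    -- If `s` kills the difference, so does `s^q = s^(q-1) s`.
    rw [← sub_eq_zero, ← smul_sub, ← hf, ← pow_sub_one_mul (NeZero.ne (p ^ i)), mul_smul, hs,
      smul_zero]

end LocalizationModule

end SmallExtOb

end

/-! ### The theorem -/

theorem theorem3p24 {k : Type*} [Field k] [IsAlgClosed k] (p : ℕ) [Fact p.Prime] [CharP k p]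
    -- an algebra `R` essentially of finite type, presented as `T / I`
    {R : Type*} [CommRing R] [Algebra k R] [Algebra.EssFiniteType k R]
    {T : Type*} [CommRing T] [Algebra k T] [Algebra T R] [IsScalarTower k T R]
    (hT : SmallExtOb.IsLocalizationOfPolynomial k T)
    (hTR : Function.Surjective (algebraMap T R))
    -- a small extension of local artinian `k`-algebras with residue field `k`
    {A' : Type*} [CommRing A'] [Algebra k A'] [IsLocalRing A'] [IsArtinianRing A']
    (hA' : Function.Bijective (algebraMap k (IsLocalRing.ResidueField A')))
    {A : Type*} [CommRing A] [Algebra k A] [IsLocalRing A] [IsArtinianRing A]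
    (hA : Function.Bijective (algebraMap k (IsLocalRing.ResidueField A)))
    (Φ : SmallExtOb.SmallExtension k A' A) :
    -- `Ob^Φ_R = Ob^q_R` with `q = p ^ i(Φ)`
    Φ.ob T R = SmallExtOb.obHS k T R (p ^ Φ.index p) ∧
    -- it is a finite `R^q`-module
    ∃ N : Submodule (SmallExtOb.powSubring k p R (Φ.index p)) (SmallExtOb.T1 k T R),
      (N : Set (SmallExtOb.T1 k T R)) = Φ.ob T R ∧ N.FG ∧
      -- and `(S^q)⁻¹ Ob^Φ_R = Ob^Φ_{S⁻¹R}` along the canonical map `T¹_{R/k} → T¹_{S⁻¹R/k}`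
      ∀ (S : Submonoid R)
        (R' : Type v) [CommRing R'] [Algebra k R'] [Algebra R R'] [IsScalarTower k R R']
        [IsLocalization S R']
        (T' : Type w) [CommRing T'] [Algebra k T'] [Algebra T T'] [IsScalarTower k T T']
        [IsLocalization (S.comap (algebraMap T R)) T']
        [Algebra T' R'] [IsScalarTower k T' R'],
        (∀ x : T, algebraMap T' R' (algebraMap T T' x) = algebraMap R R' (algebraMap T R x)) →
        ∃ u : SmallExtOb.T1 k T R →ₗ[R] SmallExtOb.T1 k T' R',
          SmallExtOb.IsLocalizationMap k u ∧
          ∃ N' : Submodule (SmallExtOb.powSubring k p R (Φ.index p)) (SmallExtOb.T1 k T' R'),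
            (N' : Set (SmallExtOb.T1 k T' R')) = Φ.ob T' R' ∧
            ∃ g : N →ₗ[SmallExtOb.powSubring k p R (Φ.index p)] N',
              (∀ x : N, (g x : SmallExtOb.T1 k T' R') = u x) ∧
              IsLocalizedModule (SmallExtOb.powSubmonoid k p (Φ.index p) S) g := by
  have hob := Φ.ob_eq p hT hTR hA
  have hob' := SmallExtOb.obHS_eq_ob (k := k) hTR (p ^ Φ.index p)
  refine ⟨hob.trans hob'.symm, SmallExtOb.obModule p hT hTR (Φ.index p), hob'.trans hob.symm,
    SmallExtOb.obModule_fg p hT hTR _, ?_⟩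
  intro S R' _ _ _ _ _ T' _ _ _ _ _ _ _ hcomm
  -- Only a commuting square is given; its diagonal supplies the scalar towers used above.
  let _ : Algebra T R' := ((algebraMap T' R').comp (algebraMap T T')).toAlgebra
  have : IsScalarTower T T' R' := IsScalarTower.of_algebraMap_eq fun x ↦ rfl
  have : IsScalarTower T R R' := IsScalarTower.of_algebraMap_eq hcomm
  have hT' : SmallExtOb.IsLocalizationOfPolynomial k T' :=
    hT.of_isLocalization (S.comap (algebraMap T R))
  have hTR' : Function.Surjective (algebraMap T' R') :=
    SmallExtOb.algebraMap_surjective_of_isLocalization S hTR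
  obtain ⟨u, hu⟩ := SmallExtOb.exists_isLocalizationMap k T R T' R' S hTR
  refine ⟨u, fun f ↦ ?_, SmallExtOb.obModuleOver p R hT' hTR' (Φ.index p),
    (SmallExtOb.obHS_eq_ob hTR' _).trans (Φ.ob_eq p hT' hTR' hA).symm,
    SmallExtOb.isLocalizedModule_obModule p hT S hTR hT' hTR' _ hu⟩
  obtain ⟨f', hf'⟩ := SmallExtOb.exists_isExtension (T' := T') (R' := R') S hTR f
  refine ⟨f', fun x x' hx ↦ ?_, hu f f' hf'⟩
  rw [← hf' x]
  congr 2
  exact Subtype.ext hx
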